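/- Fix dimensions $n,m$. Consider $x_{t+1}=Ax_t+w_t$, $y_t=Cx_t+v_t$ with $x_t\in\mathbb R^n$, $y_t\in\mathbb R^m$, where $x_0\sim\mathcal N(\bar x_0,X_0)$, $w_t\sim\mathcal N(0,W)$, $v_t\sim\mathcal N(0,V)$ ($t\ge 0$) are independent, $X_0,W,V\succ0$, $\bar x_0\ne0$ and $(C,A)$ is observable; let also $\theta_0\sim\mathcal N(0,\Theta)$, $\Theta\succ0$, be independent of everything else. Let $\Sigma^*\succ0$ be the positive definite solution of $$\Sigma=A\Sigma A^\top-A\Sigma C^\top(V+C\Sigma C^\top)^{-1}C\Sigma A^\top+W,$$ and let $L^*=A\Sigma^*C^\top(V+C\Sigma^*C^\top)^{-1}$ and $(A_L^*,B_L^*)=(A-L^*C,\,L^*)$ be the infinite-horizon Kalman filter. Write $\|\cdot\|$ for the spectral norm, $\rho$ for the spectral radius, $\kappa_{\Sigma^*}$ for the condition number of $\Sigma^*$, and $\|X\|_*^2=\max_{z\ne0}\frac{z^\top X^\top\Sigma^*Xz}{z^\top\Sigma^*z}$ for the $\Sigma^*$-induced norm. Given filters $\pi_t=(A_{L_t},B_{L_t})\in\mathbb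 R^{n\times n}\times\mathbb R^{n\times m}$ for $t<h$, let $\mathcal J_h(A_{L_h},B_{L_h})=\mathbb E\sum_{t=0}^{h+1}\|x_t-\hat x_t\|^2$, where $\hat x_0=\bar x_0$, $\hat x_{t+1}=A_{L_t}\hat x_t+B_{L_t}y_t$ and $x_{t+1}=Ax_t+w_t$, $y_t=Cx_t+v_t$, except that $\theta_0$ is added to both $x_h$ and $\hat x_h$. For any previous filters and any $h\ge0$, $\mathcal J_h$ has a unique minimizer. There is a polynomial $p$, depending only on $n$ and $m$, such that for every such system the value $\bar p>0$ of $p$ at the system parameters $\|A\|,\|C\|,\|W\|,\|W^{-1}\|,\|V\|,\|V^{-1}\|,\|X_0\|,\|X_0^{-1}\|,\|\Theta\|,\|\Theta^{-1}\|,\|\bar x_0\|,\|\Sigma^*\|$ has the following property. Let $r<1$ be either $\|(A_L^*)^\top\|_*$ (which is always $<1$) or $\|A_L^*\|_*$ (if it is $<1$), let $\epsilon>0$, and let $N\ge1$ be an integer with $N\ge N_0(\epsilon/\bar p)$, where $$N_0(\delta)=\frac12\cdot\frac{\log\Big(\frac{\|X_0-\Sigma^*\|_*\,\kappa_{\Sigma^*}\,\|A_L^*\|\,\|C\|}{\delta\,\lambda_{\min}(V)}\Big)}{\log(1/r)}+1$$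 (with $N_0(\delta)=1$ in the degenerate cases $X_0=\Sigma^*$ and $A_L^*=0$). Suppose that filters $(\tilde A_{L_h},\tilde B_{L_h})$, $h=0,\dots,N-1$, satisfy $$\|\tilde A_{L_h}-\tilde A_{L_h}^*\|\le\frac{\min(\epsilon,1)}{\bar p},\qquad \|\tilde B_{L_h}-\tilde B_{L_h}^*\|\le\frac{\min(\epsilon,1)}{\bar p},$$ where $(\tilde A_{L_h}^*,\tilde B_{L_h}^*)$ is the unique minimizer of $\mathcal J_h$ when the filters at the times $t<h$ are the previously computed $(\tilde A_{L_t},\tilde B_{L_t})$. Then $$\big\|[\tilde A_{L_{N-1}}\ \ \tilde B_{L_{N-1}}]-[A_L^*\ \ B_L^*]\big\|\le\epsilon,$$ and if moreover $\epsilon<1-r$, then $\rho(\tilde A_{L_{N-1}})<1$. -/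

import Mathlib

open MeasureTheory ProbabilityTheory Matrix
open scoped Matrix.Norms.L2Operator

noncomputable section

namespace RHPG

/-- The data of the filtering problem `x (t+1) = A x t + w t`, `y t = C x t + v t`, with
`w t ∼ N(0, W)`, `v t ∼ N(0, V)`, `x 0 ∼ N(xbar0, X0)`, together with the covariance `Theta` of the
Gaussian perturbation `θ₀ ∼ N(0, Theta)` that is injected in the subproblems. -/
structure KFSystem (n m : ℕ) where
  A : Matrix (Fin n) (Fin n) ℝ
  C : Matrix (Fin m) (Fin n) ℝ
  W : Matrix (Fin n) (Fin n) ℝ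
  V : Matrix (Fin m) (Fin m) ℝ
  X0 : Matrix (Fin n) (Fin n) ℝ
  xbar0 : EuclideanSpace ℝ (Fin n)
  Theta : Matrix (Fin n) (Fin n) ℝ

/-- The parameters `(A_L, B_L)` of a filter step `xhat (t+1) = A_L xhat t + B_L y t`. -/
abbrev FilterGain (n m : ℕ) : Type :=
  Matrix (Fin n) (Fin n) ℝ × Matrix (Fin n) (Fin m) ℝ

/-- The norm of `X` induced by the positive definite matrix `P`:
`‖X‖_P ^ 2 = max_{z ≠ 0} (zᵀ Xᵀ P X z) / (zᵀ P z)`. -/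
def inducedNorm {n : ℕ} (P X : Matrix (Fin n) (Fin n) ℝ) : ℝ :=
  √(⨆ z : {z : Fin n → ℝ // z ≠ 0}, (z.1 ⬝ᵥ (Xᵀ * P * X) *ᵥ z.1) / (z.1 ⬝ᵥ P *ᵥ z.1))

/-- The least eigenvalue of a symmetric matrix. -/
def lamMin {k : ℕ} (M : Matrix (Fin k) (Fin k) ℝ) : ℝ := sInf (spectrum ℝ M)

/-- The condition number of an invertible matrix, for the spectral norm. -/
def condNumber {k : ℕ} (M : Matrix (Fin k) (Fin k) ℝ) : ℝ := ‖M‖ * ‖M⁻¹‖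

namespace KFSystem

variable {n m : ℕ} (S : KFSystem n m)

/-- `(C, A)` is observable: the observability matrix `[C; C A; …; C A ^ (n-1)]` has trivial
kernel. -/
def Observable : Prop :=
  ∀ z : Fin n → ℝ, (∀ k < n, (S.C * S.A ^ k) *ᵥ z = 0) → z = 0

/-- The standing assumptions on the problem data. -/
structure Admissible : Prop where
  W_posDef : S.W.PosDef
  V_posDef : S.V.PosDef
  X0_posDef : S.X0.PosDef
  Theta_posDef : S.Theta.PosDef
  xbar0_ne : S.xbar0 ≠ 0
  observable : S.Observable

/-- `Sig` is a positive definite solution of the filter algebraic Riccati equation. -/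
def IsFARESolution (Sig : Matrix (Fin n) (Fin n) ℝ) : Prop :=
  Sig.PosDef ∧
    Sig = S.A * Sig * S.Aᵀ
      - S.A * Sig * S.Cᵀ * (S.V + S.C * Sig * S.Cᵀ)⁻¹ * S.C * Sig * S.Aᵀ + S.W

/-- The Kalman gain `L = A Σ Cᵀ (V + C Σ Cᵀ)⁻¹`. -/
def kalmanGain (Sig : Matrix (Fin n) (Fin n) ℝ) : Matrix (Fin n) (Fin m) ℝ :=
  S.A * Sig * S.Cᵀ * (S.V + S.C * Sig * S.Cᵀ)⁻¹

/-- The state matrix `A - L C` of the filter with the gain of `Sig`. -/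
def kalmanA (Sig : Matrix (Fin n) (Fin n) ℝ) : Matrix (Fin n) (Fin n) ℝ :=
  S.A - S.kalmanGain Sig * S.C

/-- A realization of all the random inputs: `x₀`, `(w t)`, `(v t)`, `θ₀`. -/
abbrev Sample (n m : ℕ) : Type :=
  EuclideanSpace ℝ (Fin n) × (ℕ → EuclideanSpace ℝ (Fin n)) ×
    (ℕ → EuclideanSpace ℝ (Fin m)) × EuclideanSpace ℝ (Fin n)

/-- The law of the random inputs: all of them are Gaussian and mutually independent. -/
def inputLaw : Measure (Sample n m) :=
  (multivariateGaussian S.xbar0 S.X0).prod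
    ((Measure.infinitePi fun _ : ℕ => multivariateGaussian 0 S.W).prod
      ((Measure.infinitePi fun _ : ℕ => multivariateGaussian 0 S.V).prod
        (multivariateGaussian 0 S.Theta)))

/-- The perturbation that enters at time `t` in subproblem `h`: `θ₀` if `t = h`, else zero. -/
def injection (h t : ℕ) (s : Sample n m) : EuclideanSpace ℝ (Fin n) :=
  if t = h then s.2.2.2 else 0

/-- The state trajectory in subproblem `h`. -/
def state (h : ℕ) (s : Sample n m) : ℕ → EuclideanSpace ℝ (Fin n)
  | 0 => s.1 + injection h 0 s
  | t + 1 => toEuclideanLin S.A (state h s t) + s.2.1 t + injection h (t + 1) s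

/-- The measurements in subproblem `h`. -/
def output (h : ℕ) (s : Sample n m) (t : ℕ) : EuclideanSpace ℝ (Fin m) :=
  toEuclideanLin S.C (S.state h s t) + s.2.2.1 t

/-- The estimates in subproblem `h`, generated by the filters `π 0, π 1, …`. -/
def estimate (h : ℕ) (π : ℕ → FilterGain n m) (s : Sample n m) :
    ℕ → EuclideanSpace ℝ (Fin n)
  | 0 => S.xbar0 + injection h 0 s
  | t + 1 => toEuclideanLin (π t).1 (estimate h π s t)
      + toEuclideanLin (π t).2 (S.output h s t) + injection h (t + 1) s

/-- The objective of subproblem `h` as a function of the decision variable `q = (A_{L_h}, B_{L_h})`,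
when the filters at times `t < h` are `π t` (the values `π t` with `t ≥ h` play no role). -/
def cost (π : ℕ → FilterGain n m) (h : ℕ) (q : FilterGain n m) : ℝ :=
  ∫ s, ∑ t ∈ Finset.range (h + 2),
    ‖S.state h s t - S.estimate h (Function.update π h q) s t‖ ^ 2 ∂S.inputLaw

/-- `q` minimizes the objective of subproblem `h`, the filters at times `t < h` being `π t`. -/
def IsMinimizer (π : ℕ → FilterGain n m) (h : ℕ) (q : FilterGain n m) : Prop :=
  ∀ q' : FilterGain n m, S.cost π h q ≤ S.cost π h q'

/-- The horizon threshold for the accuracy `δ`, where `r` is the contraction factor of the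
stationary filter. -/
def horizonBound (Sig : Matrix (Fin n) (Fin n) ℝ) (r δ : ℝ) : ℝ :=
  1 / 2 * (Real.log (inducedNorm Sig (S.X0 - Sig) * condNumber Sig * ‖S.kalmanA Sig‖ * ‖S.C‖
      / (δ * lamMin S.V)) / Real.log (1 / r)) + 1

/-- The scalar system parameters. -/
def params (Sig : Matrix (Fin n) (Fin n) ℝ) : Fin 12 → ℝ :=
  ![‖S.A‖, ‖S.C‖, ‖S.W‖, ‖S.W⁻¹‖, ‖S.V‖, ‖S.V⁻¹‖, ‖S.X0‖, ‖S.X0⁻¹‖, ‖S.Theta‖, ‖S.Theta⁻¹‖,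
    ‖S.xbar0‖, ‖Sig‖]

end KFSystem

end RHPG

end

/-! The perturbation θ₀ cancels in the error at time h, so the cost of subproblem h depends on its
decision variable (A_L, B_L) only through the error at time h+1. Its other effect is that the second
moment M of the estimate (`regMoment`) is nonsingular. Hence x_h splits into its linear regression R
x̂_h and a residual of covariance P, and the cost is a constant plus positive definite squares in
B_L − K(P) and (A − B_L C) R − A_L, where K(P) is the Kalman gain of P (`exists_cost_eq`). This
gives the unique minimizer B_L = K(P), A_L = (A − K(P) C) R. Everything then rests on keeping P
close to the exact Riccati iterate Σ_h of X₀ and R close to 1.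

The difficulty is that A may be unstable. A filter error of size δ multiplies an estimate whose
second moment can grow exponentially, while the loss must be bounded independently of N. What helps
is that the next stage regresses on x̂: the components of x̂ that can be large are those that A
expands, and a regression can correct the errors made along them at a cost in θ₀ that does not
depend on M. This is quantified by a symmetric Q with Aᵀ Q A − s Q = 1 for some s in [0, 1]. Leaving
s free makes ‖Q‖ polynomially bounded without any spectral gap (`exists_stein_solution`). The
inequality M⁻¹ ≥ −κ Q is preserved along the recursion (`neg_quad_le_quad_inv`), and it makes the
regularized regression error O(δ²) whatever the size of M (`exists_regression_le`). Since the exact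
filter contracts uniformly (`quad_riccatiSeq_contract`), a loss O(δ²) per step never accumulates
beyond O(δ²): this is the induction `Tracks.succ`.

It remains to compare Σ_h with Σ*. Using the stationary gain suboptimally bounds Σ_h − Σ* above.
Comparing the errors of the exact and of the stationary filter bounds it below. Together they give
‖Σ_h − Σ*‖ = O(‖X₀ − Σ*‖ r^{2h}) (`norm_riccatiSeq_sub_le`), and the horizon threshold is the time
at which the resulting gain error drops to the required accuracy. All constants are powers of one
number b that dominates 100, every parameter and ‖Q‖. -/

noncomputable section

set_option linter.unusedSectionVars false

namespace RHPG

/-! ### Quadratic forms, spectral norms and inverses. -/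

section QuadraticForms

variable {ι κ : Type*} [Fintype ι] [Fintype κ]

/-- The quadratic form of a matrix. -/
def quad (M : Matrix ι ι ℝ) (u : ι → ℝ) : ℝ := u ⬝ᵥ M *ᵥ u

lemma quad_add_mat (M N : Matrix ι ι ℝ) (u : ι → ℝ) : quad (M + N) u = quad M u + quad N u := by
  simp [quad, add_mulVec, dotProduct_add]

lemma quad_sub_mat (M N : Matrix ι ι ℝ) (u : ι → ℝ) : quad (M - N) u = quad M u - quad N u := by
  simp [quad, sub_mulVec, dotProduct_sub]

lemma quad_smul_mat (c : ℝ) (M : Matrix ι ι ℝ) (u : ι → ℝ) : quad (c • M) u = c * quad M u := by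
  simp [quad, smul_mulVec, dotProduct_smul]

lemma quad_one [DecidableEq ι] (u : ι → ℝ) : quad (1 : Matrix ι ι ℝ) u = u ⬝ᵥ u := by
  simp [quad]

lemma quad_conj (F : Matrix κ ι ℝ) (M : Matrix ι ι ℝ) (u : κ → ℝ) :
    quad (F * M * Fᵀ) u = quad M (Fᵀ *ᵥ u) := by
  simp only [quad, ← mulVec_mulVec]
  rw [dotProduct_mulVec u F, mulVec_transpose F u]

lemma quad_conj_transpose (F : Matrix ι κ ℝ) (M : Matrix ι ι ℝ) (u : κ → ℝ) :
    quad (Fᵀ * M * F) u = quad M (F *ᵥ u) := by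
  simpa using quad_conj Fᵀ M u

lemma quad_smul_vec (M : Matrix ι ι ℝ) (c : ℝ) (u : ι → ℝ) :
    quad M (c • u) = c ^ 2 * quad M u := by
  simp [quad, mulVec_smul, dotProduct_smul]; ring

lemma quad_zero_vec (M : Matrix ι ι ℝ) : quad M 0 = 0 := by simp [quad]

lemma dotProduct_mulVec_transpose (M : Matrix κ ι ℝ) (u : κ → ℝ) (v : ι → ℝ) :
    u ⬝ᵥ M *ᵥ v = v ⬝ᵥ Mᵀ *ᵥ u := by
  rw [dotProduct_mulVec, ← mulVec_transpose, dotProduct_comm]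

lemma dotProduct_mulVec_symm {M : Matrix ι ι ℝ} (hM : Mᵀ = M) (u v : ι → ℝ) :
    u ⬝ᵥ M *ᵥ v = v ⬝ᵥ M *ᵥ u := by
  rw [dotProduct_mulVec_transpose, hM]

lemma quad_transpose (M : Matrix ι ι ℝ) (u : ι → ℝ) : quad Mᵀ u = quad M u :=
  (dotProduct_mulVec_transpose M u u).symm

lemma quad_add_vec {M : Matrix ι ι ℝ} (hM : Mᵀ = M) (u v : ι → ℝ) :
    quad M (u + v) = quad M u + 2 * (u ⬝ᵥ M *ᵥ v) + quad M v := by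
  simp only [quad, mulVec_add, dotProduct_add, add_dotProduct, dotProduct_mulVec_symm hM v u]
  ring

lemma quad_sub_vec {M : Matrix ι ι ℝ} (hM : Mᵀ = M) (u v : ι → ℝ) :
    quad M (u - v) = quad M u - 2 * (u ⬝ᵥ M *ᵥ v) + quad M v := by
  simp only [quad, mulVec_sub, dotProduct_sub, sub_dotProduct, dotProduct_mulVec_symm hM v u]
  ring

lemma quad_neg_vec (M : Matrix ι ι ℝ) (u : ι → ℝ) : quad M (-u) = quad M u := by
  simp [quad, mulVec_neg]

lemma dotProduct_self_nonneg' (u : ι → ℝ) : 0 ≤ u ⬝ᵥ u :=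
  Finset.sum_nonneg fun i _ => mul_self_nonneg (u i)

lemma dotProduct_self_eq_norm_sq (u : ι → ℝ) : u ⬝ᵥ u = ‖WithLp.toLp 2 u‖ ^ 2 := by
  rw [EuclideanSpace.real_norm_sq_eq]; simp [dotProduct, sq]

lemma dotProduct_sq_le (u v : ι → ℝ) : (u ⬝ᵥ v) ^ 2 ≤ (u ⬝ᵥ u) * (v ⬝ᵥ v) := by
  have := Finset.sum_mul_sq_le_sq_mul_sq Finset.univ u v
  simpa [dotProduct, sq] using this

lemma abs_dotProduct_le (u v : ι → ℝ) : |u ⬝ᵥ v| ≤ √(u ⬝ᵥ u) * √(v ⬝ᵥ v) := by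
  rw [← Real.sqrt_mul (dotProduct_self_nonneg' u)]
  exact Real.abs_le_sqrt (dotProduct_sq_le u v)

variable [DecidableEq ι] [DecidableEq κ]

lemma mulVec_self_le (M : Matrix κ ι ℝ) (u : ι → ℝ) :
    (M *ᵥ u) ⬝ᵥ (M *ᵥ u) ≤ ‖M‖ ^ 2 * (u ⬝ᵥ u) := by
  rw [dotProduct_self_eq_norm_sq, dotProduct_self_eq_norm_sq, ← mul_pow]
  exact pow_le_pow_left₀ (norm_nonneg _) (l2_opNorm_mulVec M (WithLp.toLp 2 u)) 2

lemma l2_opNorm_le_of_mulVec {M : Matrix κ ι ℝ} {c : ℝ} (hc : 0 ≤ c)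
    (h : ∀ u : ι → ℝ, (M *ᵥ u) ⬝ᵥ (M *ᵥ u) ≤ c ^ 2 * (u ⬝ᵥ u)) : ‖M‖ ≤ c := by
  rw [l2_opNorm_def]
  refine ContinuousLinearMap.opNorm_le_bound _ hc fun x => ?_
  have := h x.ofLp
  rw [dotProduct_self_eq_norm_sq, dotProduct_self_eq_norm_sq, ← mul_pow] at this
  exact (pow_le_pow_iff_left₀ (norm_nonneg _) (by positivity) two_ne_zero).1 this

lemma l2_opNorm_transpose (M : Matrix κ ι ℝ) : ‖Mᵀ‖ = ‖M‖ := by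
  rw [← conjTranspose_eq_transpose_of_trivial, l2_opNorm_conjTranspose]

lemma abs_dotProduct_mulVec_le (M : Matrix κ ι ℝ) (u : κ → ℝ) (v : ι → ℝ) :
    |u ⬝ᵥ M *ᵥ v| ≤ ‖M‖ * (√(u ⬝ᵥ u) * √(v ⬝ᵥ v)) := by
  refine (abs_dotProduct_le _ _).trans ?_
  have h : √((M *ᵥ v) ⬝ᵥ (M *ᵥ v)) ≤ ‖M‖ * √(v ⬝ᵥ v) := by
    refine Real.sqrt_le_iff.2 ⟨by positivity, ?_⟩
    rw [mul_pow, Real.sq_sqrt (dotProduct_self_nonneg' v)]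
    exact mulVec_self_le M v
  nlinarith [mul_le_mul_of_nonneg_left h (Real.sqrt_nonneg (u ⬝ᵥ u))]

lemma abs_quad_le (M : Matrix ι ι ℝ) (u : ι → ℝ) : |quad M u| ≤ ‖M‖ * (u ⬝ᵥ u) := by
  have := abs_dotProduct_mulVec_le M u u
  rwa [Real.mul_self_sqrt (dotProduct_self_nonneg' u)] at this

lemma quad_le_norm (M : Matrix ι ι ℝ) (u : ι → ℝ) : quad M u ≤ ‖M‖ * (u ⬝ᵥ u) :=
  (le_abs_self _).trans (abs_quad_le M u)

lemma l2_opNorm_le_of_abs_quad_le {M : Matrix ι ι ℝ} (hM : Mᵀ = M) {c : ℝ} (hc : 0 ≤ c)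
    (h : ∀ u : ι → ℝ, |quad M u| ≤ c * (u ⬝ᵥ u)) : ‖M‖ ≤ c := by
  refine l2_opNorm_le_of_mulVec hc fun v => ?_
  set w := M *ᵥ v with hw
  -- Polarization: the forms at `t • w + v` and `t • w - v` differ by four times t |w|². The choice
  -- t = 1/c then balances the two terms on the right.
  have key : ∀ t : ℝ, 4 * t * (w ⬝ᵥ w) ≤ 2 * c * (t ^ 2 * (w ⬝ᵥ w) + v ⬝ᵥ v) := by
    intro t
    have h1 := (abs_le.1 (h (t • w + v))).2
    have h2 := (abs_le.1 (h (t • w - v))).1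
    rw [quad_add_vec hM] at h1
    rw [quad_sub_vec hM] at h2
    have e1 : (t • w) ⬝ᵥ M *ᵥ v = t * (w ⬝ᵥ w) := by rw [← hw]; simp
    have e2 : (t • w + v) ⬝ᵥ (t • w + v) = t ^ 2 * (w ⬝ᵥ w) + 2 * t * (w ⬝ᵥ v) + v ⬝ᵥ v := by
      simp [add_dotProduct, dotProduct_add, dotProduct_comm v w]; ring
    have e3 : (t • w - v) ⬝ᵥ (t • w - v) = t ^ 2 * (w ⬝ᵥ w) - 2 * t * (w ⬝ᵥ v) + v ⬝ᵥ v := by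
      simp [sub_dotProduct, dotProduct_sub, dotProduct_comm v w]; ring
    rw [e1, e2] at h1
    rw [e1, e3] at h2
    linarith
  rcases hc.eq_or_lt with rfl | hc'
  · have := key 1
    simp at this ⊢
    linarith
  · have h3 := key (1 / c)
    have : c * (4 * (1 / c) * (w ⬝ᵥ w)) ≤ c * (2 * c * ((1 / c) ^ 2 * (w ⬝ᵥ w) + v ⬝ᵥ v)) :=
      mul_le_mul_of_nonneg_left h3 hc
    field_simp at this
    linarith

lemma l2_opNorm_le_of_quad_nonneg {M : Matrix ι ι ℝ} (hM : Mᵀ = M) {c : ℝ} (hc : 0 ≤ c)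
    (h0 : ∀ u, 0 ≤ quad M u) (h : ∀ u : ι → ℝ, quad M u ≤ c * (u ⬝ᵥ u)) : ‖M‖ ≤ c :=
  l2_opNorm_le_of_abs_quad_le hM hc fun u => by rw [abs_of_nonneg (h0 u)]; exact h u

lemma _root_.Matrix.PosSemidef.quad_nonneg {M : Matrix ι ι ℝ} (hM : M.PosSemidef) (u : ι → ℝ) :
    0 ≤ quad M u := by
  simpa [quad] using hM.dotProduct_mulVec_nonneg u

lemma _root_.Matrix.PosDef.quad_pos {M : Matrix ι ι ℝ} (hM : M.PosDef) {u : ι → ℝ} (hu : u ≠ 0) :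
    0 < quad M u := by
  simpa [quad] using hM.dotProduct_mulVec_pos hu

lemma _root_.Matrix.PosDef.quad_nonneg {M : Matrix ι ι ℝ} (hM : M.PosDef) (u : ι → ℝ) : 0 ≤ quad M u :=
  PosSemidef.quad_nonneg hM.posSemidef u

lemma _root_.Matrix.PosDef.transpose_eq {M : Matrix ι ι ℝ} (hM : M.PosDef) : Mᵀ = M := by
  simpa using hM.isHermitian.eq

lemma posDef_of_quad_pos {M : Matrix ι ι ℝ} (hM : Mᵀ = M)
    (h : ∀ u, u ≠ 0 → 0 < quad M u) : M.PosDef :=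
  PosDef.of_dotProduct_mulVec_pos (by simpa [IsHermitian] using hM) fun u hu => by
    simpa [quad] using h u hu

/-- Expanding the nonnegative form of `M` at `u - b⁻¹ • M⁻¹ *ᵥ u` avoids any appeal to eigenvalues.
-/
lemma quad_ge_of_norm_inv_le {M : Matrix ι ι ℝ} (hM : M.PosDef) {b : ℝ} (hb : 0 < b)
    (h : ‖M⁻¹‖ ≤ b) (u : ι → ℝ) : b⁻¹ * (u ⬝ᵥ u) ≤ quad M u := by
  have hu : IsUnit M.det := (Matrix.isUnit_iff_isUnit_det _).1 hM.isUnit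
  have h1 := PosDef.quad_nonneg hM (u - b⁻¹ • M⁻¹ *ᵥ u)
  rw [quad_sub_vec (PosDef.transpose_eq hM), quad_smul_vec] at h1
  have e1 : u ⬝ᵥ M *ᵥ (b⁻¹ • M⁻¹ *ᵥ u) = b⁻¹ * (u ⬝ᵥ u) := by
    rw [mulVec_smul, mulVec_mulVec, mul_nonsing_inv _ hu]; simp
  have e2 : quad M (M⁻¹ *ᵥ u) = quad M⁻¹ u := by
    rw [quad, mulVec_mulVec, mul_nonsing_inv _ hu, one_mulVec, dotProduct_comm]; rfl
  have h2 : quad M⁻¹ u ≤ b * (u ⬝ᵥ u) := (quad_le_norm _ _).trans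
    (mul_le_mul_of_nonneg_right h (dotProduct_self_nonneg' u))
  rw [e1, e2] at h1
  have h3 : b⁻¹ ^ 2 * quad M⁻¹ u ≤ b⁻¹ ^ 2 * (b * (u ⬝ᵥ u)) :=
    mul_le_mul_of_nonneg_left h2 (by positivity)
  have h4 : b⁻¹ ^ 2 * (b * (u ⬝ᵥ u)) = b⁻¹ * (u ⬝ᵥ u) := by field_simp
  linarith

lemma posDef_of_quad_ge {M : Matrix ι ι ℝ} (hM : Mᵀ = M) {c : ℝ} (hc : 0 < c)
    (h : ∀ u : ι → ℝ, c * (u ⬝ᵥ u) ≤ quad M u) : M.PosDef :=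
  posDef_of_quad_pos hM fun u hu => lt_of_lt_of_le (mul_pos hc (lt_of_le_of_ne
    (dotProduct_self_nonneg' u) fun h0 => hu (dotProduct_self_eq_zero.1 h0.symm))) (h u)

lemma norm_inv_le_of_quad_ge {M : Matrix ι ι ℝ} (hM : Mᵀ = M) {c : ℝ} (hc : 0 < c)
    (h : ∀ u : ι → ℝ, c * (u ⬝ᵥ u) ≤ quad M u) : ‖M⁻¹‖ ≤ c⁻¹ := by
  have hu : IsUnit M.det := (Matrix.isUnit_iff_isUnit_det _).1 (posDef_of_quad_ge hM hc h).isUnit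
  refine l2_opNorm_le_of_mulVec (by positivity) fun w => ?_
  set v := M⁻¹ *ᵥ w with hv
  have hw : M *ᵥ v = w := by rw [hv, mulVec_mulVec, mul_nonsing_inv _ hu, one_mulVec]
  have h1 := h v
  rw [quad, hw] at h1
  have h2 := dotProduct_sq_le v w
  have h3 := dotProduct_self_nonneg' v
  rcases h3.eq_or_lt with h0 | h0
  · rw [← h0]; have := dotProduct_self_nonneg' w; positivity
  · have h4 : (c * (v ⬝ᵥ v)) ^ 2 ≤ (v ⬝ᵥ v) * (w ⬝ᵥ w) :=
      (pow_le_pow_left₀ (by positivity) h1 2).trans h2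
    have h5 : c ^ 2 * (v ⬝ᵥ v) ≤ w ⬝ᵥ w := by
      refine le_of_mul_le_mul_left ?_ h0
      linarith
    rw [inv_pow, ← div_eq_inv_mul, le_div_iff₀ (by positivity)]
    linarith

lemma _root_.Matrix.PosDef.mul_inv {M : Matrix ι ι ℝ} (hM : M.PosDef) : M * M⁻¹ = 1 :=
  mul_nonsing_inv _ ((Matrix.isUnit_iff_isUnit_det _).1 hM.isUnit)

lemma _root_.Matrix.PosDef.inv_mul {M : Matrix ι ι ℝ} (hM : M.PosDef) : M⁻¹ * M = 1 :=
  nonsing_inv_mul _ ((Matrix.isUnit_iff_isUnit_det _).1 hM.isUnit)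

lemma _root_.Matrix.PosDef.inv_transpose {M : Matrix ι ι ℝ} (hM : M.PosDef) : (M⁻¹)ᵀ = M⁻¹ := by
  rw [transpose_nonsing_inv, PosDef.transpose_eq hM]

lemma _root_.Matrix.PosDef.quad_inv_mulVec {M : Matrix ι ι ℝ} (hM : M.PosDef) (u : ι → ℝ) :
    quad M⁻¹ (M *ᵥ u) = quad M u := by
  rw [quad, mulVec_mulVec, PosDef.inv_mul hM, one_mulVec, dotProduct_comm]; rfl

/-- The Fenchel inequality between the forms of M and M⁻¹, obtained by expanding the form of M⁻¹ at
`y - M *ᵥ v`. It replaces matrix square roots in order reversal and in the lower Riccati bound. -/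
lemma _root_.Matrix.PosDef.quad_inv_ge {M : Matrix ι ι ℝ} (hM : M.PosDef) (y v : ι → ℝ) :
    2 * (y ⬝ᵥ v) - quad M v ≤ quad M⁻¹ y := by
  have h1 := PosDef.quad_nonneg hM.inv (y - M *ᵥ v)
  rw [quad_sub_vec (PosDef.inv_transpose hM), PosDef.quad_inv_mulVec hM, mulVec_mulVec,
    PosDef.inv_mul hM, one_mulVec] at h1
  linarith

lemma _root_.Matrix.PosDef.quad_inv_anti {M N : Matrix ι ι ℝ} (hM : M.PosDef) (hN : N.PosDef)
    (h : ∀ u, quad M u ≤ quad N u) (y : ι → ℝ) : quad N⁻¹ y ≤ quad M⁻¹ y := by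
  have h1 := PosDef.quad_inv_ge hM y (N⁻¹ *ᵥ y)
  have h2 := h (N⁻¹ *ᵥ y)
  have h3 : quad N (N⁻¹ *ᵥ y) = quad N⁻¹ y := by
    rw [quad, mulVec_mulVec, PosDef.mul_inv hN, one_mulVec, dotProduct_comm]; rfl
  have h4 : y ⬝ᵥ N⁻¹ *ᵥ y = quad N⁻¹ y := rfl
  linarith

end QuadraticForms

/-! ### A Stein equation with a free shift. -/

section SteinEquation

open Polynomial in
-- Lagrange interpolation at d + 1 fixed nodes of [0, 1] writes the leading coefficient, which is 1,
-- as a fixed combination of the values there. So these values cannot all be small.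
lemma exists_le_abs_eval_of_monic (d : ℕ) : ∃ c : ℝ, 0 < c ∧ ∀ P : ℝ[X], P.Monic →
    P.natDegree = d → ∃ s, 0 ≤ s ∧ s ≤ 1 ∧ c ≤ |P.eval s| := by
  set v : ℕ → ℝ := fun j => j / (d + 1) with hv
  have hinj : Set.InjOn v (Finset.range (d + 1)) := by
    intro i _ j _ h
    have : (d + 1 : ℝ) ≠ 0 := by positivity
    simpa [hv, div_left_inj' this] using h
  set T : ℝ := ∑ i ∈ Finset.range (d + 1), |∏ j ∈ (Finset.range (d + 1)).erase i, (v i - v j)|⁻¹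
  have hT : 0 ≤ T := Finset.sum_nonneg fun i _ => by positivity
  refine ⟨(T + 1)⁻¹, by positivity, fun P hP hd => ?_⟩
  by_contra! hcon
  have h1 := Lagrange.leadingCoeff_eq_sum hinj (P := P)
    (by rw [Finset.card_range, degree_eq_natDegree hP.ne_zero, hd]; rfl)
  rw [hP.leadingCoeff] at h1
  have h2 : (1 : ℝ) ≤ ∑ i ∈ Finset.range (d + 1),
      (T + 1)⁻¹ * |∏ j ∈ (Finset.range (d + 1)).erase i, (v i - v j)|⁻¹ := by
    have h1' := congrArg abs h1
    rw [abs_one] at h1'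
    refine h1'.le.trans ((Finset.abs_sum_le_sum_abs _ _).trans (Finset.sum_le_sum fun i hi => ?_))
    rw [abs_div, div_eq_mul_inv]
    refine mul_le_mul_of_nonneg_right (hcon (v i) (by positivity) ?_).le (by positivity)
    rw [hv, div_le_one (by positivity)]
    exact_mod_cast (Finset.mem_range.1 hi).le
  rw [← Finset.mul_sum] at h2
  have h3 : (T + 1)⁻¹ * T < 1 := by
    rw [inv_mul_lt_iff₀ (by positivity)]; linarith
  exact absurd h2 (not_le.2 h3)

variable {κ : Type*} [Fintype κ] [DecidableEq κ]

lemma abs_adjugate_apply_le (M : Matrix κ κ ℝ) {a : ℝ} (ha : 1 ≤ a) (h : ∀ i j, |M i j| ≤ a)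
    (i j : κ) : |M.adjugate i j| ≤ (Fintype.card κ).factorial • a ^ Fintype.card κ := by
  rw [adjugate_apply]
  refine Matrix.det_le (abv := AbsoluteValue.abs) fun k l => ?_
  simp only [AbsoluteValue.abs_apply]
  rw [updateRow_apply]
  split_ifs
  · rw [Pi.single_apply]; split_ifs <;> simp <;> linarith
  · exact h k l

/-- Cramer's rule: the adjugate has polynomially bounded entries, so a lower bound on the
determinant is all that a bounded solution requires. -/
lemma exists_solution_le (M : Matrix κ κ ℝ) {a c : ℝ} (ha : 1 ≤ a) (h : ∀ i j, |M i j| ≤ a)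
    (hc : 0 < c) (hM : c ≤ |M.det|) (y : κ → ℝ) (hy : ∀ i, |y i| ≤ 1) :
    ∃ x, M *ᵥ x = y ∧ ∀ i, |x i| ≤
      c⁻¹ * (Fintype.card κ * ((Fintype.card κ).factorial * a ^ Fintype.card κ)) := by
  have h0 : M.det ≠ 0 := by
    intro h0; rw [h0] at hM; simp at hM; linarith
  refine ⟨M.det⁻¹ • M.adjugate *ᵥ y, ?_, fun i => ?_⟩
  · rw [mulVec_smul, mulVec_mulVec, mul_adjugate, smul_mulVec, one_mulVec, smul_smul,
      inv_mul_cancel₀ h0, one_smul]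
  · rw [Pi.smul_apply, smul_eq_mul, abs_mul, abs_inv]
    refine mul_le_mul (inv_anti₀ hc hM) ?_ (abs_nonneg _) (by positivity)
    refine (Finset.abs_sum_le_sum_abs _ _).trans ?_
    calc ∑ j, |M.adjugate i j * y j| ≤ ∑ _j : κ,
          ((Fintype.card κ).factorial * a ^ Fintype.card κ : ℝ) := by
          refine Finset.sum_le_sum fun j _ => ?_
          rw [abs_mul]
          refine (mul_le_mul ?_ (hy j) (abs_nonneg _) (by positivity)).trans_eq (mul_one _)
          simpa using abs_adjugate_apply_le M ha h i j
      _ = _ := by simp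

lemma abs_apply_le_l2_opNorm (A : Matrix κ κ ℝ) (i j : κ) : |A i j| ≤ ‖A‖ := by
  have := abs_dotProduct_mulVec_le A (Pi.single i 1) (Pi.single j 1)
  simpa using this

lemma l2_opNorm_le_of_abs_apply_le {A : Matrix κ κ ℝ} {a : ℝ} (ha : 0 ≤ a)
    (h : ∀ i j, |A i j| ≤ a) : ‖A‖ ≤ Fintype.card κ * a := by
  refine l2_opNorm_le_of_mulVec (by positivity) fun u => ?_
  have hu := dotProduct_self_nonneg' u
  have h1 : ∀ i, (A *ᵥ u) i * (A *ᵥ u) i ≤ Fintype.card κ * a ^ 2 * (u ⬝ᵥ u) := by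
    intro i
    have h2 := dotProduct_sq_le (A i) u
    have h3 : A i ⬝ᵥ A i ≤ Fintype.card κ * a ^ 2 := by
      calc A i ⬝ᵥ A i ≤ ∑ _j : κ, a ^ 2 := Finset.sum_le_sum fun j _ => by
            rw [← sq, ← sq_abs]; exact pow_le_pow_left₀ (abs_nonneg _) (h i j) 2
        _ = _ := by simp
    calc (A *ᵥ u) i * (A *ᵥ u) i = (A i ⬝ᵥ u) ^ 2 := by rw [sq]; rfl
      _ ≤ _ := h2.trans (mul_le_mul_of_nonneg_right h3 hu)
  calc (A *ᵥ u) ⬝ᵥ (A *ᵥ u) ≤ ∑ _i : κ, Fintype.card κ * a ^ 2 * (u ⬝ᵥ u) :=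
        Finset.sum_le_sum fun i _ => h1 i
    _ = _ := by simp; ring

lemma exists_stein_solution_of_le {n : ℕ} (A : Matrix (Fin n) (Fin n) ℝ) {a : ℝ}
    {s : ℝ} {x : Fin n × Fin n → ℝ} (ha : 0 ≤ a)
    (hx : (scalar (Fin n × Fin n) s - kroneckerMap (· * ·) Aᵀ Aᵀ) *ᵥ x =
      -vec (1 : Matrix (Fin n) (Fin n) ℝ)) (hxb : ∀ i, |x i| ≤ a) :
    ∃ Q : Matrix (Fin n) (Fin n) ℝ, Qᵀ = Q ∧ ‖Q‖ ≤ n * a ∧ Aᵀ * Q * A - s • Q = 1 := by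
  set X : Matrix (Fin n) (Fin n) ℝ := Matrix.of fun i j => x (j, i) with hX
  have hvec : vec X = x := by ext ⟨i, j⟩; rfl
  have hXeq : Aᵀ * X * A - s • X = 1 := by
    have h1 : kroneckerMap (· * ·) Aᵀ Aᵀ *ᵥ vec X = vec (Aᵀ * X * A) := by
      simpa using kronecker_mulVec_vec Aᵀ X Aᵀ
    rw [← vec_inj, vec_sub, vec_smul, ← h1, hvec]
    rw [sub_mulVec] at hx
    have h2 : (scalar (Fin n × Fin n) s) *ᵥ x = s • x := by
      ext i; simp [scalar_apply, mulVec_diagonal]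
    rw [h2] at hx
    rw [← neg_sub, hx, neg_neg]
  have h2 : Aᵀ * Xᵀ * A - s • Xᵀ = 1 := by
    have := congrArg transpose hXeq
    simpa [Matrix.mul_assoc] using this
  have h3 : ‖X‖ ≤ n * a := by
    have := l2_opNorm_le_of_abs_apply_le (A := X) ha fun i j => hxb (j, i)
    simpa using this
  -- The transpose of a solution is again a solution, so symmetrizing costs nothing.
  refine ⟨(2⁻¹ : ℝ) • (X + Xᵀ), by simp [add_comm], ?_, ?_⟩
  · calc ‖(2⁻¹ : ℝ) • (X + Xᵀ)‖ ≤ 2⁻¹ * (‖X‖ + ‖Xᵀ‖) := by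
          rw [norm_smul]; simp only [norm_inv, Real.norm_ofNat]
          exact mul_le_mul_of_nonneg_left (norm_add_le _ _) (by norm_num)
      _ = ‖X‖ := by rw [l2_opNorm_transpose]; ring
      _ ≤ _ := h3
  · rw [Matrix.mul_smul, Matrix.smul_mul, Matrix.mul_add, Matrix.add_mul, smul_comm s,
      ← smul_sub, smul_add s, add_sub_add_comm, hXeq, h2, ← two_smul ℝ, smul_smul]
    norm_num

/-- For some `s ∈ [0, 1]` the Stein equation `Aᵀ Q A - s Q = 1` has a symmetric solution of
polynomially bounded norm. -/
theorem exists_stein_solution (n : ℕ) : ∃ (c : ℝ) (k : ℕ), 0 ≤ c ∧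
    ∀ A : Matrix (Fin n) (Fin n) ℝ, ∃ (Q : Matrix (Fin n) (Fin n) ℝ) (s : ℝ),
      Qᵀ = Q ∧ 0 ≤ s ∧ s ≤ 1 ∧ ‖Q‖ ≤ c * (1 + ‖A‖) ^ k ∧ Aᵀ * Q * A - s • Q = 1 := by
  obtain ⟨c, hc, hP⟩ := exists_le_abs_eval_of_monic (Fintype.card (Fin n × Fin n))
  generalize hd : Fintype.card (Fin n × Fin n) = d at hP
  obtain ⟨f, hf⟩ : ∃ f : ℝ, f = d.factorial := ⟨_, rfl⟩
  have hf0 : 0 ≤ f := by rw [hf]; positivity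
  -- Here d = n², and the entries of s − Aᵀ ⊗ Aᵀ are at most (1 + ‖A‖)², whence the exponent 2d.
  refine ⟨n * (c⁻¹ * (d * f)), 2 * d, by positivity, fun A => ?_⟩
  -- The Stein equation is singular exactly when s is an eigenvalue of Aᵀ ⊗ Aᵀ. The shift is chosen
  -- where its characteristic polynomial is quantitatively nonzero.
  obtain ⟨s, hs0, hs1, hs⟩ := hP (kroneckerMap (· * ·) Aᵀ Aᵀ).charpoly (charpoly_monic _)
    (by rw [charpoly_natDegree_eq_dim, hd])
  rw [eval_charpoly] at hs
  have hA := norm_nonneg A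
  have ha : 1 ≤ (1 + ‖A‖) ^ 2 := one_le_pow₀ (by linarith)
  have hent : ∀ i j, |(scalar (Fin n × Fin n) s - kroneckerMap (· * ·) Aᵀ Aᵀ) i j| ≤
      (1 + ‖A‖) ^ 2 := by
    intro i j
    have h1 : |scalar (Fin n × Fin n) s i j| ≤ 1 := by
      rw [scalar_apply, diagonal_apply]
      by_cases hij : i = j
      · rw [if_pos hij, abs_of_nonneg hs0]; exact hs1
      · rw [if_neg hij, abs_zero]; exact zero_le_one
    have h2 : |kroneckerMap (· * ·) Aᵀ Aᵀ i j| ≤ ‖A‖ * ‖A‖ := by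
      rw [kroneckerMap_apply, abs_mul]
      exact mul_le_mul (abs_apply_le_l2_opNorm A j.1 i.1) (abs_apply_le_l2_opNorm A j.2 i.2)
        (abs_nonneg _) hA
    rw [Matrix.sub_apply]
    have h3 := (abs_le.1 h1)
    have h4 := (abs_le.1 h2)
    have h5 : 1 + ‖A‖ * ‖A‖ ≤ (1 + ‖A‖) ^ 2 := by nlinarith only [hA]
    exact abs_le.2 ⟨by linarith only [h3.1, h4.2, h5], by linarith only [h3.2, h4.1, h5]⟩
  obtain ⟨x, hx, hxb⟩ := exists_solution_le _ ha hent hc hs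
    (-vec (1 : Matrix (Fin n) (Fin n) ℝ)) (fun i => by
      rw [Pi.neg_apply, abs_neg, vec, Matrix.one_apply]
      split_ifs <;> simp)
  rw [hd, ← hf, ← pow_mul] at hxb
  obtain ⟨Q, hQ, hQn, hQe⟩ := exists_stein_solution_of_le A (by positivity) hx hxb
  exact ⟨Q, s, hQ, hs0, hs1, hQn.trans (le_of_eq (by ring)), hQe⟩

end SteinEquation

namespace KFSystem

/-! ### The Riccati operator and Kalman gains. -/

section Riccati

variable {n m : ℕ} (S : KFSystem n m)

/-- The innovation covariance. -/
def innov (P : Matrix (Fin n) (Fin n) ℝ) : Matrix (Fin m) (Fin m) ℝ := S.V + S.C * P * S.Cᵀ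

/-- The Riccati operator. -/
def ric (P : Matrix (Fin n) (Fin n) ℝ) : Matrix (Fin n) (Fin n) ℝ :=
  S.A * P * S.Aᵀ - S.A * P * S.Cᵀ * (S.V + S.C * P * S.Cᵀ)⁻¹ * S.C * P * S.Aᵀ + S.W

variable {S} {P : Matrix (Fin n) (Fin n) ℝ}

lemma quad_innov (P : Matrix (Fin n) (Fin n) ℝ) (y : Fin m → ℝ) :
    quad (S.innov P) y = quad S.V y + quad P (S.Cᵀ *ᵥ y) := by
  rw [innov, quad_add_mat, quad_conj]

lemma innov_transpose (hV : S.V.PosDef) (hP : Pᵀ = P) : (S.innov P)ᵀ = S.innov P := by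
  simp [innov, hV.transpose_eq, hP, Matrix.mul_assoc]

lemma innov_posDef (hV : S.V.PosDef) (hP : Pᵀ = P) (hP0 : ∀ u, 0 ≤ quad P u) :
    (S.innov P).PosDef :=
  posDef_of_quad_pos (innov_transpose hV hP) fun u hu => by
    rw [quad_innov]
    exact add_pos_of_pos_of_nonneg (hV.quad_pos hu) (hP0 _)

lemma gain_mul_innov (hI : (S.innov P).PosDef) :
    S.kalmanGain P * S.innov P = S.A * P * S.Cᵀ := by
  rw [kalmanGain, Matrix.mul_assoc, ← innov, hI.inv_mul, Matrix.mul_one]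

lemma innov_mul_gain_transpose (hI : (S.innov P).PosDef) (hP : Pᵀ = P) :
    S.innov P * (S.kalmanGain P)ᵀ = S.C * P * S.Aᵀ := by
  have := congrArg transpose (gain_mul_innov hI)
  simpa [hI.transpose_eq, hP, Matrix.mul_assoc] using this

/-- The optimality condition for the gain. It is what makes the terms containing an arbitrary
competing gain cancel in `cross_stationary` and in `gain_sub_gain`. -/
lemma kalmanA_mul (hI : (S.innov P).PosDef) :
    S.kalmanA P * P * S.Cᵀ = S.kalmanGain P * S.V := by
  have := gain_mul_innov hI
  rw [innov, Matrix.mul_add] at this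
  rw [kalmanA, Matrix.sub_mul, Matrix.sub_mul, ← this]
  simp [Matrix.mul_assoc]

lemma ric_eq (P : Matrix (Fin n) (Fin n) ℝ) : S.ric P = S.kalmanA P * P * S.Aᵀ + S.W := by
  simp [ric, kalmanA, kalmanGain, Matrix.sub_mul, Matrix.mul_assoc]

lemma kalmanA_transpose_mulVec (P : Matrix (Fin n) (Fin n) ℝ) (f : Fin n → ℝ) :
    (S.kalmanA P)ᵀ *ᵥ f = S.Aᵀ *ᵥ f - S.Cᵀ *ᵥ ((S.kalmanGain P)ᵀ *ᵥ f) := by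
  simp [kalmanA, sub_mulVec]

lemma ric_transpose (hW : S.W.PosDef) (hV : S.V.PosDef) (hP : Pᵀ = P) :
    (S.ric P)ᵀ = S.ric P := by
  have h : ((S.V + S.C * P * S.Cᵀ)⁻¹)ᵀ = (S.V + S.C * P * S.Cᵀ)⁻¹ := by
    rw [transpose_nonsing_inv, ← innov, innov_transpose hV hP]
  rw [ric]
  generalize (S.V + S.C * P * S.Cᵀ)⁻¹ = N at h ⊢
  simp [hP, h, hW.transpose_eq, Matrix.mul_assoc]

/-- Completion of the square in the gain. -/
lemma quad_ric_add (hI : (S.innov P).PosDef) (hP : Pᵀ = P) (f : Fin n → ℝ) (y : Fin m → ℝ) :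
    quad P (S.Aᵀ *ᵥ f - S.Cᵀ *ᵥ y) + quad S.V y + quad S.W f =
      quad (S.ric P) f + quad (S.innov P) (y - (S.kalmanGain P)ᵀ *ᵥ f) := by
  have e1 : (S.Aᵀ *ᵥ f) ⬝ᵥ P *ᵥ S.Cᵀ *ᵥ y = y ⬝ᵥ (S.C * P * S.Aᵀ) *ᵥ f := by
    rw [mulVec_mulVec, dotProduct_mulVec_transpose, mulVec_mulVec]
    simp [hP]
  have e2 : y ⬝ᵥ (S.innov P) *ᵥ ((S.kalmanGain P)ᵀ *ᵥ f) = y ⬝ᵥ (S.C * P * S.Aᵀ) *ᵥ f := by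
    rw [mulVec_mulVec, innov_mul_gain_transpose hI hP]
  have e3 : quad (S.ric P) f = quad P (S.Aᵀ *ᵥ f)
      - quad (S.innov P) ((S.kalmanGain P)ᵀ *ᵥ f) + quad S.W f := by
    rw [← quad_conj, ← quad_conj, Matrix.mul_assoc (S.kalmanGain P),
      innov_mul_gain_transpose hI hP, ← quad_sub_mat, ← quad_add_mat]
    congr 1
    simp [ric_eq, kalmanA, Matrix.sub_mul, Matrix.mul_assoc]
  rw [quad_sub_vec hP, quad_sub_vec hI.transpose_eq, e1, e2, e3, quad_innov _ y]
  ring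

lemma quad_ric (hI : (S.innov P).PosDef) (hP : Pᵀ = P) (f : Fin n → ℝ) :
    quad (S.ric P) f = quad P ((S.kalmanA P)ᵀ *ᵥ f) + quad S.V ((S.kalmanGain P)ᵀ *ᵥ f)
      + quad S.W f := by
  have := quad_ric_add hI hP f ((S.kalmanGain P)ᵀ *ᵥ f)
  rw [sub_self, quad_zero_vec, ← kalmanA_transpose_mulVec] at this
  linarith

/-- The Kalman gain is optimal, so inserting any other gain gives an upper bound. Every upper
estimate of a Riccati step below comes from a suitable suboptimal gain. -/
lemma quad_ric_le (hI : (S.innov P).PosDef) (hP : Pᵀ = P) (f : Fin n → ℝ) (y : Fin m → ℝ) :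
    quad (S.ric P) f ≤ quad P (S.Aᵀ *ᵥ f - S.Cᵀ *ᵥ y) + quad S.V y + quad S.W f := by
  rw [quad_ric_add hI hP]
  linarith [hI.quad_nonneg (y - (S.kalmanGain P)ᵀ *ᵥ f)]

/-- The difference of two Kalman gains. -/
lemma gain_sub_gain {P' : Matrix (Fin n) (Fin n) ℝ} (hI : (S.innov P).PosDef)
    (hI' : (S.innov P').PosDef) :
    S.kalmanGain P - S.kalmanGain P' =
      S.kalmanA P' * (P - P') * S.Cᵀ * (S.innov P)⁻¹ := by
  have h : (S.kalmanGain P - S.kalmanGain P') * S.innov P = S.kalmanA P' * (P - P') * S.Cᵀ := by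
    rw [Matrix.sub_mul, gain_mul_innov hI, Matrix.mul_sub, Matrix.sub_mul, kalmanA_mul hI',
      innov, kalmanA]
    simp only [Matrix.mul_add, Matrix.sub_mul, Matrix.mul_assoc]
    abel
  rw [← h, Matrix.mul_assoc, hI.mul_inv, Matrix.mul_one]

/-- Orthogonality of the stationary filter error to the error of any other filter. -/
lemma cross_stationary {Sig : Matrix (Fin n) (Fin n) ℝ} (hS : Sigᵀ = Sig)
    (hI : (S.innov Sig).PosDef) (hW : S.W.PosDef) (hfix : S.ric Sig = Sig)
    (x y : Fin n → ℝ) (l : Fin m → ℝ) :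
    x ⬝ᵥ Sig *ᵥ y = (S.Aᵀ *ᵥ x - S.Cᵀ *ᵥ l) ⬝ᵥ Sig *ᵥ ((S.kalmanA Sig)ᵀ *ᵥ y)
      + l ⬝ᵥ S.V *ᵥ ((S.kalmanGain Sig)ᵀ *ᵥ y) + x ⬝ᵥ S.W *ᵥ y := by
  have h1 : S.kalmanA Sig * Sig * S.Aᵀ + S.W = Sig := by rw [← ric_eq, hfix]
  have h2 : S.A * (Sig * (S.kalmanA Sig)ᵀ) + S.W = Sig := by
    have := congrArg transpose h1
    simpa [hS, hW.transpose_eq, Matrix.mul_assoc] using this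
  have h3 : S.C * (Sig * (S.kalmanA Sig)ᵀ) = S.Vᵀ * (S.kalmanGain Sig)ᵀ := by
    have := congrArg transpose (kalmanA_mul hI)
    simpa [hS, Matrix.mul_assoc] using this
  have hVt : S.Vᵀ = S.V := by
    have := hI.transpose_eq
    simp only [innov, transpose_add, transpose_mul, transpose_transpose, hS] at this
    simpa [Matrix.mul_assoc] using this
  rw [hVt] at h3
  have e1 : (S.Aᵀ *ᵥ x) ⬝ᵥ Sig *ᵥ ((S.kalmanA Sig)ᵀ *ᵥ y) =
      x ⬝ᵥ (S.A * (Sig * (S.kalmanA Sig)ᵀ)) *ᵥ y := by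
    rw [mulVec_transpose S.A, ← dotProduct_mulVec]; simp only [mulVec_mulVec]
  have e2 : (S.Cᵀ *ᵥ l) ⬝ᵥ Sig *ᵥ ((S.kalmanA Sig)ᵀ *ᵥ y) =
      l ⬝ᵥ (S.C * (Sig * (S.kalmanA Sig)ᵀ)) *ᵥ y := by
    rw [mulVec_transpose S.C, ← dotProduct_mulVec]; simp only [mulVec_mulVec]
  have e3 : l ⬝ᵥ (S.V * (S.kalmanGain Sig)ᵀ) *ᵥ y = l ⬝ᵥ S.V *ᵥ (S.kalmanGain Sig)ᵀ *ᵥ y := by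
    rw [mulVec_mulVec]
  rw [sub_dotProduct, e1, e2, h3, e3]
  conv_lhs => rw [← h2, add_mulVec, dotProduct_add]
  ring

variable (S) in
/-- The exact error covariances: the Riccati iterates of `X0`. -/
def riccatiSeq : ℕ → Matrix (Fin n) (Fin n) ℝ
  | 0 => S.X0
  | h + 1 => S.ric (riccatiSeq h)

lemma riccatiSeq_succ (h : ℕ) : S.riccatiSeq (h + 1) = S.ric (S.riccatiSeq h) := rfl

/-- Well-posed data all of whose parameters are bounded by `b`. -/
structure BoundedBy (S : KFSystem n m) (Sig : Matrix (Fin n) (Fin n) ℝ) (b : ℝ) : Prop where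
  adm : S.Admissible
  sol : S.IsFARESolution Sig
  large : 100 ≤ b
  A_le : ‖S.A‖ ≤ b
  C_le : ‖S.C‖ ≤ b
  W_le : ‖S.W‖ ≤ b
  Winv_le : ‖S.W⁻¹‖ ≤ b
  V_le : ‖S.V‖ ≤ b
  Vinv_le : ‖S.V⁻¹‖ ≤ b
  X0_le : ‖S.X0‖ ≤ b
  X0inv_le : ‖S.X0⁻¹‖ ≤ b
  Theta_le : ‖S.Theta‖ ≤ b
  Thetainv_le : ‖S.Theta⁻¹‖ ≤ b
  xbar0_le : ‖S.xbar0‖ ≤ b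
  Sig_le : ‖Sig‖ ≤ b

end Riccati

/-! ### Uniform bounds and convergence of the Riccati iterates. -/

section RiccatiBounds

variable {n m : ℕ} {S : KFSystem n m} {Sig : Matrix (Fin n) (Fin n) ℝ} {b : ℝ}

lemma IsFARESolution.ric_eq_self (h : S.IsFARESolution Sig) : S.ric Sig = Sig := h.2.symm

lemma Admissible.innov_posDef (hS : S.Admissible) {P : Matrix (Fin n) (Fin n) ℝ}
    (hP : P.PosDef) : (S.innov P).PosDef :=
  KFSystem.innov_posDef hS.V_posDef hP.transpose_eq hP.quad_nonneg

lemma Admissible.ric_posDef (hS : S.Admissible) {P : Matrix (Fin n) (Fin n) ℝ}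
    (hP : P.PosDef) : (S.ric P).PosDef :=
  posDef_of_quad_pos (ric_transpose hS.W_posDef hS.V_posDef hP.transpose_eq) fun u hu => by
    rw [quad_ric (hS.innov_posDef hP) hP.transpose_eq]
    have h1 := hP.quad_nonneg ((S.kalmanA P)ᵀ *ᵥ u)
    have h2 := hS.V_posDef.quad_nonneg ((S.kalmanGain P)ᵀ *ᵥ u)
    have h3 := hS.W_posDef.quad_pos hu
    linarith

lemma Admissible.riccatiSeq_posDef (hS : S.Admissible) (h : ℕ) : (S.riccatiSeq h).PosDef := by
  induction h with
  | zero => exact hS.X0_posDef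
  | succ h ih => exact hS.ric_posDef ih

namespace BoundedBy

variable (H : S.BoundedBy Sig b)
include H

lemma pos : 0 < b := by linarith [H.large]

lemma one_le : 1 ≤ b := by linarith [H.large]

lemma quad_W_ge (u : Fin n → ℝ) : b⁻¹ * (u ⬝ᵥ u) ≤ quad S.W u :=
  quad_ge_of_norm_inv_le H.adm.W_posDef H.pos H.Winv_le u

lemma quad_V_ge (u : Fin m → ℝ) : b⁻¹ * (u ⬝ᵥ u) ≤ quad S.V u :=
  quad_ge_of_norm_inv_le H.adm.V_posDef H.pos H.Vinv_le u

lemma quad_X0_ge (u : Fin n → ℝ) : b⁻¹ * (u ⬝ᵥ u) ≤ quad S.X0 u :=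
  quad_ge_of_norm_inv_le H.adm.X0_posDef H.pos H.X0inv_le u

lemma quad_Theta_ge (u : Fin n → ℝ) : b⁻¹ * (u ⬝ᵥ u) ≤ quad S.Theta u :=
  quad_ge_of_norm_inv_le H.adm.Theta_posDef H.pos H.Thetainv_le u

lemma quad_le_of_norm_le {k : ℕ} {M : Matrix (Fin k) (Fin k) ℝ} (hM : ‖M‖ ≤ b)
    (u : Fin k → ℝ) : quad M u ≤ b * (u ⬝ᵥ u) :=
  (quad_le_norm M u).trans (mul_le_mul_of_nonneg_right hM (dotProduct_self_nonneg' u))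

lemma innov_Sig_posDef : (S.innov Sig).PosDef := H.adm.innov_posDef H.sol.1

lemma quad_Sig_eq (u : Fin n → ℝ) :
    quad Sig u = quad Sig ((S.kalmanA Sig)ᵀ *ᵥ u) + quad S.V ((S.kalmanGain Sig)ᵀ *ᵥ u)
      + quad S.W u := by
  have := quad_ric H.innov_Sig_posDef H.sol.1.transpose_eq u
  rwa [H.sol.ric_eq_self] at this

lemma quad_Sig_ge (u : Fin n → ℝ) : b⁻¹ * (u ⬝ᵥ u) ≤ quad Sig u := by
  have h1 := H.sol.1.quad_nonneg ((S.kalmanA Sig)ᵀ *ᵥ u)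
  have h2 := H.adm.V_posDef.quad_nonneg ((S.kalmanGain Sig)ᵀ *ᵥ u)
  linarith [H.quad_W_ge u, H.quad_Sig_eq u]

lemma quad_riccatiSeq_ge (h : ℕ) (u : Fin n → ℝ) :
    b⁻¹ * (u ⬝ᵥ u) ≤ quad (S.riccatiSeq h) u := by
  cases h with
  | zero => exact H.quad_X0_ge u
  | succ h =>
    have hP := H.adm.riccatiSeq_posDef h
    rw [riccatiSeq_succ, quad_ric (H.adm.innov_posDef hP) hP.transpose_eq]
    have h1 := hP.quad_nonneg ((S.kalmanA (S.riccatiSeq h))ᵀ *ᵥ u)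
    have h2 := H.adm.V_posDef.quad_nonneg ((S.kalmanGain (S.riccatiSeq h))ᵀ *ᵥ u)
    linarith [H.quad_W_ge u]

lemma quad_riccatiSeq_succ_le (h : ℕ) (u : Fin n → ℝ) :
    quad (S.riccatiSeq (h + 1)) u ≤ quad (S.riccatiSeq h) ((S.kalmanA Sig)ᵀ *ᵥ u)
      + quad S.V ((S.kalmanGain Sig)ᵀ *ᵥ u) + quad S.W u := by
  have hP := H.adm.riccatiSeq_posDef h
  rw [kalmanA_transpose_mulVec]
  exact quad_ric_le (H.adm.innov_posDef hP) hP.transpose_eq _ _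

/-- The stationary gain applied to b² Σ* reproduces b² Σ* up to the noise terms, which enter only
once and are dominated because b² ≥ 1. Initially X₀ ≤ b ≤ b² Σ*. -/
lemma quad_riccatiSeq_le_Sig (h : ℕ) (u : Fin n → ℝ) :
    quad (S.riccatiSeq h) u ≤ b ^ 2 * quad Sig u := by
  have hb := H.one_le
  induction h generalizing u with
  | zero =>
    have h1 := H.quad_le_of_norm_le H.X0_le u
    have h2 := mul_le_mul_of_nonneg_left (H.quad_Sig_ge u) (sq_nonneg b)
    have h3 : b ^ 2 * (b⁻¹ * (u ⬝ᵥ u)) = b * (u ⬝ᵥ u) := by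
      have := H.pos.ne'
      field_simp
    exact h1.trans (h3.symm.le.trans h2)
  | succ h ih =>
    have h1 := H.quad_riccatiSeq_succ_le h u
    have h2 := ih ((S.kalmanA Sig)ᵀ *ᵥ u)
    have h3 := H.quad_Sig_eq u
    have h4 := H.adm.V_posDef.quad_nonneg ((S.kalmanGain Sig)ᵀ *ᵥ u)
    have h5 := H.adm.W_posDef.quad_nonneg u
    have hb2 : 1 ≤ b ^ 2 := one_le_pow₀ hb
    rw [h3]
    nlinarith

lemma quad_riccatiSeq_le (h : ℕ) (u : Fin n → ℝ) :
    quad (S.riccatiSeq h) u ≤ b ^ 3 * (u ⬝ᵥ u) := by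
  have h1 := mul_le_mul_of_nonneg_left (H.quad_le_of_norm_le H.Sig_le u) (sq_nonneg b)
  linarith [H.quad_riccatiSeq_le_Sig h u, pow_succ b 2]

/-- One step of the exact filter contracts at a uniform rate. -/
lemma quad_riccatiSeq_contract (h : ℕ) (u : Fin n → ℝ) :
    quad (S.riccatiSeq h) ((S.kalmanA (S.riccatiSeq h))ᵀ *ᵥ u) ≤
      (1 - (b ^ 4)⁻¹) * quad (S.riccatiSeq (h + 1)) u := by
  have hP := H.adm.riccatiSeq_posDef h
  have h1 := quad_ric (H.adm.innov_posDef hP) hP.transpose_eq u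
  rw [← riccatiSeq_succ] at h1
  have h2 := H.adm.V_posDef.quad_nonneg ((S.kalmanGain (S.riccatiSeq h))ᵀ *ᵥ u)
  have h3 := mul_le_mul_of_nonneg_left (H.quad_riccatiSeq_le (h + 1) u)
    (inv_nonneg.2 (pow_nonneg H.pos.le 4))
  have h4 : (b ^ 4)⁻¹ * (b ^ 3 * (u ⬝ᵥ u)) = b⁻¹ * (u ⬝ᵥ u) := by
    have := H.pos.ne'
    field_simp
  linarith [H.quad_W_ge u]

/-- Each stationary step adds `S.W`, which is at least b⁻¹ and hence at least b⁻² Σ*. The remaining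
part of Σ* must therefore shrink. This is why the transposed induced norm is always below 1. -/
lemma quad_Sig_contract (u : Fin n → ℝ) :
    quad Sig ((S.kalmanA Sig)ᵀ *ᵥ u) ≤ (1 - (b ^ 2)⁻¹) * quad Sig u := by
  have h1 := H.quad_Sig_eq u
  have h2 := H.adm.V_posDef.quad_nonneg ((S.kalmanGain Sig)ᵀ *ᵥ u)
  have h3 := mul_le_mul_of_nonneg_left (H.quad_le_of_norm_le H.Sig_le u)
    (inv_nonneg.2 (pow_nonneg H.pos.le 2))
  have h4 : (b ^ 2)⁻¹ * (b * (u ⬝ᵥ u)) = b⁻¹ * (u ⬝ᵥ u) := by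
    have := H.pos.ne'
    field_simp
  linarith [H.quad_W_ge u]

/-- Running the Riccati iteration with the stationary gain adds the same noise terms as Σ* receives,
so they cancel in the difference. -/
lemma quad_riccatiSeq_sub_le (h : ℕ) (u : Fin n → ℝ) :
    quad (S.riccatiSeq h - Sig) u ≤ quad (S.X0 - Sig) ((S.kalmanA Sig ^ h)ᵀ *ᵥ u) := by
  induction h generalizing u with
  | zero => simp [riccatiSeq]
  | succ h ih =>
    have h1 := H.quad_riccatiSeq_succ_le h u
    have h2 := ih ((S.kalmanA Sig)ᵀ *ᵥ u)
    rw [mulVec_mulVec, ← transpose_mul, ← pow_succ'] at h2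
    rw [quad_sub_mat] at h2 ⊢
    linarith [H.quad_Sig_eq u]

/-- The second moment matrix of the differences between the errors of the exact time-varying filter
and those of the stationary filter, both started without initial error, is positive
semidefinite. -/
lemma exists_transition (h : ℕ) : ∃ Phi : Matrix (Fin n) (Fin n) ℝ, ∀ x y : Fin n → ℝ,
    0 ≤ quad (S.riccatiSeq h) x - quad S.X0 (Phiᵀ *ᵥ x)
      + 2 * (x ⬝ᵥ Sig *ᵥ y - (Phiᵀ *ᵥ x) ⬝ᵥ Sig *ᵥ ((S.kalmanA Sig ^ h)ᵀ *ᵥ y))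
      + (quad Sig y - quad Sig ((S.kalmanA Sig ^ h)ᵀ *ᵥ y)) := by
  induction h with
  | zero => exact ⟨1, fun x y => by simp [riccatiSeq]⟩
  | succ h ih =>
    obtain ⟨Phi, hPhi⟩ := ih
    have hP := H.adm.riccatiSeq_posDef h
    refine ⟨S.kalmanA (S.riccatiSeq h) * Phi, fun x y => ?_⟩
    have h1 := hPhi ((S.kalmanA (S.riccatiSeq h))ᵀ *ᵥ x) ((S.kalmanA Sig)ᵀ *ᵥ y)
    rw [mulVec_mulVec y (S.kalmanA Sig ^ h)ᵀ, ← transpose_mul, ← pow_succ',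
      mulVec_mulVec x Phiᵀ, ← transpose_mul] at h1
    have h2 := quad_ric (H.adm.innov_posDef hP) hP.transpose_eq x
    have h3 := H.quad_Sig_eq y
    have h4 := cross_stationary H.sol.1.transpose_eq H.innov_Sig_posDef H.adm.W_posDef
      H.sol.ric_eq_self x y ((S.kalmanGain (S.riccatiSeq h))ᵀ *ᵥ x)
    rw [← kalmanA_transpose_mulVec] at h4
    -- Both errors are driven by the same noise, so one step adds the forms of `S.V` and `S.W` at
    -- the sum of the two filtered functionals. Their cross terms are those of `cross_stationary`.
    have h5 := H.adm.V_posDef.quad_nonneg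
      ((S.kalmanGain (S.riccatiSeq h))ᵀ *ᵥ x + (S.kalmanGain Sig)ᵀ *ᵥ y)
    have h6 := H.adm.W_posDef.quad_nonneg (x + y)
    rw [quad_add_vec H.adm.V_posDef.transpose_eq] at h5
    rw [quad_add_vec H.adm.W_posDef.transpose_eq] at h6
    rw [riccatiSeq_succ]
    linarith

/-- Taking y = −u in `exists_transition` leaves X₀[Φᵀu] − 2 Φᵀu · Σ*ψ + Σ*[ψ]. Minimizing over the
unknown vector Φᵀu removes Φ and leaves the form of Σ* − Σ* X₀⁻¹ Σ* = (X₀ − Σ*) X₀⁻¹ Σ* at ψ, which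
is proportional to X₀ − Σ*. -/
lemma quad_riccatiSeq_sub_ge (h : ℕ) (u : Fin n → ℝ) :
    -(b ^ 2 * ‖S.X0 - Sig‖ *
        (((S.kalmanA Sig ^ h)ᵀ *ᵥ u) ⬝ᵥ ((S.kalmanA Sig ^ h)ᵀ *ᵥ u))) ≤
      quad (S.riccatiSeq h - Sig) u := by
  obtain ⟨Phi, hPhi⟩ := H.exists_transition h
  have h1 := hPhi u (-u)
  set psi := (S.kalmanA Sig ^ h)ᵀ *ᵥ u with hpsi
  have hSt := H.sol.1.transpose_eq
  rw [mulVec_neg, mulVec_neg, mulVec_neg, dotProduct_neg, dotProduct_neg, ← hpsi, quad_neg_vec,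
    quad_neg_vec] at h1
  have h2 := H.adm.X0_posDef.quad_inv_ge (Sig *ᵥ psi) (Phiᵀ *ᵥ u)
  rw [dotProduct_comm] at h2
  have h3 : quad Sig psi - quad S.X0⁻¹ (Sig *ᵥ psi) =
      quad ((S.X0 - Sig) * S.X0⁻¹ * Sig) psi := by
    have e : (S.X0 - Sig) * S.X0⁻¹ * Sig = Sig - Sig * S.X0⁻¹ * Sigᵀ := by
      rw [Matrix.sub_mul, Matrix.sub_mul, H.adm.X0_posDef.mul_inv, Matrix.one_mul, hSt]
    rw [e, quad_sub_mat, quad_conj, hSt]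
  have h4 : ‖(S.X0 - Sig) * S.X0⁻¹ * Sig‖ ≤ b ^ 2 * ‖S.X0 - Sig‖ := by
    refine (l2_opNorm_mul _ _).trans ?_
    refine (mul_le_mul (l2_opNorm_mul _ _) H.Sig_le (norm_nonneg _) (by positivity)).trans ?_
    have := mul_le_mul_of_nonneg_left H.X0inv_le (norm_nonneg (S.X0 - Sig))
    have := mul_le_mul_of_nonneg_right this H.pos.le
    linarith
  have h5 := (abs_le.1 (abs_quad_le ((S.X0 - Sig) * S.X0⁻¹ * Sig) psi)).1
  have h6 := mul_le_mul_of_nonneg_right h4 (dotProduct_self_nonneg' psi)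
  have h7 : u ⬝ᵥ Sig *ᵥ u = quad Sig u := rfl
  rw [quad_sub_mat]
  linarith

lemma norm_riccatiSeq_sub_le (h : ℕ) :
    ‖S.riccatiSeq h - Sig‖ ≤ b ^ 2 * ‖S.X0 - Sig‖ * ‖S.kalmanA Sig ^ h‖ ^ 2 := by
  have hb := H.one_le
  refine l2_opNorm_le_of_abs_quad_le ?_ (by positivity) fun u => ?_
  · rw [transpose_sub, (H.adm.riccatiSeq_posDef h).transpose_eq, H.sol.1.transpose_eq]
  · have h1 := mulVec_self_le (S.kalmanA Sig ^ h)ᵀ u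
    rw [l2_opNorm_transpose] at h1
    have h2 := H.quad_riccatiSeq_sub_ge h u
    have h3 := H.quad_riccatiSeq_sub_le h u
    have h4 := quad_le_norm (S.X0 - Sig) ((S.kalmanA Sig ^ h)ᵀ *ᵥ u)
    have h0 := dotProduct_self_nonneg' ((S.kalmanA Sig ^ h)ᵀ *ᵥ u)
    have hb2 : 1 ≤ b ^ 2 := one_le_pow₀ hb
    have h5 : ‖S.X0 - Sig‖ ≤ b ^ 2 * ‖S.X0 - Sig‖ :=
      le_mul_of_one_le_left (norm_nonneg _) hb2
    have h6 := mul_le_mul_of_nonneg_right h5 h0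
    have h7 := mul_le_mul_of_nonneg_left h1 (by positivity : 0 ≤ b ^ 2 * ‖S.X0 - Sig‖)
    exact abs_le.2 ⟨by linarith, by linarith⟩

end BoundedBy

end RiccatiBounds

end KFSystem

namespace KFSystem

/-! ### Second moments of state and estimate under arbitrary filters. -/

section Moments

variable {n m : ℕ} (S : KFSystem n m) (π : ℕ → FilterGain n m)

/-- The second moment of the initial mean. -/
def meanMoment : Matrix (Fin n) (Fin n) ℝ := vecMulVec S.xbar0.ofLp S.xbar0.ofLp

/-- The second moment of the unperturbed state. -/
def stateMoment : ℕ → Matrix (Fin n) (Fin n) ℝ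
  | 0 => S.X0 + S.meanMoment
  | t + 1 => S.A * stateMoment t * S.Aᵀ + S.W

/-- The mixed second moment of the unperturbed state and its estimate. -/
def crossMoment : ℕ → Matrix (Fin n) (Fin n) ℝ
  | 0 => S.meanMoment
  | t + 1 => S.A * crossMoment t * (π t).1ᵀ + S.A * S.stateMoment t * (S.Cᵀ * (π t).2ᵀ)

/-- The second moment of the unperturbed estimate. -/
def estMoment : ℕ → Matrix (Fin n) (Fin n) ℝ
  | 0 => S.meanMoment
  | t + 1 => (π t).1 * estMoment t * (π t).1ᵀ
      + ((π t).2 * S.C * S.crossMoment π t * (π t).1ᵀ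
        + ((π t).2 * S.C * S.crossMoment π t * (π t).1ᵀ)ᵀ)
      + ((π t).2 * S.C * S.stateMoment t * ((π t).2 * S.C)ᵀ + (π t).2 * S.V * (π t).2ᵀ)

/-- The second moment of the linear functional `f · x + g · xhat` of the unperturbed state and its
estimate. -/
def joint (t : ℕ) (f g : Fin n → ℝ) : ℝ :=
  quad (S.stateMoment t) f + 2 * (f ⬝ᵥ S.crossMoment π t *ᵥ g) + quad (S.estMoment π t) g

lemma quad_meanMoment (u : Fin n → ℝ) : quad S.meanMoment u = (u ⬝ᵥ S.xbar0.ofLp) ^ 2 := by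
  simp only [quad, meanMoment, vecMulVec_mulVec, op_smul_eq_smul, dotProduct_smul,
    smul_eq_mul, dotProduct_comm S.xbar0.ofLp u]
  ring

lemma meanMoment_transpose : S.meanMomentᵀ = S.meanMoment := by
  ext i j; simp [meanMoment, vecMulVec, mul_comm]

lemma joint_zero (f g : Fin n → ℝ) :
    S.joint π 0 f g = quad S.X0 f + ((f + g) ⬝ᵥ S.xbar0.ofLp) ^ 2 := by
  rw [← quad_meanMoment, quad_add_vec S.meanMoment_transpose, joint, stateMoment, crossMoment,
    estMoment, quad_add_mat]
  ring

variable {S} {π}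

lemma Admissible.stateMoment_transpose (hS : S.Admissible) (t : ℕ) :
    (S.stateMoment t)ᵀ = S.stateMoment t := by
  induction t with
  | zero => simp [stateMoment, meanMoment_transpose, hS.X0_posDef.transpose_eq]
  | succ t ih => simp [stateMoment, ih, hS.W_posDef.transpose_eq, Matrix.mul_assoc]

lemma Admissible.estMoment_transpose (hS : S.Admissible) (t : ℕ) :
    (S.estMoment π t)ᵀ = S.estMoment π t := by
  induction t with
  | zero => simp [estMoment, meanMoment_transpose]
  | succ t ih =>
    have h1 := hS.stateMoment_transpose t
    have h2 := hS.V_posDef.transpose_eq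
    rw [estMoment]
    simp only [transpose_add, transpose_mul, transpose_transpose, ih, h1, h2, Matrix.mul_assoc]
    abel

lemma Admissible.joint_succ (hS : S.Admissible) (t : ℕ) (f g : Fin n → ℝ) :
    S.joint π (t + 1) f g =
      S.joint π t (S.Aᵀ *ᵥ f + S.Cᵀ *ᵥ (π t).2ᵀ *ᵥ g) ((π t).1ᵀ *ᵥ g)
        + quad S.W f + quad S.V ((π t).2ᵀ *ᵥ g) := by
  have h1 := hS.stateMoment_transpose t
  have e1 : f ⬝ᵥ (S.A * S.crossMoment π t * (π t).1ᵀ) *ᵥ g =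
      (S.Aᵀ *ᵥ f) ⬝ᵥ S.crossMoment π t *ᵥ (π t).1ᵀ *ᵥ g := by
    rw [mulVec_transpose S.A, ← dotProduct_mulVec]; simp only [← mulVec_mulVec]
  have e2 : f ⬝ᵥ (S.A * S.stateMoment t * (S.Cᵀ * (π t).2ᵀ)) *ᵥ g =
      (S.Aᵀ *ᵥ f) ⬝ᵥ S.stateMoment t *ᵥ S.Cᵀ *ᵥ (π t).2ᵀ *ᵥ g := by
    rw [mulVec_transpose S.A, ← dotProduct_mulVec]; simp only [← mulVec_mulVec]
  have e3 : quad ((π t).2 * S.C * S.crossMoment π t * (π t).1ᵀ) g =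
      (S.Cᵀ *ᵥ (π t).2ᵀ *ᵥ g) ⬝ᵥ S.crossMoment π t *ᵥ (π t).1ᵀ *ᵥ g := by
    rw [mulVec_transpose S.C, ← dotProduct_mulVec, mulVec_transpose (π t).2, ← dotProduct_mulVec]
    simp only [quad, ← mulVec_mulVec]
  have e4 : ((π t).2 * S.C)ᵀ *ᵥ g = S.Cᵀ *ᵥ (π t).2ᵀ *ᵥ g := by
    rw [transpose_mul, ← mulVec_mulVec]
  rw [joint, joint, stateMoment, crossMoment, estMoment]
  simp only [quad_add_mat, quad_transpose, quad_conj, e3, e4, add_mulVec, dotProduct_add, e1, e2,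
    quad_add_vec h1, add_dotProduct]
  ring

/-- No linear filter beats the exact error covariances. -/
lemma Admissible.quad_riccatiSeq_le_joint (hS : S.Admissible) (t : ℕ) (f g : Fin n → ℝ) :
    quad (S.riccatiSeq t) f ≤ S.joint π t f g := by
  induction t generalizing f g with
  | zero => rw [joint_zero]; exact le_add_of_nonneg_right (sq_nonneg _)
  | succ t ih =>
    have hP := hS.riccatiSeq_posDef t
    have h1 := quad_ric_le (hS.innov_posDef hP) hP.transpose_eq f (-((π t).2ᵀ *ᵥ g))
    rw [hS.joint_succ, riccatiSeq_succ]
    rw [mulVec_neg, sub_neg_eq_add, quad_neg_vec] at h1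
    linarith [ih (S.Aᵀ *ᵥ f + S.Cᵀ *ᵥ (π t).2ᵀ *ᵥ g) ((π t).1ᵀ *ᵥ g)]

variable (S) (π)

/-- The second moment of the perturbed estimate at the time of the perturbation. -/
def regMoment (t : ℕ) : Matrix (Fin n) (Fin n) ℝ := S.estMoment π t + S.Theta

/-- The linear regression of the perturbed state on the perturbed estimate. -/
def regression (t : ℕ) : Matrix (Fin n) (Fin n) ℝ :=
  (S.crossMoment π t + S.Theta) * (S.regMoment π t)⁻¹

/-- The residual covariance of the linear regression of the perturbed state on the perturbed
estimate. -/
def residual (t : ℕ) : Matrix (Fin n) (Fin n) ℝ :=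
  S.stateMoment t + S.Theta
    - (S.crossMoment π t + S.Theta) * (S.regMoment π t)⁻¹ * (S.crossMoment π t + S.Theta)ᵀ

variable {S} {π}

lemma Admissible.regMoment_posDef (hS : S.Admissible) (t : ℕ) : (S.regMoment π t).PosDef :=
  posDef_of_quad_pos (by
    simp [regMoment, hS.estMoment_transpose, hS.Theta_posDef.transpose_eq]) fun u hu => by
    have h1 := hS.quad_riccatiSeq_le_joint (π := π) t 0 u
    have h2 := hS.Theta_posDef.quad_pos hu
    simp only [joint, quad_zero_vec, zero_dotProduct] at h1
    rw [regMoment, quad_add_mat]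
    linarith

lemma Admissible.residual_transpose (hS : S.Admissible) (t : ℕ) :
    (S.residual π t)ᵀ = S.residual π t := by
  have h1 := hS.stateMoment_transpose t
  have h2 := (hS.regMoment_posDef (π := π) t).inv_transpose
  have h3 := hS.Theta_posDef.transpose_eq
  simp only [residual, transpose_sub, transpose_add, transpose_mul, transpose_transpose, h1, h2, h3,
    Matrix.mul_assoc]

/-- The left side is the second moment of the functional once θ₀ is added to both state and
estimate. Completing the square in g separates the residual from the regression. -/
lemma Admissible.joint_add_quad_Theta (hS : S.Admissible) (t : ℕ) (f g : Fin n → ℝ) :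
    S.joint π t f g + quad S.Theta (f + g) =
      quad (S.residual π t) f + quad (S.regMoment π t) ((S.regression π t)ᵀ *ᵥ f + g) := by
  have hM := hS.regMoment_posDef (π := π) t
  have h1 : S.regression π t * S.regMoment π t = S.crossMoment π t + S.Theta := by
    rw [regression, Matrix.mul_assoc, hM.inv_mul, Matrix.mul_one]
  have e1 : ((S.regression π t)ᵀ *ᵥ f) ⬝ᵥ S.regMoment π t *ᵥ g =
      f ⬝ᵥ (S.crossMoment π t + S.Theta) *ᵥ g := by
    rw [mulVec_transpose (S.regression π t), ← dotProduct_mulVec, mulVec_mulVec, h1]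
  have e2 : quad (S.regMoment π t) ((S.regression π t)ᵀ *ᵥ f) =
      quad ((S.crossMoment π t + S.Theta) * (S.regMoment π t)⁻¹
        * (S.crossMoment π t + S.Theta)ᵀ) f := by
    rw [← quad_conj, h1, regression, transpose_mul, hM.inv_transpose, Matrix.mul_assoc]
  rw [quad_add_vec hM.transpose_eq, e1, e2, residual, quad_sub_mat, quad_add_mat, joint,
    quad_add_vec hS.Theta_posDef.transpose_eq, regMoment, quad_add_mat, add_mulVec, dotProduct_add]
  ring

/-- At g = −Rᵀf the regression square vanishes. What remains is the error of a linear estimator, no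
better than the exact filter, plus the part of θ₀ that R fails to cancel. So a nearly optimal
residual forces R to be close to 1. -/
lemma Admissible.quad_residual_ge (hS : S.Admissible) (t : ℕ) (f : Fin n → ℝ) :
    quad (S.riccatiSeq t) f + quad S.Theta ((S.regression π t - 1)ᵀ *ᵥ f) ≤
      quad (S.residual π t) f := by
  have h1 := hS.joint_add_quad_Theta (π := π) t f (-((S.regression π t)ᵀ *ᵥ f))
  have h2 := hS.quad_riccatiSeq_le_joint (π := π) t f (-((S.regression π t)ᵀ *ᵥ f))
  rw [add_neg_cancel, quad_zero_vec, add_zero] at h1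
  have h3 : (S.regression π t - 1)ᵀ *ᵥ f = -(f + -((S.regression π t)ᵀ *ᵥ f)) := by
    simp [sub_mulVec]; abel
  rw [h3, quad_neg_vec, ← h1]
  linarith

lemma Admissible.residual_posDef (hS : S.Admissible) (t : ℕ) : (S.residual π t).PosDef :=
  posDef_of_quad_pos (hS.residual_transpose t) fun u hu => by
    have h1 := hS.quad_residual_ge (π := π) t u
    have h2 := (hS.riccatiSeq_posDef t).quad_pos hu
    have h3 := hS.Theta_posDef.quad_nonneg ((S.regression π t - 1)ᵀ *ᵥ u)
    linarith

/-- The initial estimate is the deterministic mean, so its mixed moment with the state equals its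
own second moment and the regression is the identity. -/
lemma Admissible.residual_zero (hS : S.Admissible) : S.residual π 0 = S.X0 := by
  have hM := hS.regMoment_posDef (π := π) 0
  have h1 : S.crossMoment π 0 + S.Theta = S.regMoment π 0 := rfl
  rw [residual, h1, hM.mul_inv, Matrix.one_mul, hM.transpose_eq, regMoment, estMoment, stateMoment]
  abel

variable (S) (π) in
/-- The transition matrix of the perturbed estimate. -/
def trans (t : ℕ) : Matrix (Fin n) (Fin n) ℝ := (π t).1 + (π t).2 * S.C * S.regression π t

lemma Admissible.joint_succ_le (hS : S.Admissible) (t : ℕ) (f g : Fin n → ℝ) :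
    S.joint π (t + 1) f g ≤
      quad (S.residual π t) (S.Aᵀ *ᵥ f + S.Cᵀ *ᵥ (π t).2ᵀ *ᵥ g)
        + quad (S.regMoment π t) ((S.A * S.regression π t)ᵀ *ᵥ f + (S.trans π t)ᵀ *ᵥ g)
        + quad S.W f + quad S.V ((π t).2ᵀ *ᵥ g) := by
  have h1 := hS.joint_add_quad_Theta (π := π) t
    (S.Aᵀ *ᵥ f + S.Cᵀ *ᵥ (π t).2ᵀ *ᵥ g) ((π t).1ᵀ *ᵥ g)
  have h2 := hS.Theta_posDef.quad_nonneg
    (S.Aᵀ *ᵥ f + S.Cᵀ *ᵥ (π t).2ᵀ *ᵥ g + (π t).1ᵀ *ᵥ g)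
  have h3 : (S.regression π t)ᵀ *ᵥ (S.Aᵀ *ᵥ f + S.Cᵀ *ᵥ (π t).2ᵀ *ᵥ g) + (π t).1ᵀ *ᵥ g =
      (S.A * S.regression π t)ᵀ *ᵥ f + (S.trans π t)ᵀ *ᵥ g := by
    simp only [trans, transpose_add, transpose_mul, add_mulVec, mulVec_add, ← mulVec_mulVec]
    abel
  rw [h3] at h1
  rw [hS.joint_succ]
  linarith

/-- The residual is bounded by the error of any trial estimator of f · x, here (f + k) · x̂. The
correction k is free: it can cancel the filter error weighted by the possibly huge `regMoment`, at
the price of the form of `S.Theta` at k and a change in the innovation term. -/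
lemma Admissible.quad_residual_succ_le (hS : S.Admissible) (t : ℕ) (f k : Fin n → ℝ) :
    quad (S.residual π (t + 1)) f ≤
      quad (S.ric (S.residual π t)) f
        + quad (S.innov (S.residual π t))
            ((π t).2ᵀ *ᵥ (f + k) - (S.kalmanGain (S.residual π t))ᵀ *ᵥ f)
        + quad (S.regMoment π t)
            ((S.trans π t - S.A * S.regression π t)ᵀ *ᵥ f + (S.trans π t)ᵀ *ᵥ k)
        + quad S.Theta k := by
  have hP := hS.residual_posDef (π := π) t
  have h1 := hS.joint_add_quad_Theta (π := π) (t + 1) f (-(f + k))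
  have h2 := (hS.regMoment_posDef (π := π) (t + 1)).quad_nonneg
    ((S.regression π (t + 1))ᵀ *ᵥ f + -(f + k))
  have h3 := hS.joint_succ_le (π := π) t f (-(f + k))
  have h4 := quad_ric_add (hS.innov_posDef hP) hP.transpose_eq f ((π t).2ᵀ *ᵥ (f + k))
  have e1 : (S.A * S.regression π t)ᵀ *ᵥ f + (S.trans π t)ᵀ *ᵥ (-(f + k)) =
      -((S.trans π t - S.A * S.regression π t)ᵀ *ᵥ f + (S.trans π t)ᵀ *ᵥ k) := by
    simp only [transpose_sub, sub_mulVec, mulVec_neg, mulVec_add]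
    abel
  have e2 : f + -(f + k) = -k := by abel
  rw [e1, quad_neg_vec, mulVec_neg, mulVec_neg, ← sub_eq_add_neg, quad_neg_vec] at h3
  rw [e2, quad_neg_vec] at h1
  linarith

lemma Admissible.quad_regMoment_succ_le (hS : S.Admissible) (t : ℕ) (g : Fin n → ℝ) :
    quad (S.regMoment π (t + 1)) g ≤ quad (S.regMoment π t) ((S.trans π t)ᵀ *ᵥ g)
      + quad (S.innov (S.residual π t)) ((π t).2ᵀ *ᵥ g) + quad S.Theta g := by
  have h1 := hS.joint_succ_le (π := π) t 0 g
  simp only [joint, quad_zero_vec, zero_dotProduct, mulVec_zero, zero_add] at h1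
  rw [quad_innov, regMoment, quad_add_mat]
  linarith

end Moments

end KFSystem

/-! ### Regularized regression under an expanding indefinite form. -/

section Dichotomy

variable {ι : Type*} [Fintype ι] [DecidableEq ι]

lemma _root_.Matrix.PosDef.quad_inv_ge_of_le {M : Matrix ι ι ℝ} (hM : M.PosDef) {c : ℝ}
    (hc : 0 < c) (h : ∀ u : ι → ℝ, quad M u ≤ c * (u ⬝ᵥ u)) (y : ι → ℝ) :
    c⁻¹ * (y ⬝ᵥ y) ≤ quad M⁻¹ y := by
  have h1 := hM.quad_inv_ge y (c⁻¹ • y)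
  rw [quad_smul_vec, dotProduct_smul, smul_eq_mul] at h1
  have h2 := mul_le_mul_of_nonneg_left (h y) (sq_nonneg c⁻¹)
  have h3 : c⁻¹ ^ 2 * (c * (y ⬝ᵥ y)) = c⁻¹ * (y ⬝ᵥ y) := by field_simp
  linarith

lemma _root_.Matrix.PosDef.quad_mulVec_inv {M : Matrix ι ι ℝ} (hM : M.PosDef) (y : ι → ℝ) :
    quad M (M⁻¹ *ᵥ y) = quad M⁻¹ y := by
  rw [← hM.quad_inv_mulVec, mulVec_mulVec, hM.mul_inv, one_mulVec]

/-- Regression through a regularized linear map that expands an indefinite quadratic form: the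
residual does not depend on the size of the regressed covariance `M`. -/
lemma exists_regression_le {M Θ A Q : Matrix ι ι ℝ} {s κ : ℝ} (hM : M.PosDef) (hΘ : Θ.PosDef)
    (hs0 : 0 ≤ s) (hs1 : s ≤ 1) (hκ : 0 < κ)
    (hQA : ∀ z : ι → ℝ, s * quad Q z + 2⁻¹ * (z ⬝ᵥ z) ≤ quad Q (A *ᵥ z))
    (hQM : ∀ z, -(κ * quad Q z) ≤ quad M⁻¹ z) (hQΘ : ∀ z, κ * quad Q z ≤ quad Θ⁻¹ z)
    (γ : ι → ℝ) :
    ∃ k : ι → ℝ, quad M (γ + Aᵀ *ᵥ k) + quad Θ k ≤ 2 * κ⁻¹ * (γ ⬝ᵥ γ) := by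
  set G : Matrix ι ι ℝ := M⁻¹ + Aᵀ * Θ⁻¹ * A with hG
  have hGt : Gᵀ = G := by
    simp only [hG, transpose_add, transpose_mul, transpose_transpose, hM.inv_transpose,
      hΘ.inv_transpose, Matrix.mul_assoc]
  have hGq : ∀ z, quad G z = quad M⁻¹ z + quad Θ⁻¹ (A *ᵥ z) := fun z => by
    rw [hG, quad_add_mat, quad_conj_transpose]
  -- The two parts compensate each other: M⁻¹ ≥ s M⁻¹ ≥ −κ s Q, while AᵀΘ⁻¹A ≥ κ AᵀQA ≥ κ (s Q +
  -- 1/2). The indefinite terms cancel, leaving a bound free of M.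
  have hGe : ∀ z : ι → ℝ, κ / 2 * (z ⬝ᵥ z) ≤ quad G z := fun z => by
    rw [hGq]
    have h1 := mul_le_mul_of_nonneg_left (hQA z) hκ.le
    have h2 := mul_le_mul_of_nonneg_left (hQM z) hs0
    have h3 := mul_le_mul_of_nonneg_right hs1 (hM.inv.quad_nonneg z)
    have h4 := hQΘ (A *ᵥ z)
    linarith
  have hGp : G.PosDef := posDef_of_quad_ge hGt (half_pos hκ) hGe
  set z := G⁻¹ *ᵥ γ with hz
  have hGz : G *ᵥ z = γ := by rw [hz, mulVec_mulVec, hGp.mul_inv, one_mulVec]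
  -- The minimizer of the regularized problem, whose value is γ · G⁻¹γ.
  refine ⟨-(Θ⁻¹ *ᵥ A *ᵥ z), ?_⟩
  have e1 : γ + Aᵀ *ᵥ (-(Θ⁻¹ *ᵥ A *ᵥ z)) = M⁻¹ *ᵥ z := by
    rw [← hGz, hG, add_mulVec, mulVec_neg]
    simp only [← mulVec_mulVec]
    abel
  rw [e1, quad_neg_vec, hM.quad_mulVec_inv, hΘ.quad_mulVec_inv, ← hGq]
  have h1 : quad G z = z ⬝ᵥ γ := by rw [quad, hGz]
  have h2 := hGe z
  have h3 := dotProduct_sq_le z γ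
  rw [h1] at h2 ⊢
  have h4 := dotProduct_self_nonneg' γ
  have h5 := dotProduct_self_nonneg' z
  have h6 : 0 ≤ z ⬝ᵥ γ := le_trans (by positivity) h2
  rcases h6.eq_or_lt with h0 | h0
  · rw [← h0]; positivity
  · refine le_of_mul_le_mul_left ?_ h0
    have h7 := mul_le_mul_of_nonneg_right h2 (by positivity : 0 ≤ 2 * κ⁻¹ * (γ ⬝ᵥ γ))
    have h8 : κ / 2 * (z ⬝ᵥ z) * (2 * κ⁻¹ * (γ ⬝ᵥ γ)) = (z ⬝ᵥ z) * (γ ⬝ᵥ γ) := by field_simp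
    nlinarith

/-- The lower bound of `M⁻¹` by the negative of an expanded indefinite quadratic form is
propagated. -/
lemma neg_quad_le_quad_inv {M M' A Q : Matrix ι ι ℝ} {s κ ν q a : ℝ} (hM : M.PosDef)
    (hM' : M'.PosDef) (hs0 : 0 ≤ s) (hs1 : s ≤ 1) (hκ : 0 < κ) (hν : 0 < ν)
    (hQt : Qᵀ = Q) (hQ : ‖Q‖ ≤ q) (hA : ‖A‖ ≤ a)
    (hκν : κ * ν * (2 * q ^ 2 * a ^ 2 + q) ≤ 1)
    (hQA : ∀ z : ι → ℝ, s * quad Q z + 2⁻¹ * (z ⬝ᵥ z) ≤ quad Q (A *ᵥ z))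
    (hQM : ∀ z, -(κ * quad Q z) ≤ quad M⁻¹ z)
    (hMM : ∀ g, quad M' g ≤ quad M (Aᵀ *ᵥ g) + ν * (g ⬝ᵥ g)) (y : ι → ℝ) :
    -(κ * quad Q y) ≤ quad M'⁻¹ y := by
  have hq : 0 ≤ q := (norm_nonneg _).trans hQ
  have ha : 0 ≤ a := (norm_nonneg _).trans hA
  set N : Matrix ι ι ℝ := A * M * Aᵀ + ν • 1 with hN
  have hNq : ∀ g, quad N g = quad M (Aᵀ *ᵥ g) + ν * (g ⬝ᵥ g) := fun g => by
    rw [hN, quad_add_mat, quad_conj, quad_smul_mat, quad_one]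
  have hNp : N.PosDef := posDef_of_quad_ge
    (by simp [hN, hM.transpose_eq, Matrix.mul_assoc]) hν fun g => by
      rw [hNq]; linarith [hM.quad_nonneg (Aᵀ *ᵥ g)]
  refine le_trans ?_ (hM'.quad_inv_anti hNp (fun g => by rw [hNq]; exact hMM g) y)
  set u := N⁻¹ *ᵥ y with hu
  have hNu : N *ᵥ u = y := by rw [hu, mulVec_mulVec, hNp.mul_inv, one_mulVec]
  set z := M *ᵥ Aᵀ *ᵥ u with hz
  -- This splits y into a transported part and a noise part so that N⁻¹[y] = M⁻¹[z] + ν |u|².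
  have hy : y = A *ᵥ z + ν • u := by
    rw [← hNu, hN, add_mulVec, smul_mulVec, one_mulVec, hz]
    simp only [mulVec_mulVec, Matrix.mul_assoc]
  have e1 : quad N⁻¹ y = quad M⁻¹ z + ν * (u ⬝ᵥ u) := by
    rw [← hNu, hNp.quad_inv_mulVec, hNq, hz, hM.quad_inv_mulVec]
  have e2 : quad Q y = quad Q (A *ᵥ z) + 2 * (ν * ((A *ᵥ z) ⬝ᵥ Q *ᵥ u)) + ν ^ 2 * quad Q u := by
    rw [hy, quad_add_vec hQt, quad_smul_vec, mulVec_smul, dotProduct_smul, smul_eq_mul]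
  have h0 : 0 ≤ u ⬝ᵥ u := dotProduct_self_nonneg' u
  have hz0 : 0 ≤ z ⬝ᵥ z := dotProduct_self_nonneg' z
  have h1 : -(q * (u ⬝ᵥ u)) ≤ quad Q u := by
    have := (abs_le.1 (abs_quad_le Q u)).1
    have := mul_le_mul_of_nonneg_right hQ h0
    linarith
  have h2 : -(q * a * (√(z ⬝ᵥ z) * √(u ⬝ᵥ u))) ≤ (A *ᵥ z) ⬝ᵥ Q *ᵥ u := by
    have h3 : (A *ᵥ z) ⬝ᵥ Q *ᵥ u = z ⬝ᵥ (Aᵀ * Q) *ᵥ u := by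
      rw [dotProduct_comm, dotProduct_mulVec, ← mulVec_transpose, dotProduct_comm, mulVec_mulVec]
    have h4 := (abs_le.1 (abs_dotProduct_mulVec_le (Aᵀ * Q) z u)).1
    have h5 : ‖Aᵀ * Q‖ ≤ q * a := by
      refine (l2_opNorm_mul _ _).trans ?_
      rw [l2_opNorm_transpose, mul_comm q a]
      exact mul_le_mul hA hQ (norm_nonneg _) ha
    have := mul_le_mul_of_nonneg_right h5 (by positivity : 0 ≤ √(z ⬝ᵥ z) * √(u ⬝ᵥ u))
    rw [h3]
    linarith
  have h3 := hQA z
  have h4 : -(κ * (s * quad Q z)) ≤ quad M⁻¹ z := by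
    have h5 := mul_le_mul_of_nonneg_left (hQM z) hs0
    have h6 := mul_le_mul_of_nonneg_right hs1 (hM.inv.quad_nonneg z)
    linarith
  set Z := √(z ⬝ᵥ z) with hZ
  set W := √(u ⬝ᵥ u) with hW
  have hZ2 : z ⬝ᵥ z = Z ^ 2 := (Real.sq_sqrt hz0).symm
  have hW2 : u ⬝ᵥ u = W ^ 2 := (Real.sq_sqrt h0).symm
  rw [e1, e2]
  rw [hW2] at h1 ⊢
  rw [hZ2] at h3
  have k1 := mul_le_mul_of_nonneg_left h1 (by positivity : 0 ≤ κ * ν ^ 2)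
  have k2 := mul_le_mul_of_nonneg_left h2 (by positivity : 0 ≤ 2 * κ * ν)
  have k3 := mul_le_mul_of_nonneg_left h3 hκ.le
  have k4 := mul_le_mul_of_nonneg_right hκν (by positivity : 0 ≤ ν * W ^ 2)
  -- The gain |z|²/2 from the expansion absorbs the cross term between z and u. The leftover
  -- multiple of |u|² is paid by ν |u|², which is what `hκν` expresses.
  have k5 : 0 ≤ κ * (2⁻¹ * (Z - 2 * ν * q * a * W) ^ 2) := by positivity
  nlinarith

end Dichotomy

/-- Numerical factors up to 100 are absorbed by raising the exponent of b by one. -/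
lemma const_mul_pow_le_pow {b : ℝ} (hb : 100 ≤ b) {k l : ℕ} (h : k + 1 = l) {c : ℝ}
    (hc : c ≤ 100) : c * b ^ k ≤ b ^ l := by
  rw [← h, pow_succ']
  exact mul_le_mul_of_nonneg_right (hc.trans hb) (by positivity)

lemma dotProduct_self_add_le {ι : Type*} [Fintype ι] (u v : ι → ℝ) :
    (u + v) ⬝ᵥ (u + v) ≤ 2 * (u ⬝ᵥ u) + 2 * (v ⬝ᵥ v) := by
  have h := dotProduct_self_nonneg' (u - v)
  simp only [add_dotProduct, dotProduct_add, sub_dotProduct, dotProduct_sub,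
    dotProduct_comm v u] at h ⊢
  linarith

/-! ### Error propagation along nearly optimal filters. -/

namespace KFSystem

variable {n m : ℕ} {S : KFSystem n m} {Sig : Matrix (Fin n) (Fin n) ℝ} {b : ℝ}

namespace BoundedBy

section GainBounds

variable (H : S.BoundedBy Sig b) {P : Matrix (Fin n) (Fin n) ℝ}
include H

lemma norm_innov_inv_le (hP : P.PosDef) : ‖(S.innov P)⁻¹‖ ≤ b := by
  have hb := H.pos
  have := norm_inv_le_of_quad_ge (H.adm.innov_posDef hP).transpose_eq (inv_pos.2 hb) fun y => by
    rw [quad_innov]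
    linarith [H.quad_V_ge y, hP.quad_nonneg (S.Cᵀ *ᵥ y)]
  rwa [inv_inv] at this

lemma quad_innov_le (hPb : ‖P‖ ≤ b ^ 4) (y : Fin m → ℝ) :
    quad (S.innov P) y ≤ b ^ 7 * (y ⬝ᵥ y) := by
  have hb := H.one_le
  have hy := dotProduct_self_nonneg' y
  have h1 := H.quad_le_of_norm_le H.V_le y
  have h2 := quad_le_norm P (S.Cᵀ *ᵥ y)
  have h3 := mulVec_self_le S.Cᵀ y
  rw [l2_opNorm_transpose] at h3
  have h4 : ‖S.C‖ ^ 2 ≤ b ^ 2 := pow_le_pow_left₀ (norm_nonneg _) H.C_le 2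
  have h5 := h3.trans (mul_le_mul_of_nonneg_right h4 hy)
  have h6 := h2.trans (mul_le_mul hPb h5 (dotProduct_self_nonneg' _) (by positivity))
  have h7 : b + b ^ 6 ≤ b ^ 7 := by
    have := const_mul_pow_le_pow H.large (k := 6) (l := 7) rfl (c := 2) (by norm_num)
    have : b ≤ b ^ 6 := le_self_pow₀ hb (by norm_num)
    linarith
  rw [quad_innov]
  nlinarith [mul_le_mul_of_nonneg_right h7 hy]

lemma norm_kalmanGain_le (hP : P.PosDef) (hPb : ‖P‖ ≤ b ^ 4) : ‖S.kalmanGain P‖ ≤ b ^ 7 := by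
  have hb := H.pos
  have h1 := H.norm_innov_inv_le hP
  have h2 : ‖S.A * P‖ ≤ b * b ^ 4 :=
    (l2_opNorm_mul _ _).trans (mul_le_mul H.A_le hPb (norm_nonneg _) hb.le)
  have h3 : ‖S.A * P * S.Cᵀ‖ ≤ b * b ^ 4 * b :=
    (l2_opNorm_mul _ _).trans (mul_le_mul h2 (by rw [l2_opNorm_transpose]; exact H.C_le)
      (norm_nonneg _) (by positivity))
  refine (l2_opNorm_mul _ _).trans ((mul_le_mul h3 h1 (norm_nonneg _) (by positivity)).trans ?_)
  exact le_of_eq (by ring)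

lemma norm_kalmanA_le (hP : P.PosDef) (hPb : ‖P‖ ≤ b ^ 4) : ‖S.kalmanA P‖ ≤ b ^ 9 := by
  have hb := H.one_le
  have h1 : ‖S.kalmanGain P * S.C‖ ≤ b ^ 7 * b := (l2_opNorm_mul _ _).trans
    (mul_le_mul (H.norm_kalmanGain_le hP hPb) H.C_le (norm_nonneg _) (by positivity))
  have h2 := (norm_sub_le S.A (S.kalmanGain P * S.C)).trans (add_le_add H.A_le h1)
  have h3 := const_mul_pow_le_pow H.large (k := 8) (l := 9) rfl (c := 2) (by norm_num)
  have h4 : b ≤ b ^ 8 := le_self_pow₀ hb (by norm_num)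
  have h5 : b ^ 7 * b = b ^ 8 := by ring
  rw [kalmanA]
  linarith

lemma norm_gain_sub_gain_le {P' : Matrix (Fin n) (Fin n) ℝ} (hP : P.PosDef) (hP' : P'.PosDef) :
    ‖S.kalmanGain P - S.kalmanGain P'‖ ≤ ‖S.kalmanA P'‖ * ‖P - P'‖ * ‖S.C‖ * b := by
  rw [gain_sub_gain (H.adm.innov_posDef hP) (H.adm.innov_posDef hP')]
  refine (l2_opNorm_mul _ _).trans ?_
  refine mul_le_mul ?_ (H.norm_innov_inv_le hP) (norm_nonneg _) (by positivity)
  refine (l2_opNorm_mul _ _).trans ?_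
  rw [l2_opNorm_transpose]
  exact mul_le_mul_of_nonneg_right (l2_opNorm_mul _ _) (norm_nonneg _)

end GainBounds

end BoundedBy

variable (S) in
/-- The first component of the optimal filter at time `t`, given the previous filters. -/
def optA (π : ℕ → FilterGain n m) (t : ℕ) : Matrix (Fin n) (Fin n) ℝ :=
  S.kalmanA (S.residual π t) * S.regression π t

variable (S) in
/-- The second component of the optimal filter at time `t`, given the previous filters. -/
def optB (π : ℕ → FilterGain n m) (t : ℕ) : Matrix (Fin n) (Fin m) ℝ :=
  S.kalmanGain (S.residual π t)

variable (S) in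
/-- The invariant that holds as long as all filters are `δ`-close to the optimal ones. -/
structure Tracks (π : ℕ → FilterGain n m) (b δ : ℝ) (Q : Matrix (Fin n) (Fin n) ℝ) (t : ℕ) :
    Prop where
  residual_le : ∀ f, quad (S.residual π t) f ≤ (1 + (b ^ 33 * δ) ^ 2) * quad (S.riccatiSeq t) f
  inv_ge : ∀ y, -((b ^ 29)⁻¹ * quad Q y) ≤ quad (S.regMoment π t)⁻¹ y

namespace Tracks

variable {π : ℕ → FilterGain n m} {δ : ℝ} {Q : Matrix (Fin n) (Fin n) ℝ} {t : ℕ}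

section

variable (T : S.Tracks π b δ Q t) (H : S.BoundedBy Sig b) (hδ0 : 0 ≤ δ) (hδ : b ^ 40 * δ ≤ 1)
include H

include hδ0 hδ in
omit T in
lemma pow_mul_le_one {k : ℕ} (hk : k ≤ 40) : b ^ k * δ ≤ 1 :=
  (mul_le_mul_of_nonneg_right (pow_le_pow_right₀ H.one_le hk) hδ0).trans hδ

include T in
lemma abs_quad_residual_sub_le (f : Fin n → ℝ) :
    quad (S.residual π t) f - quad (S.riccatiSeq t) f ≤ (b ^ 33 * δ) ^ 2 * (b ^ 3 * (f ⬝ᵥ f)) := by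
  have h1 := T.residual_le f
  have h2 := mul_le_mul_of_nonneg_left (H.quad_riccatiSeq_le t f) (sq_nonneg (b ^ 33 * δ))
  linarith

include T in
lemma norm_residual_sub_le :
    ‖S.residual π t - S.riccatiSeq t‖ ≤ (b ^ 33 * δ) ^ 2 * b ^ 3 := by
  have hb := H.pos
  refine l2_opNorm_le_of_quad_nonneg ?_ (by positivity) (fun f => ?_) fun f => ?_
  · rw [transpose_sub, H.adm.residual_transpose, (H.adm.riccatiSeq_posDef t).transpose_eq]
  · rw [quad_sub_mat]
    have h1 := H.adm.quad_residual_ge (π := π) t f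
    have h2 := H.adm.Theta_posDef.quad_nonneg ((S.regression π t - 1)ᵀ *ᵥ f)
    linarith
  · rw [quad_sub_mat]
    linarith [T.abs_quad_residual_sub_le H f]

include T hδ0 hδ in
lemma norm_residual_le : ‖S.residual π t‖ ≤ b ^ 4 := by
  have hb := H.pos
  refine l2_opNorm_le_of_quad_nonneg (H.adm.residual_transpose t) (by positivity)
    (H.adm.residual_posDef t).quad_nonneg fun f => ?_
  have h1 := T.abs_quad_residual_sub_le H f
  have h2 := H.quad_riccatiSeq_le t f
  have h3 : (b ^ 33 * δ) ^ 2 ≤ 1 :=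
    pow_le_one₀ (by positivity) (pow_mul_le_one H hδ0 hδ (by norm_num))
  have hf : 0 ≤ b ^ 3 * (f ⬝ᵥ f) := mul_nonneg (by positivity) (dotProduct_self_nonneg' f)
  have h4 := mul_le_mul_of_nonneg_right h3 hf
  have h5 := mul_le_mul_of_nonneg_right
    (const_mul_pow_le_pow H.large (k := 3) (l := 4) rfl (c := 2) (by norm_num)) (dotProduct_self_nonneg' f)
  linarith

include T hδ0 in
-- The excess of the residual over the exact covariance pays for the uncancelled part of θ₀, and
-- `S.Theta` is at least b⁻¹.
lemma norm_regression_sub_one_le : ‖S.regression π t - 1‖ ≤ b ^ 2 * (b ^ 33 * δ) := by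
  have hb := H.pos
  rw [← l2_opNorm_transpose]
  refine l2_opNorm_le_of_mulVec (by positivity) fun f => ?_
  have h1 := T.abs_quad_residual_sub_le H f
  have h2 := H.adm.quad_residual_ge (π := π) t f
  have h3 := H.quad_Theta_ge ((S.regression π t - 1)ᵀ *ᵥ f)
  have h4 : b⁻¹ * (((S.regression π t - 1)ᵀ *ᵥ f) ⬝ᵥ ((S.regression π t - 1)ᵀ *ᵥ f)) ≤
      (b ^ 33 * δ) ^ 2 * (b ^ 3 * (f ⬝ᵥ f)) := by linarith
  rw [inv_mul_le_iff₀ hb] at h4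
  exact h4.trans (le_of_eq (by ring))

include T hδ0 hδ in
lemma norm_regression_le : ‖S.regression π t‖ ≤ 2 := by
  have h1 := T.norm_regression_sub_one_le H hδ0
  have h2 : b ^ 2 * (b ^ 33 * δ) ≤ 1 := by
    have := pow_mul_le_one H hδ0 hδ (k := 35) (by norm_num)
    linarith
  have h3 : ‖(1 : Matrix (Fin n) (Fin n) ℝ)‖ ≤ 1 :=
    l2_opNorm_le_of_mulVec zero_le_one fun u => by simp
  have h4 := norm_add_le (S.regression π t - 1) 1
  rw [sub_add_cancel] at h4
  linarith

end

section

variable (T : S.Tracks π b δ Q t) (H : S.BoundedBy Sig b) (hδ0 : 0 ≤ δ) (hδ : b ^ 40 * δ ≤ 1)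
  (hA : ‖(π t).1 - S.optA π t‖ ≤ δ) (hB : ‖(π t).2 - S.optB π t‖ ≤ δ)
include T H hδ0 hδ

include hB in
lemma norm_filterB_le : ‖(π t).2‖ ≤ b ^ 8 := by
  have hb := H.one_le
  have h1 := H.norm_kalmanGain_le (H.adm.residual_posDef (π := π) t)
    (T.norm_residual_le H hδ0 hδ)
  have h2 := norm_add_le ((π t).2 - S.optB π t) (S.optB π t)
  rw [sub_add_cancel] at h2
  have h3 : δ ≤ 1 := by simpa using pow_mul_le_one H hδ0 hδ (k := 0) (by norm_num)
  have h4 := const_mul_pow_le_pow H.large (k := 7) (l := 8) rfl (c := 2) (by norm_num)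
  have h5 : 1 ≤ b ^ 7 := one_le_pow₀ hb
  rw [optB] at h2 hB
  linarith

include hA hB in
-- The optimal pair satisfies `optA + optB * C * R = A * R` exactly, so only the δ-errors of the
-- current filter survive.
lemma norm_trans_sub_le : ‖S.trans π t - S.A * S.regression π t‖ ≤ b ^ 2 * δ := by
  have hb := H.one_le
  have e : S.trans π t - S.A * S.regression π t =
      ((π t).1 - S.optA π t) + ((π t).2 - S.optB π t) * S.C * S.regression π t := by
    simp only [trans, optA, optB, kalmanA, Matrix.sub_mul]
    abel
  have h1 : ‖((π t).2 - S.optB π t) * S.C * S.regression π t‖ ≤ δ * b * 2 := by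
    refine (l2_opNorm_mul _ _).trans (mul_le_mul ((l2_opNorm_mul _ _).trans
      (mul_le_mul hB H.C_le (norm_nonneg _) hδ0)) (T.norm_regression_le H hδ0 hδ)
      (norm_nonneg _) (by positivity))
  have h2 : 1 + b * 2 ≤ b ^ 2 := by nlinarith [H.large]
  rw [e]
  refine (norm_add_le _ _).trans ((add_le_add hA h1).trans ?_)
  nlinarith [mul_le_mul_of_nonneg_right h2 hδ0]

include hA hB in
lemma norm_trans_sub_A_le : ‖S.trans π t - S.A‖ ≤ b ^ 37 * δ := by
  have hb := H.one_le
  have e : S.trans π t - S.A = S.A * (S.regression π t - 1) +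
      (S.trans π t - S.A * S.regression π t) := by
    rw [Matrix.mul_sub, Matrix.mul_one]; abel
  have h1 : ‖S.A * (S.regression π t - 1)‖ ≤ b * (b ^ 2 * (b ^ 33 * δ)) :=
    (l2_opNorm_mul _ _).trans (mul_le_mul H.A_le (T.norm_regression_sub_one_le H hδ0)
      (norm_nonneg _) (by positivity))
  have h2 := T.norm_trans_sub_le H hδ0 hδ hA hB
  have h3 := const_mul_pow_le_pow H.large (k := 36) (l := 37) rfl (c := 2) (by norm_num)
  have h4 : b ^ 2 ≤ b ^ 36 := pow_le_pow_right₀ hb (by norm_num)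
  have h5 : b ^ 36 * δ + b ^ 2 * δ ≤ b ^ 37 * δ := by
    rw [← add_mul]; exact mul_le_mul_of_nonneg_right (by linarith) hδ0
  rw [e]
  refine (norm_add_le _ _).trans ((add_le_add h1 h2).trans ?_)
  linarith

include hA hB in
lemma norm_trans_le : ‖S.trans π t‖ ≤ 2 * b := by
  have h1 := T.norm_trans_sub_A_le H hδ0 hδ hA hB
  have h2 := pow_mul_le_one H hδ0 hδ (k := 37) (by norm_num)
  have h3 := norm_add_le (S.trans π t - S.A) S.A
  rw [sub_add_cancel] at h3
  linarith [H.A_le, H.one_le]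

include hA hB in
/-- The Stein inequality is robust. -/
lemma stein_trans {s : ℝ} (hQ : ‖Q‖ ≤ b) (hQA : S.Aᵀ * Q * S.A - s • Q = 1)
    (z : Fin n → ℝ) : s * quad Q z + 2⁻¹ * (z ⬝ᵥ z) ≤ quad Q (S.trans π t *ᵥ z) := by
  have hb := H.one_le
  have hb0 := H.pos
  have hz := dotProduct_self_nonneg' z
  have h1 : quad Q (S.A *ᵥ z) = s * quad Q z + z ⬝ᵥ z := by
    have := congrArg (fun M => quad M z) hQA
    simp only [quad_sub_mat, quad_conj_transpose, quad_smul_mat, quad_one] at this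
    linarith
  set E := S.trans π t - S.A with hE
  have hE' : ‖E‖ ≤ b ^ 37 * δ := T.norm_trans_sub_A_le H hδ0 hδ hA hB
  have e : quad Q (S.trans π t *ᵥ z) - quad Q (S.A *ᵥ z) =
      quad (Eᵀ * Q * S.trans π t + S.Aᵀ * Q * E) z := by
    rw [← quad_conj_transpose, ← quad_conj_transpose, ← quad_sub_mat]
    congr 1
    simp only [hE, transpose_sub, Matrix.sub_mul, Matrix.mul_sub]
    abel
  have h2 : ‖Eᵀ * Q * S.trans π t‖ ≤ b ^ 37 * δ * b * (2 * b) :=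
    (l2_opNorm_mul _ _).trans (mul_le_mul ((l2_opNorm_mul _ _).trans
      (mul_le_mul (by rwa [l2_opNorm_transpose]) hQ (norm_nonneg _) (by positivity)))
      (T.norm_trans_le H hδ0 hδ hA hB) (norm_nonneg _) (by positivity))
  have h3 : ‖S.Aᵀ * Q * E‖ ≤ b * b * (b ^ 37 * δ) :=
    (l2_opNorm_mul _ _).trans (mul_le_mul ((l2_opNorm_mul _ _).trans
      (mul_le_mul (by rw [l2_opNorm_transpose]; exact H.A_le) hQ (norm_nonneg _) (by positivity)))
      hE' (norm_nonneg _) (by positivity))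
  have h4 : ‖Eᵀ * Q * S.trans π t + S.Aᵀ * Q * E‖ ≤ 2⁻¹ := by
    refine (norm_add_le _ _).trans ((add_le_add h2 h3).trans ?_)
    have h5 := mul_le_mul_of_nonneg_right
      (const_mul_pow_le_pow H.large (k := 39) (l := 40) rfl (c := 6) (by norm_num)) hδ0
    have h6 : b ^ 37 * δ * b * (2 * b) + b * b * (b ^ 37 * δ) = 3 * (b ^ 39 * δ) := by ring
    linarith
  have h7 := (abs_le.1 (abs_quad_le (Eᵀ * Q * S.trans π t + S.Aᵀ * Q * E) z)).1
  have h8 := mul_le_mul_of_nonneg_right h4 hz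
  linarith

include hA hB in
-- The excess factor (b³³ δ)² is a steady state: the exact filter shrinks it by 1 − b⁻⁴, and the
-- fresh loss of order δ² refills at most what was lost. Hence the same bound holds at every time,
-- independently of the horizon.
theorem succ {s : ℝ} (hs0 : 0 ≤ s) (hs1 : s ≤ 1) (hQ : ‖Q‖ ≤ b) (hQt : Qᵀ = Q)
    (hQA : S.Aᵀ * Q * S.A - s • Q = 1) : S.Tracks π b δ Q (t + 1) := by
  have hb := H.one_le
  have hb0 := H.pos
  have hres := H.adm.residual_posDef (π := π) t
  have hric := H.adm.riccatiSeq_posDef t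
  have hPb := T.norm_residual_le H hδ0 hδ
  have hst := T.stein_trans H hδ0 hδ hA hB hQ hQA
  have hBn := T.norm_filterB_le H hδ0 hδ hB
  have hκ : 0 < (b ^ 29)⁻¹ := by positivity
  have hBt : ∀ g, ((π t).2ᵀ *ᵥ g) ⬝ᵥ ((π t).2ᵀ *ᵥ g) ≤ b ^ 16 * (g ⬝ᵥ g) := fun g => by
    have h1 := mulVec_self_le (π t).2ᵀ g
    rw [l2_opNorm_transpose] at h1
    have h2 := mul_le_mul_of_nonneg_right
      (pow_le_pow_left₀ (norm_nonneg _) hBn 2) (dotProduct_self_nonneg' g)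
    exact (h1.trans h2).trans (le_of_eq (by ring))
  refine ⟨fun f => ?_, ?_⟩
  · have hf := dotProduct_self_nonneg' f
    -- The correction k is chosen against the one-step filter error γ of size b² δ. Both the
    -- remaining error and k are O(δ) whatever the size of `regMoment`.
    obtain ⟨k, hk⟩ := exists_regression_le (H.adm.regMoment_posDef (π := π) t) H.adm.Theta_posDef
      hs0 hs1 hκ hst T.inv_ge (fun z => by
        have h1 := H.adm.Theta_posDef.quad_inv_ge_of_le hb0 (H.quad_le_of_norm_le H.Theta_le) z
        have h2 := H.quad_le_of_norm_le hQ z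
        have h3 := mul_le_mul_of_nonneg_left h2 hκ.le
        have h4 : (b ^ 29)⁻¹ * (b * (z ⬝ᵥ z)) ≤ b⁻¹ * (z ⬝ᵥ z) := by
          rw [← mul_assoc]
          refine mul_le_mul_of_nonneg_right ?_ (dotProduct_self_nonneg' z)
          rw [inv_mul_le_iff₀ (by positivity), ← div_eq_mul_inv, le_div_iff₀ hb0, ← sq]
          exact pow_le_pow_right₀ hb (by norm_num)
        linarith) ((S.trans π t - S.A * S.regression π t)ᵀ *ᵥ f)
    have h1 := H.adm.quad_residual_succ_le (π := π) t f k
    have hγ : ((S.trans π t - S.A * S.regression π t)ᵀ *ᵥ f) ⬝ᵥ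
        ((S.trans π t - S.A * S.regression π t)ᵀ *ᵥ f) ≤ (b ^ 2 * δ) ^ 2 * (f ⬝ᵥ f) := by
      have h1 := mulVec_self_le (S.trans π t - S.A * S.regression π t)ᵀ f
      rw [l2_opNorm_transpose] at h1
      exact h1.trans (mul_le_mul_of_nonneg_right (pow_le_pow_left₀ (norm_nonneg _)
        (T.norm_trans_sub_le H hδ0 hδ hA hB) 2) hf)
    have hk2 : quad (S.regMoment π t)
        ((S.trans π t - S.A * S.regression π t)ᵀ *ᵥ f + (S.trans π t)ᵀ *ᵥ k) + quad S.Theta k ≤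
        b ^ 34 * δ ^ 2 * (f ⬝ᵥ f) := by
      refine hk.trans ?_
      rw [inv_inv]
      refine (mul_le_mul_of_nonneg_left hγ (by positivity)).trans ?_
      have h2 := const_mul_pow_le_pow H.large (k := 33) (l := 34) rfl (c := 2) (by norm_num)
      have h3 := mul_le_mul_of_nonneg_right h2 (by positivity : 0 ≤ δ ^ 2 * (f ⬝ᵥ f))
      linarith
    have hkk : k ⬝ᵥ k ≤ b ^ 35 * δ ^ 2 * (f ⬝ᵥ f) := by
      have h2 := (H.adm.regMoment_posDef (π := π) t).quad_nonneg
        ((S.trans π t - S.A * S.regression π t)ᵀ *ᵥ f + (S.trans π t)ᵀ *ᵥ k)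
      have h3 : b⁻¹ * (k ⬝ᵥ k) ≤ b ^ 34 * δ ^ 2 * (f ⬝ᵥ f) := by linarith [H.quad_Theta_ge k]
      rw [inv_mul_le_iff₀ hb0] at h3
      exact h3.trans (le_of_eq (by ring))
    have hin : quad (S.innov (S.residual π t))
        ((π t).2ᵀ *ᵥ (f + k) - (S.kalmanGain (S.residual π t))ᵀ *ᵥ f) ≤
        b ^ 59 * δ ^ 2 * (f ⬝ᵥ f) := by
      have e : (π t).2ᵀ *ᵥ (f + k) - (S.kalmanGain (S.residual π t))ᵀ *ᵥ f =
          ((π t).2 - S.optB π t)ᵀ *ᵥ f + (π t).2ᵀ *ᵥ k := by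
        simp only [optB, transpose_sub, sub_mulVec, mulVec_add]; abel
      rw [e]
      have h2 := mulVec_self_le ((π t).2 - S.optB π t)ᵀ f
      rw [l2_opNorm_transpose] at h2
      have h3 := mul_le_mul_of_nonneg_right (pow_le_pow_left₀ (norm_nonneg _) hB 2) hf
      have h4 := (hBt k).trans (mul_le_mul_of_nonneg_left hkk (by positivity))
      have h5 := dotProduct_self_add_le (((π t).2 - S.optB π t)ᵀ *ᵥ f) ((π t).2ᵀ *ᵥ k)
      have h6 : 2 + 2 * b ^ 51 ≤ b ^ 52 := by
        have := const_mul_pow_le_pow H.large (k := 51) (l := 52) rfl (c := 4) (by norm_num)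
        have : 1 ≤ b ^ 51 := one_le_pow₀ hb
        linarith
      have h7 := mul_le_mul_of_nonneg_right h6 (by positivity : 0 ≤ δ ^ 2 * (f ⬝ᵥ f))
      have h8 : (((π t).2 - S.optB π t)ᵀ *ᵥ f + (π t).2ᵀ *ᵥ k) ⬝ᵥ
          (((π t).2 - S.optB π t)ᵀ *ᵥ f + (π t).2ᵀ *ᵥ k) ≤ b ^ 52 * (δ ^ 2 * (f ⬝ᵥ f)) := by
        linarith
      refine (H.quad_innov_le hPb _).trans
        ((mul_le_mul_of_nonneg_left h8 (by positivity)).trans (le_of_eq (by ring)))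
    have hr : quad (S.ric (S.residual π t)) f ≤
        (1 + (b ^ 33 * δ) ^ 2 * (1 - (b ^ 4)⁻¹)) * quad (S.riccatiSeq (t + 1)) f := by
      -- The gain of the exact iterate is used suboptimally for the residual. Thus only the excess,
      -- and not the noise, is propagated, and it contracts.
      have h2 := quad_ric_le (H.adm.innov_posDef hres) hres.transpose_eq f
        ((S.kalmanGain (S.riccatiSeq t))ᵀ *ᵥ f)
      rw [← kalmanA_transpose_mulVec] at h2
      have h3 := quad_ric (H.adm.innov_posDef hric) hric.transpose_eq f
      rw [← riccatiSeq_succ] at h3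
      have h4 := T.residual_le ((S.kalmanA (S.riccatiSeq t))ᵀ *ᵥ f)
      have h5 := mul_le_mul_of_nonneg_left (H.quad_riccatiSeq_contract t f)
        (sq_nonneg (b ^ 33 * δ))
      linarith
    -- This fixes the exponent 33: the contraction frees (b³³δ)² b⁻⁴ times a covariance of at least
    -- b⁻¹, that is b⁶¹ δ², which covers the innovation loss b⁵⁹ δ² and the regression loss b³⁴ δ².
    have hex : (b ^ 59 + b ^ 34) * δ ^ 2 * (f ⬝ᵥ f) ≤
        (b ^ 33 * δ) ^ 2 * (b ^ 4)⁻¹ * quad (S.riccatiSeq (t + 1)) f := by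
      have h2 : b ^ 59 + b ^ 34 ≤ b ^ 60 := by
        have := const_mul_pow_le_pow H.large (k := 59) (l := 60) rfl (c := 2) (by norm_num)
        have : b ^ 34 ≤ b ^ 59 := pow_le_pow_right₀ hb (by norm_num)
        linarith
      have h3 : b ^ 60 ≤ b ^ 61 := pow_le_pow_right₀ hb (by norm_num)
      have h4 := mul_le_mul_of_nonneg_right (h2.trans h3)
        (by positivity : 0 ≤ δ ^ 2 * (f ⬝ᵥ f))
      have h5 := mul_le_mul_of_nonneg_left (H.quad_riccatiSeq_ge (t + 1) f)
        (by positivity : 0 ≤ (b ^ 33 * δ) ^ 2 * (b ^ 4)⁻¹)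
      have h6 : (b ^ 33 * δ) ^ 2 * (b ^ 4)⁻¹ * (b⁻¹ * (f ⬝ᵥ f)) =
          b ^ 61 * (δ ^ 2 * (f ⬝ᵥ f)) := by
        have := hb0.ne'
        field_simp
      linarith
    linarith
  · have hν : 0 < b ^ 24 := by positivity
    -- The noise entering `regMoment` is at most b⁷ · b¹⁶ + b ≤ b²⁴. With ‖Q‖ ≤ b and a transition
    -- norm of at most 2b, the side condition on κ asks for b²⁴ · b⁵ κ ≤ 1, hence κ = b⁻²⁹.
    refine neg_quad_le_quad_inv (ν := b ^ 24) (H.adm.regMoment_posDef (π := π) t)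
      (H.adm.regMoment_posDef (π := π) (t + 1)) hs0 hs1 hκ hν hQt hQ
      (T.norm_trans_le H hδ0 hδ hA hB) ?_ hst T.inv_ge fun g => ?_
    · rw [mul_assoc, inv_mul_le_iff₀ (by positivity), mul_one]
      have h1 : 2 * b ^ 2 * (2 * b) ^ 2 + b ≤ b ^ 5 := by
        have := const_mul_pow_le_pow H.large (k := 4) (l := 5) rfl (c := 9) (by norm_num)
        have : b ≤ b ^ 4 := le_self_pow₀ hb (by norm_num)
        linarith
      refine (mul_le_mul_of_nonneg_left h1 hν.le).trans (le_of_eq (by ring))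
    · have h1 := H.adm.quad_regMoment_succ_le (π := π) t g
      have h2 := (H.quad_innov_le hPb ((π t).2ᵀ *ᵥ g)).trans
        (mul_le_mul_of_nonneg_left (hBt g) (by positivity))
      have h3 := H.quad_le_of_norm_le H.Theta_le g
      have h4 : b ^ 7 * b ^ 16 + b ≤ b ^ 24 := by
        have := const_mul_pow_le_pow H.large (k := 23) (l := 24) rfl (c := 2) (by norm_num)
        have : b ≤ b ^ 23 := le_self_pow₀ hb (by norm_num)
        linarith
      have h5 := mul_le_mul_of_nonneg_right h4 (dotProduct_self_nonneg' g)
      linarith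

end

end Tracks

lemma BoundedBy.tracks_zero (H : S.BoundedBy Sig b) (π : ℕ → FilterGain n m) (δ : ℝ)
    {Q : Matrix (Fin n) (Fin n) ℝ} (hQ : ‖Q‖ ≤ b) : S.Tracks π b δ Q 0 := by
  have hb := H.one_le
  have hb0 := H.pos
  refine ⟨fun f => ?_, fun y => ?_⟩
  · rw [H.adm.residual_zero, riccatiSeq]
    have := mul_nonneg (sq_nonneg (b ^ 33 * δ)) (H.adm.X0_posDef.quad_nonneg f)
    linarith
  · have hM : ∀ u, quad (S.regMoment π 0) u ≤ b ^ 3 * (u ⬝ᵥ u) := fun u => by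
      have hu := dotProduct_self_nonneg' u
      have h1 := H.quad_le_of_norm_le H.Theta_le u
      have h2 := dotProduct_sq_le u S.xbar0.ofLp
      have h3 : S.xbar0.ofLp ⬝ᵥ S.xbar0.ofLp ≤ b ^ 2 := by
        rw [dotProduct_self_eq_norm_sq]
        exact pow_le_pow_left₀ (norm_nonneg _) H.xbar0_le 2
      have h4 := h2.trans (mul_le_mul_of_nonneg_left h3 hu)
      have h5 : b ^ 2 + b ≤ b ^ 3 := by
        have := const_mul_pow_le_pow H.large (k := 2) (l := 3) rfl (c := 2) (by norm_num)
        have : b ≤ b ^ 2 := le_self_pow₀ hb (by norm_num)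
        linarith
      have h6 := mul_le_mul_of_nonneg_right h5 hu
      rw [regMoment, quad_add_mat, estMoment, quad_meanMoment]
      linarith
    have h1 := (H.adm.regMoment_posDef (π := π) 0).quad_inv_ge_of_le (by positivity) hM y
    have h2 := (abs_le.1 (abs_quad_le Q y)).1
    have hy := dotProduct_self_nonneg' y
    have h3 := mul_le_mul_of_nonneg_right hQ hy
    have h4 : (b ^ 29)⁻¹ * (-quad Q y) ≤ (b ^ 29)⁻¹ * (b * (y ⬝ᵥ y)) :=
      mul_le_mul_of_nonneg_left (by linarith) (by positivity)
    have h5 : (b ^ 29)⁻¹ * (b * (y ⬝ᵥ y)) ≤ (b ^ 3)⁻¹ * (y ⬝ᵥ y) := by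
      rw [← mul_assoc]
      refine mul_le_mul_of_nonneg_right ?_ hy
      rw [inv_mul_le_iff₀ (by positivity), ← div_eq_mul_inv, le_div_iff₀ (by positivity),
        ← pow_succ']
      exact pow_le_pow_right₀ hb (by norm_num)
    linarith

end KFSystem

/-! ### Induced norms, spectral radius and the horizon threshold. -/

section InducedNorm

variable {n : ℕ} {P : Matrix (Fin n) (Fin n) ℝ}

lemma inducedNorm_nonneg (P X : Matrix (Fin n) (Fin n) ℝ) : 0 ≤ inducedNorm P X :=
  Real.sqrt_nonneg _

lemma quad_mulVec_le_inducedNorm (hP : P.PosDef) (X : Matrix (Fin n) (Fin n) ℝ)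
    (z : Fin n → ℝ) : quad P (X *ᵥ z) ≤ inducedNorm P X ^ 2 * quad P z := by
  by_cases hz : z = 0
  · simp [hz, quad_zero_vec]
  have hge : ∀ u : Fin n → ℝ, (‖P⁻¹‖ + 1)⁻¹ * (u ⬝ᵥ u) ≤ quad P u :=
    quad_ge_of_norm_inv_le hP (by positivity) (by linarith)
  have hbdd : BddAbove (Set.range fun z : {z : Fin n → ℝ // z ≠ 0} =>
      (z.1 ⬝ᵥ (Xᵀ * P * X) *ᵥ z.1) / (z.1 ⬝ᵥ P *ᵥ z.1)) := by
    refine ⟨‖Xᵀ * P * X‖ * (‖P⁻¹‖ + 1), ?_⟩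
    rintro _ ⟨⟨u, hu⟩, rfl⟩
    have h1 : 0 < quad P u := hP.quad_pos hu
    have h2 := quad_le_norm (Xᵀ * P * X) u
    have h3 := hge u
    rw [inv_mul_le_iff₀ (by positivity)] at h3
    change quad (Xᵀ * P * X) u / quad P u ≤ _
    rw [div_le_iff₀ h1, mul_assoc ‖Xᵀ * P * X‖]
    exact h2.trans (mul_le_mul_of_nonneg_left h3 (norm_nonneg _))
  have h1 : 0 < quad P z := hP.quad_pos hz
  have h2 := le_ciSup hbdd ⟨z, hz⟩
  have h3 : quad P (X *ᵥ z) / quad P z ≤ ⨆ z : {z : Fin n → ℝ // z ≠ 0},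
      (z.1 ⬝ᵥ (Xᵀ * P * X) *ᵥ z.1) / (z.1 ⬝ᵥ P *ᵥ z.1) := by
    rw [← quad_conj_transpose]; exact h2
  have h4 := (div_nonneg (hP.quad_nonneg (X *ᵥ z)) h1.le).trans h3
  rw [inducedNorm, Real.sq_sqrt h4, ← div_le_iff₀ h1]
  exact h3

lemma inducedNorm_le_sqrt (hP : P.PosDef) {X : Matrix (Fin n) (Fin n) ℝ} {c : ℝ} (hc : 0 ≤ c)
    (h : ∀ z, quad P (X *ᵥ z) ≤ c * quad P z) : inducedNorm P X ≤ √c := by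
  refine Real.sqrt_le_sqrt (Real.iSup_le (fun z => ?_) hc)
  change quad (Xᵀ * P * X) z.1 / quad P z.1 ≤ c
  rw [div_le_iff₀ (hP.quad_pos z.2), quad_conj_transpose]
  exact h z.1

lemma quad_pow_mulVec_le (hP : P.PosDef) (X : Matrix (Fin n) (Fin n) ℝ) (k : ℕ)
    (z : Fin n → ℝ) : quad P (X ^ k *ᵥ z) ≤ (inducedNorm P X ^ k) ^ 2 * quad P z := by
  induction k with
  | zero => simp
  | succ k ih =>
    rw [pow_succ', ← mulVec_mulVec]
    have h1 := quad_mulVec_le_inducedNorm hP X (X ^ k *ᵥ z)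
    have h2 := mul_le_mul_of_nonneg_left ih (sq_nonneg (inducedNorm P X))
    rw [pow_succ' (inducedNorm P X)]
    linarith

lemma norm_le_of_quad_mulVec_le {b c : ℝ} (hb : 0 < b) (hc : 0 ≤ c)
    (hP : ∀ u : Fin n → ℝ, b⁻¹ * (u ⬝ᵥ u) ≤ quad P u) (hPb : ‖P‖ ≤ b)
    {X : Matrix (Fin n) (Fin n) ℝ} (h : ∀ z, quad P (X *ᵥ z) ≤ c ^ 2 * quad P z) :
    ‖X‖ ≤ b * c := by
  refine l2_opNorm_le_of_mulVec (by positivity) fun u => ?_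
  have h1 := hP (X *ᵥ u)
  have h2 := (quad_le_norm P u).trans
    (mul_le_mul_of_nonneg_right hPb (dotProduct_self_nonneg' u))
  have h3 := h1.trans ((h u).trans (mul_le_mul_of_nonneg_left h2 (sq_nonneg c)))
  rw [inv_mul_le_iff₀ hb] at h3
  exact h3.trans (le_of_eq (by ring))

/-- The triangle inequality for the norm of P in squared form, with q a common scale. The degenerate
factors are treated apart because the main case divides by α β. -/
lemma quad_add_le (hP : P.PosDef) {u v : Fin n → ℝ} {α β q : ℝ} (hα : 0 ≤ α) (hβ : 0 ≤ β)
    (hu : quad P u ≤ α ^ 2 * q) (hv : quad P v ≤ β ^ 2 * q) :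
    quad P (u + v) ≤ (α + β) ^ 2 * q := by
  have ht := hP.transpose_eq
  rw [quad_add_vec ht]
  suffices h : u ⬝ᵥ P *ᵥ v ≤ α * β * q by nlinarith
  rcases hα.eq_or_lt with rfl | hα'
  · have hu0 : u = 0 := by
      by_contra h; have := hP.quad_pos h; linarith
    simp [hu0]
  rcases hβ.eq_or_lt with rfl | hβ'
  · have hv0 : v = 0 := by
      by_contra h; have := hP.quad_pos h; linarith
    simp [hv0]
  have h1 := hP.quad_nonneg (β • u - α • v)
  rw [quad_sub_vec ht, quad_smul_vec, quad_smul_vec, mulVec_smul, dotProduct_smul, smul_dotProduct,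
    smul_eq_mul, smul_eq_mul] at h1
  have h2 := mul_le_mul_of_nonneg_left hu (sq_nonneg β)
  have h3 := mul_le_mul_of_nonneg_left hv (sq_nonneg α)
  have h4 : α * β * (u ⬝ᵥ P *ᵥ v) ≤ α * β * (α * β * q) := by nlinarith
  exact le_of_mul_le_mul_left h4 (by positivity)

/-- A real matrix that contracts a quadratic form has small complex spectral radius. -/
lemma spectralRadius_lt_one_of_quad (hP : P.PosDef) {X : Matrix (Fin n) (Fin n) ℝ} {ρ : ℝ}
    (hρ0 : 0 ≤ ρ) (hρ : ρ < 1) (h : ∀ z, quad P (X *ᵥ z) ≤ ρ ^ 2 * quad P z) :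
    spectralRadius ℂ (X.map (algebraMap ℝ ℂ)) < 1 := by
  have key : ∀ l ∈ spectrum ℂ (X.map (algebraMap ℝ ℂ)), ‖l‖ ≤ ρ := by
    intro l hl
    have hdet : (algebraMap ℂ (Matrix (Fin n) (Fin n) ℂ) l - X.map (algebraMap ℝ ℂ)).det = 0 := by
      by_contra h0
      exact hl ((Matrix.isUnit_iff_isUnit_det _).2 (isUnit_iff_ne_zero.2 h0))
    obtain ⟨v, hv0, hv⟩ := Matrix.exists_mulVec_eq_zero_iff.2 hdet
    have hv' : X.map (algebraMap ℝ ℂ) *ᵥ v = l • v := by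
      rw [sub_mulVec, sub_eq_zero] at hv
      rw [← hv, Algebra.algebraMap_eq_smul_one, smul_mulVec, one_mulVec]
    set x : Fin n → ℝ := fun i => (v i).re with hx
    set y : Fin n → ℝ := fun i => (v i).im with hy
    have e1 : X *ᵥ x = l.re • x - l.im • y := by
      ext i
      have := congrArg Complex.re (congrFun hv' i)
      simpa [mulVec, dotProduct, hx, hy] using this
    have e2 : X *ᵥ y = l.re • y + l.im • x := by
      ext i
      have := congrArg Complex.im (congrFun hv' i)
      simpa [mulVec, dotProduct, hx, hy] using this
    have ht := hP.transpose_eq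
    have h1 := h x
    have h2 := h y
    -- On the real and imaginary parts of an eigenvector, X acts as a rotation scaled by |l|. The
    -- cross terms cancel in the sum of the two forms.
    have h3 : quad P (X *ᵥ x) + quad P (X *ᵥ y) =
        (l.re ^ 2 + l.im ^ 2) * (quad P x + quad P y) := by
      rw [e1, e2, quad_sub_vec ht, quad_add_vec ht]
      simp only [quad_smul_vec, mulVec_smul, dotProduct_smul, smul_dotProduct, smul_eq_mul]
      rw [dotProduct_mulVec_symm ht y x]
      ring
    have hpos : 0 < quad P x + quad P y := by
      by_cases hx0 : x = 0
      · have hy0 : y ≠ 0 := fun hy0 => hv0 (by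
          ext i
          exact Complex.ext (congrFun hx0 i) (congrFun hy0 i))
        exact add_pos_of_nonneg_of_pos (hP.quad_nonneg x) (hP.quad_pos hy0)
      · exact add_pos_of_pos_of_nonneg (hP.quad_pos hx0) (hP.quad_nonneg y)
    have h4 : l.re ^ 2 + l.im ^ 2 ≤ ρ ^ 2 := by
      refine le_of_mul_le_mul_right ?_ hpos
      rw [← h3]; linarith
    have h5 : ‖l‖ ^ 2 = l.re ^ 2 + l.im ^ 2 := by
      rw [← Complex.normSq_eq_norm_sq, Complex.normSq_apply]; ring
    rw [← h5] at h4
    exact (pow_le_pow_iff_left₀ (norm_nonneg _) hρ0 two_ne_zero).1 h4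
  refine lt_of_le_of_lt (b := ENNReal.ofReal ρ) (iSup₂_le fun l hl => ?_) ?_
  · rw [← enorm_eq_nnnorm, ← ofReal_norm]
    exact ENNReal.ofReal_le_ofReal (key l hl)
  · rwa [ENNReal.ofReal_lt_one]

lemma spectralRadius_map_transpose (X : Matrix (Fin n) (Fin n) ℝ) :
    spectralRadius ℂ (Xᵀ.map (algebraMap ℝ ℂ)) = spectralRadius ℂ (X.map (algebraMap ℝ ℂ)) := by
  have : spectrum ℂ (Xᵀ.map (algebraMap ℝ ℂ)) = spectrum ℂ (X.map (algebraMap ℝ ℂ)) := by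
    ext l
    rw [spectrum.mem_iff, spectrum.mem_iff, Matrix.isUnit_iff_isUnit_det,
      Matrix.isUnit_iff_isUnit_det, ← det_transpose, transpose_sub]
    simp [Algebra.algebraMap_eq_smul_one, ← transpose_map]
  rw [spectralRadius, spectralRadius, this]

lemma lamMin_pos_le {m : ℕ} [Nonempty (Fin m)] {V : Matrix (Fin m) (Fin m) ℝ} (hV : V.PosDef) :
    0 < lamMin V ∧ lamMin V ≤ ‖V‖ := by
  have h1 : lamMin V ∈ spectrum ℝ V := by
    rw [lamMin, hV.isHermitian.spectrum_real_eq_range_eigenvalues]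
    exact (Set.range_nonempty _).csInf_mem (Set.finite_range _)
  constructor
  · rw [hV.isHermitian.spectrum_real_eq_range_eigenvalues] at h1
    obtain ⟨i, hi⟩ := h1
    rw [← hi]
    exact hV.eigenvalues_pos i
  · have h2 := spectrum.norm_le_norm_mul_of_mem h1
    have h3 : ‖(1 : Matrix (Fin m) (Fin m) ℝ)‖ ≤ 1 :=
      l2_opNorm_le_of_mulVec zero_le_one fun u => by simp
    have h4 := mul_le_mul_of_nonneg_left h3 (norm_nonneg V)
    exact (le_abs_self _).trans (h2.trans (by linarith))

end InducedNorm

/-- The horizon threshold guarantees that the geometric transient is small. -/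
lemma pow_mul_le_of_log_le {r X : ℝ} {N : ℕ} (hr0 : 0 < r) (hr : r < 1) (hX : 0 < X)
    (hN : 1 ≤ N) (h : 1 / 2 * (Real.log X / Real.log (1 / r)) + 1 ≤ N) :
    (r ^ (N - 1)) ^ 2 * X ≤ 1 := by
  have hl : 0 < Real.log (1 / r) := Real.log_pos (by rw [lt_div_iff₀ hr0]; linarith)
  have h1 : Real.log X / Real.log (1 / r) ≤ 2 * (N - 1 : ℝ) := by linarith
  rw [div_le_iff₀ hl, one_div, Real.log_inv] at h1
  rw [← Real.log_nonpos_iff (by positivity), Real.log_mul (by positivity) hX.ne', Real.log_pow,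
    Real.log_pow, Nat.cast_sub hN]
  push_cast
  linarith

/-! ### Comparison with the stationary filter at long horizons. -/

namespace KFSystem

variable {n m : ℕ} {S : KFSystem n m} {Sig : Matrix (Fin n) (Fin n) ℝ} {b : ℝ}

namespace BoundedBy

variable (H : S.BoundedBy Sig b)
include H

lemma inducedNorm_kalmanA_transpose_lt : inducedNorm Sig (S.kalmanA Sig)ᵀ < 1 := by
  have hb := H.one_le
  have hb2 : (b ^ 2)⁻¹ ≤ 1 := inv_le_one_of_one_le₀ (one_le_pow₀ hb)
  have hb3 : 0 < (b ^ 2)⁻¹ := by have := H.pos; positivity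
  refine (inducedNorm_le_sqrt H.sol.1 (by linarith) H.quad_Sig_contract).trans_lt ?_
  rw [Real.sqrt_lt' one_pos]
  linarith

lemma norm_le_mul_of_quad_Sig {c : ℝ} (hc : 0 ≤ c) {X : Matrix (Fin n) (Fin n) ℝ}
    (h : ∀ z, quad Sig (X *ᵥ z) ≤ c ^ 2 * quad Sig z) : ‖X‖ ≤ b * c :=
  norm_le_of_quad_mulVec_le H.pos hc H.quad_Sig_ge H.Sig_le h

lemma norm_kalmanA_pow_le {r : ℝ} (hr : r = inducedNorm Sig (S.kalmanA Sig) ∨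
    r = inducedNorm Sig (S.kalmanA Sig)ᵀ) (k : ℕ) : ‖S.kalmanA Sig ^ k‖ ≤ b * r ^ k := by
  rcases hr with rfl | rfl
  · exact H.norm_le_mul_of_quad_Sig (pow_nonneg (inducedNorm_nonneg _ _) k)
      (quad_pow_mulVec_le H.sol.1 _ k)
  · rw [← l2_opNorm_transpose, transpose_pow]
    exact H.norm_le_mul_of_quad_Sig (pow_nonneg (inducedNorm_nonneg _ _) k)
      (quad_pow_mulVec_le H.sol.1 _ k)

lemma nonempty_fin : Nonempty (Fin n) := by
  by_contra h
  rw [not_nonempty_iff] at h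
  exact H.adm.xbar0_ne (Subsingleton.elim _ _)

lemma one_le_condNumber : 1 ≤ condNumber Sig := by
  have := H.nonempty_fin
  have h1 : ‖(1 : Matrix (Fin n) (Fin n) ℝ)‖ = 1 := CStarRing.norm_one
  rw [condNumber, ← h1, ← H.sol.1.mul_inv]
  exact l2_opNorm_mul _ _

/-- The meaning of the horizon threshold. -/
lemma transient_le {r : ℝ} (hr : r = inducedNorm Sig (S.kalmanA Sig) ∨
    r = inducedNorm Sig (S.kalmanA Sig)ᵀ) (hr1 : r < 1) {d : ℝ} (hd : 0 < d) {N : ℕ}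
    (hN : 1 ≤ N) (h : S.horizonBound Sig r d ≤ N) :
    inducedNorm Sig (S.X0 - Sig) * ‖S.kalmanA Sig‖ * ‖S.C‖ * (r ^ (N - 1)) ^ 2 ≤ b * d := by
  have hb := H.pos
  have hr0 : 0 ≤ r := by rcases hr with rfl | rfl <;> exact inducedNorm_nonneg _ _
  have hD := inducedNorm_nonneg Sig (S.X0 - Sig)
  -- When one of these factors vanishes the left side is zero, so no information from the logarithm
  -- is needed.
  rcases hD.eq_or_lt with h0 | hD'
  · rw [← h0]; simp; positivity
  rcases (norm_nonneg (S.kalmanA Sig)).eq_or_lt with h0 | hA'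
  · rw [← h0]; simp; positivity
  rcases (norm_nonneg S.C).eq_or_lt with h0 | hC'
  · rw [← h0]; simp; positivity
  have hr' : 0 < r := by
    refine lt_of_le_of_ne hr0 fun h0 => ?_
    have := H.norm_kalmanA_pow_le hr 1
    rw [← h0] at this
    simp at this
    rw [this, norm_zero] at hA'
    exact lt_irrefl _ hA'
  have hm : Nonempty (Fin m) := by
    by_contra hm
    rw [not_nonempty_iff] at hm
    have : S.C = 0 := Subsingleton.elim _ _
    rw [this, norm_zero] at hC'
    exact lt_irrefl _ hC'
  obtain ⟨hl0, hl1⟩ := lamMin_pos_le H.adm.V_posDef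
  have hk := H.one_le_condNumber
  have hk0 : 0 < condNumber Sig := by linarith
  have h1 := pow_mul_le_of_log_le hr' hr1 (by positivity) hN h
  rw [mul_div_assoc', div_le_one (by positivity)] at h1
  have h2 : 0 ≤ inducedNorm Sig (S.X0 - Sig) * ‖S.kalmanA Sig‖ * ‖S.C‖ * (r ^ (N - 1)) ^ 2 := by
    positivity
  -- The threshold carries λ_min(V) ≤ b in its denominator and a condition number of at least 1 in
  -- its numerator; the latter is simply dropped.
  have h3 := mul_le_mul_of_nonneg_left (hl1.trans H.V_le) hd.le
  have h4 := le_mul_of_one_le_left h2 hk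
  linarith

/-- The gain of the exact filter is close to the stationary gain once the horizon is long. -/
lemma norm_riccatiSeq_gain_sub_le {r : ℝ} (hr : r = inducedNorm Sig (S.kalmanA Sig) ∨
    r = inducedNorm Sig (S.kalmanA Sig)ᵀ) (hr1 : r < 1) {d : ℝ} (hd : 0 < d) {N : ℕ}
    (hN : 1 ≤ N) (h : S.horizonBound Sig r d ≤ N) :
    ‖S.kalmanGain (S.riccatiSeq (N - 1)) - S.kalmanGain Sig‖ ≤ b ^ 7 * d := by
  have hb := H.pos
  have hr0 : 0 ≤ r := by rcases hr with rfl | rfl <;> exact inducedNorm_nonneg _ _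
  have h1 := H.norm_gain_sub_gain_le (H.adm.riccatiSeq_posDef (N - 1)) H.sol.1
  have h2 := H.norm_riccatiSeq_sub_le (N - 1)
  have h3 := pow_le_pow_left₀ (norm_nonneg _) (H.norm_kalmanA_pow_le hr (N - 1)) 2
  have h4 := H.norm_le_mul_of_quad_Sig (inducedNorm_nonneg _ _)
    (quad_mulVec_le_inducedNorm H.sol.1 (S.X0 - Sig))
  have h5 := H.transient_le hr hr1 hd hN h
  have h6 : ‖S.riccatiSeq (N - 1) - Sig‖ ≤
      b ^ 2 * (b * inducedNorm Sig (S.X0 - Sig)) * (b * r ^ (N - 1)) ^ 2 :=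
    h2.trans (mul_le_mul (mul_le_mul_of_nonneg_left h4 (by positivity)) h3 (by positivity)
      (mul_nonneg (by positivity) (mul_nonneg hb.le (inducedNorm_nonneg _ _))))
  have h7 := mul_le_mul_of_nonneg_left h6 (norm_nonneg (S.kalmanA Sig))
  have h8 := mul_le_mul_of_nonneg_right (mul_le_mul_of_nonneg_right h7 (norm_nonneg S.C)) hb.le
  have h9 := mul_le_mul_of_nonneg_left h5 (by positivity : 0 ≤ b ^ 6)
  linarith

/-- Filters that are close to the optimal filters given the previous ones are, once the horizon is
long, close to the stationary filter. -/
theorem norm_filter_sub_le {Q : Matrix (Fin n) (Fin n) ℝ} {s : ℝ} (hs0 : 0 ≤ s) (hs1 : s ≤ 1)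
    (hQ : ‖Q‖ ≤ b) (hQt : Qᵀ = Q) (hQA : S.Aᵀ * Q * S.A - s • Q = 1) {r : ℝ}
    (hr : r = inducedNorm Sig (S.kalmanA Sig) ∨ r = inducedNorm Sig (S.kalmanA Sig)ᵀ)
    (hr1 : r < 1) {ε : ℝ} (hε : 0 < ε) {N : ℕ} (hN : 1 ≤ N)
    (h : S.horizonBound Sig r (ε / b ^ 85) ≤ N) {π : ℕ → FilterGain n m}
    (hπ : ∀ t < N, ‖(π t).1 - S.optA π t‖ ≤ min ε 1 / b ^ 85 ∧
      ‖(π t).2 - S.optB π t‖ ≤ min ε 1 / b ^ 85) :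
    ‖(π (N - 1)).1 - S.kalmanA Sig‖ ≤ ε / b ^ 2 ∧
      ‖(π (N - 1)).2 - S.kalmanGain Sig‖ ≤ ε / b ^ 2 := by
  have hb := H.one_le
  have hb0 := H.pos
  set δ := min ε 1 / b ^ 85 with hδdef
  set d := ε / b ^ 85 with hd
  have hd0 : 0 < d := by positivity
  have hδ0 : 0 ≤ δ := div_nonneg (le_min hε.le zero_le_one) (by positivity)
  have hδd : δ ≤ d := div_le_div_of_nonneg_right (min_le_left _ _) (by positivity)
  have hδ85 : b ^ 85 * δ ≤ 1 := by
    rw [hδdef, mul_div_cancel₀ _ (by positivity)]; exact min_le_right _ _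
  have hδ : b ^ 40 * δ ≤ 1 :=
    (mul_le_mul_of_nonneg_right (pow_le_pow_right₀ hb (by norm_num)) hδ0).trans hδ85
  have htr : ∀ t < N, S.Tracks π b δ Q t := by
    intro t ht
    induction t with
    | zero => exact H.tracks_zero π δ hQ
    | succ t ih =>
      have ht' : t < N := by omega
      exact (ih ht').succ H hδ0 hδ (hπ t ht').1 (hπ t ht').2 hs0 hs1 hQ hQt hQA
  have hlt : N - 1 < N := by omega
  have T := htr (N - 1) hlt
  obtain ⟨hA, hB⟩ := hπ (N - 1) hlt
  have hgain := H.norm_riccatiSeq_gain_sub_le hr hr1 hd0 hN h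
  set t := N - 1 with ht
  have hP := H.adm.residual_posDef (π := π) t
  have hR := H.adm.riccatiSeq_posDef t
  have hRb : ‖S.riccatiSeq t‖ ≤ b ^ 4 :=
    l2_opNorm_le_of_quad_nonneg hR.transpose_eq (by positivity) hR.quad_nonneg fun u =>
      (H.quad_riccatiSeq_le t u).trans (mul_le_mul_of_nonneg_right
        (pow_le_pow_right₀ hb (by norm_num)) (dotProduct_self_nonneg' u))
  have hPb := T.norm_residual_le H hδ0 hδ
  -- The residual error is quadratic in δ, so b⁸⁰ δ² ≤ δ. This is the most demanding requirement on
  -- the exponent 85.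
  have h1 : ‖S.optB π t - S.kalmanGain (S.riccatiSeq t)‖ ≤ δ := by
    refine (H.norm_gain_sub_gain_le hP hR).trans ?_
    have h2 : ‖S.kalmanA (S.riccatiSeq t)‖ * ‖S.residual π t - S.riccatiSeq t‖ * ‖S.C‖ * b ≤
        b ^ 9 * ((b ^ 33 * δ) ^ 2 * b ^ 3) * b * b := by
      have := H.norm_kalmanA_le hR hRb
      have := T.norm_residual_sub_le H
      have := H.C_le
      gcongr
    have h3 : b ^ 80 * δ ≤ 1 :=
      (mul_le_mul_of_nonneg_right (pow_le_pow_right₀ hb (by norm_num)) hδ0).trans hδ85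
    have h4 := mul_le_mul_of_nonneg_right h3 hδ0
    refine h2.trans (le_trans (le_of_eq (by ring)) (h4.trans (le_of_eq (one_mul δ))))
  have h2 : ‖S.optB π t - S.kalmanGain Sig‖ ≤ b ^ 8 * d := by
    have e : S.optB π t - S.kalmanGain Sig = (S.optB π t - S.kalmanGain (S.riccatiSeq t)) +
        (S.kalmanGain (S.riccatiSeq t) - S.kalmanGain Sig) := by abel
    have h3 := norm_add_le (S.optB π t - S.kalmanGain (S.riccatiSeq t))
      (S.kalmanGain (S.riccatiSeq t) - S.kalmanGain Sig)
    rw [← e] at h3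
    have h4 : 1 + b ^ 7 ≤ b ^ 8 := by
      have := const_mul_pow_le_pow H.large (k := 7) (l := 8) rfl (c := 2) (by norm_num)
      have : 1 ≤ b ^ 7 := one_le_pow₀ hb
      linarith
    have h5 := mul_le_mul_of_nonneg_right h4 hd0.le
    linarith
  have hfin : b ^ 83 * d = ε / b ^ 2 := by
    rw [hd]; field_simp
  have h9 : ‖(π t).2 - S.kalmanGain Sig‖ ≤ b ^ 9 * d := by
    have h3 := norm_add_le ((π t).2 - S.optB π t) (S.optB π t - S.kalmanGain Sig)
    rw [sub_add_sub_cancel] at h3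
    have h4 : 1 + b ^ 8 ≤ b ^ 9 := by
      have := const_mul_pow_le_pow H.large (k := 8) (l := 9) rfl (c := 2) (by norm_num)
      have : 1 ≤ b ^ 8 := one_le_pow₀ hb
      linarith
    have h5 := mul_le_mul_of_nonneg_right h4 hd0.le
    linarith
  have h45 : ‖(π t).1 - S.kalmanA Sig‖ ≤ b ^ 45 * d := by
    -- Three sources of error: the computed filter, the regression differing from 1, and the gain
    -- differing from the stationary one.
    have e : (π t).1 - S.kalmanA Sig = ((π t).1 - S.optA π t) +
        (S.kalmanA (S.residual π t) * (S.regression π t - 1)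
          - (S.optB π t - S.kalmanGain Sig) * S.C) := by
      simp only [optA, optB, kalmanA, Matrix.mul_sub, Matrix.sub_mul, Matrix.mul_one]
      abel
    have h3 : ‖S.kalmanA (S.residual π t) * (S.regression π t - 1)‖ ≤
        b ^ 9 * (b ^ 2 * (b ^ 33 * δ)) := (l2_opNorm_mul _ _).trans
      (mul_le_mul (H.norm_kalmanA_le hP hPb) (T.norm_regression_sub_one_le H hδ0) (norm_nonneg _)
        (by positivity))
    have h4 : ‖(S.optB π t - S.kalmanGain Sig) * S.C‖ ≤ b ^ 8 * d * b :=
      (l2_opNorm_mul _ _).trans (mul_le_mul h2 H.C_le (norm_nonneg _) (by positivity))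
    have h5 : 1 + b ^ 44 + b ^ 9 ≤ b ^ 45 := by
      have := const_mul_pow_le_pow H.large (k := 44) (l := 45) rfl (c := 3) (by norm_num)
      have : 1 ≤ b ^ 44 := one_le_pow₀ hb
      have : b ^ 9 ≤ b ^ 44 := pow_le_pow_right₀ hb (by norm_num)
      linarith
    have h6 := mul_le_mul_of_nonneg_right h5 hd0.le
    have h7 := mul_le_mul_of_nonneg_left hδd (by positivity : 0 ≤ b ^ 44)
    rw [e]
    refine (norm_add_le _ _).trans ((add_le_add hA ((norm_sub_le _ _).trans
      (add_le_add h3 h4))).trans ?_)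
    linarith
  rw [← hfin]
  exact ⟨h45.trans (mul_le_mul_of_nonneg_right (pow_le_pow_right₀ hb (by norm_num)) hd0.le),
    h9.trans (mul_le_mul_of_nonneg_right (pow_le_pow_right₀ hb (by norm_num)) hd0.le)⟩

lemma quad_Sig_mulVec_le (X : Matrix (Fin n) (Fin n) ℝ) (z : Fin n → ℝ) :
    quad Sig (X *ᵥ z) ≤ (b * ‖X‖) ^ 2 * quad Sig z := by
  have hb := H.pos
  have h1 := H.quad_le_of_norm_le H.Sig_le (X *ᵥ z)
  have h2 := mul_le_mul_of_nonneg_left (mulVec_self_le X z) hb.le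
  have h3 := H.quad_Sig_ge z
  rw [inv_mul_le_iff₀ hb] at h3
  have h4 := mul_le_mul_of_nonneg_left h3 (by positivity : 0 ≤ b * ‖X‖ ^ 2)
  linarith

/-- The Σ*-induced norm of the deviation is at most b times its spectral norm, hence at most ε, so
the induced norm of the filter is at most r + ε < 1. In the transposed case the argument is run on
transposes, which have the same spectrum. -/
lemma spectralRadius_lt_one {r : ℝ}
    (hr : r = inducedNorm Sig (S.kalmanA Sig) ∨ r = inducedNorm Sig (S.kalmanA Sig)ᵀ)
    {ε : ℝ} (hεr : ε < 1 - r) {X : Matrix (Fin n) (Fin n) ℝ}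
    (hX : ‖X - S.kalmanA Sig‖ ≤ ε / b ^ 2) :
    spectralRadius ℂ (X.map (algebraMap ℝ ℂ)) < 1 := by
  have hb := H.one_le
  have hb0 := H.pos
  have hε0 : 0 ≤ ε := by
    have := (norm_nonneg _).trans hX
    rw [le_div_iff₀ (by positivity), zero_mul] at this
    exact this
  have hX' : b * ‖X - S.kalmanA Sig‖ ≤ ε := by
    rw [le_div_iff₀ (by positivity)] at hX
    have := le_mul_of_one_le_left (mul_nonneg hb0.le (norm_nonneg (X - S.kalmanA Sig))) hb
    linarith
  have key : ∀ Y L : Matrix (Fin n) (Fin n) ℝ, ‖Y - L‖ = ‖X - S.kalmanA Sig‖ →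
      r = inducedNorm Sig L → spectralRadius ℂ (Y.map (algebraMap ℝ ℂ)) < 1 := by
    intro Y L hYL hrL
    have hr0 : 0 ≤ r := hrL ▸ inducedNorm_nonneg _ _
    refine spectralRadius_lt_one_of_quad H.sol.1 (ρ := r + b * ‖Y - L‖) (by positivity)
      (by rw [hYL]; linarith) fun z => ?_
    have e : Y *ᵥ z = L *ᵥ z + (Y - L) *ᵥ z := by rw [sub_mulVec]; abel
    rw [e]
    refine quad_add_le H.sol.1 hr0 (by positivity) ?_ (H.quad_Sig_mulVec_le _ z)
    rw [hrL]
    exact quad_mulVec_le_inducedNorm H.sol.1 L z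
  rcases hr with hr | hr
  · exact key X _ rfl hr
  · rw [← spectralRadius_map_transpose]
    exact key Xᵀ _ (by rw [← transpose_sub, l2_opNorm_transpose]) hr

end BoundedBy

end KFSystem

/-! ### Moments of Gaussian functionals. -/

section Gaussian

variable {k : ℕ}

/-- The linear functional `x ↦ u · x` on Euclidean space. -/
def functional (u : Fin k → ℝ) (x : EuclideanSpace ℝ (Fin k)) : ℝ := u ⬝ᵥ x.ofLp

lemma functional_eq_inner (u : Fin k → ℝ) : functional u = innerSL ℝ (WithLp.toLp 2 u) := by
  ext x
  simp [functional, PiLp.inner_apply, dotProduct, mul_comm]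

lemma measurable_functional (u : Fin k → ℝ) : Measurable (functional u) := by
  rw [functional_eq_inner]
  exact (innerSL ℝ (WithLp.toLp 2 u)).continuous.measurable

variable (a : EuclideanSpace ℝ (Fin k)) (M : Matrix (Fin k) (Fin k) ℝ)

lemma memLp_functional (u : Fin k → ℝ) : MemLp (functional u) 2 (multivariateGaussian a M) := by
  rw [functional_eq_inner]
  exact (innerSL ℝ (WithLp.toLp 2 u)).comp_memLp' IsGaussian.memLp_two_id

lemma integral_functional (u : Fin k → ℝ) :
    ∫ x, functional u x ∂(multivariateGaussian a M) = functional u a := by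
  have h := (innerSL ℝ (WithLp.toLp 2 u)).integral_comp_comm
    (IsGaussian.integrable_id (μ := multivariateGaussian a M))
  simp only [id_eq] at h
  rw [functional_eq_inner, h]
  exact congrArg _ integral_id_multivariateGaussian'

lemma integral_functional_sq {M : Matrix (Fin k) (Fin k) ℝ} (hM : M.PosDef) (u : Fin k → ℝ) :
    ∫ x, functional u x ^ 2 ∂(multivariateGaussian a M) = quad M u + functional u a ^ 2 := by
  have h1 := variance_eq_sub (memLp_functional a M u)
  have h2 : Var[functional u; multivariateGaussian a M] = quad M u := by
    have h3 := covarianceBilin_multivariateGaussian (μ := a) hM.posSemidef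
      (WithLp.toLp 2 u) (WithLp.toLp 2 u)
    rw [covarianceBilin_apply_eq_cov IsGaussian.memLp_two_id] at h3
    rw [← covariance_self (measurable_functional u).aemeasurable, quad, ← h3,
      functional_eq_inner]
    rfl
  rw [h2, integral_functional] at h1
  simp only [Pi.pow_apply] at h1
  linarith

@[simp]
lemma functional_zero (u : Fin k → ℝ) : functional u 0 = 0 := by simp [functional]

end Gaussian

namespace KFSystem

variable {n m : ℕ} (S : KFSystem n m)

/-! ### Moments and uncorrelatedness of the random inputs. -/

section Inputs

instance : IsProbabilityMeasure S.inputLaw := by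
  rw [inputLaw]; infer_instance

/-- The functionals of the initial state. -/
def init (u : Fin n → ℝ) (s : Sample n m) : ℝ := functional u s.1

/-- The functionals of the process noise. -/
def noise (k : ℕ) (u : Fin n → ℝ) (s : Sample n m) : ℝ := functional u (s.2.1 k)

/-- The functionals of the measurement noise. -/
def sensor (k : ℕ) (u : Fin m → ℝ) (s : Sample n m) : ℝ := functional u (s.2.2.1 k)

/-- The functionals of the perturbation. -/
def perturb (u : Fin n → ℝ) (s : Sample n m) : ℝ := functional u s.2.2.2

lemma measurePreserving_init :
    MeasurePreserving (fun s : Sample n m => s.1) S.inputLaw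
      (multivariateGaussian S.xbar0 S.X0) :=
  measurePreserving_fst

lemma measurePreserving_noise (k : ℕ) :
    MeasurePreserving (fun s : Sample n m => s.2.1 k) S.inputLaw (multivariateGaussian 0 S.W) :=
  (measurePreserving_eval_infinitePi (fun _ : ℕ => multivariateGaussian 0 S.W) k).comp
    (measurePreserving_fst.comp measurePreserving_snd)

lemma measurePreserving_sensor (k : ℕ) :
    MeasurePreserving (fun s : Sample n m => s.2.2.1 k) S.inputLaw (multivariateGaussian 0 S.V) :=
  (measurePreserving_eval_infinitePi (fun _ : ℕ => multivariateGaussian 0 S.V) k).comp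
    (measurePreserving_fst.comp (measurePreserving_snd.comp measurePreserving_snd))

lemma measurePreserving_perturb :
    MeasurePreserving (fun s : Sample n m => s.2.2.2) S.inputLaw (multivariateGaussian 0 S.Theta) :=
  measurePreserving_snd.comp (measurePreserving_snd.comp measurePreserving_snd)

lemma memLp_init (u : Fin n → ℝ) : MemLp (init (m := m) u) 2 S.inputLaw :=
  (memLp_functional _ _ u).comp_measurePreserving S.measurePreserving_init

lemma memLp_noise (k : ℕ) (u : Fin n → ℝ) : MemLp (noise (m := m) k u) 2 S.inputLaw :=
  (memLp_functional _ _ u).comp_measurePreserving (S.measurePreserving_noise k)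

lemma memLp_sensor (k : ℕ) (u : Fin m → ℝ) : MemLp (sensor (n := n) k u) 2 S.inputLaw :=
  (memLp_functional _ _ u).comp_measurePreserving (S.measurePreserving_sensor k)

lemma memLp_perturb (u : Fin n → ℝ) : MemLp (perturb (m := m) u) 2 S.inputLaw :=
  (memLp_functional _ _ u).comp_measurePreserving S.measurePreserving_perturb

lemma _root_.MeasureTheory.MeasurePreserving.integral_comp_of_measurable {α β : Type*}
    [MeasurableSpace α] [MeasurableSpace β] {μ : Measure α} {ν : Measure β} {f : α → β}
    (hf : MeasurePreserving f μ ν) {g : β → ℝ} (hg : Measurable g) :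
    ∫ x, g (f x) ∂μ = ∫ y, g y ∂ν := by
  rw [← hf.map_eq, integral_map hf.measurable.aemeasurable hg.aestronglyMeasurable]

lemma integral_noise (k : ℕ) (u : Fin n → ℝ) : ∫ s, noise k u s ∂S.inputLaw = 0 := by
  have := (S.measurePreserving_noise k).integral_comp_of_measurable (measurable_functional u)
  rwa [integral_functional, functional_zero] at this

lemma integral_sensor (k : ℕ) (u : Fin m → ℝ) : ∫ s, sensor k u s ∂S.inputLaw = 0 := by
  have := (S.measurePreserving_sensor k).integral_comp_of_measurable (measurable_functional u)
  rwa [integral_functional, functional_zero] at this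

lemma integral_perturb (u : Fin n → ℝ) : ∫ s, perturb u s ∂S.inputLaw = 0 := by
  have := S.measurePreserving_perturb.integral_comp_of_measurable (measurable_functional u)
  rwa [integral_functional, functional_zero] at this

variable {S} in
lemma Admissible.integral_init_sq (hS : S.Admissible) (u : Fin n → ℝ) :
    ∫ s, init u s ^ 2 ∂S.inputLaw = quad S.X0 u + (u ⬝ᵥ S.xbar0.ofLp) ^ 2 := by
  have := S.measurePreserving_init.integral_comp_of_measurable
    ((measurable_functional u).pow_const 2)
  rwa [integral_functional_sq _ hS.X0_posDef] at this

variable {S} in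
lemma Admissible.integral_noise_sq (hS : S.Admissible) (k : ℕ) (u : Fin n → ℝ) :
    ∫ s, noise k u s ^ 2 ∂S.inputLaw = quad S.W u := by
  have := (S.measurePreserving_noise k).integral_comp_of_measurable
    ((measurable_functional u).pow_const 2)
  rwa [integral_functional_sq _ hS.W_posDef, functional_zero, zero_pow two_ne_zero,
    add_zero] at this

variable {S} in
lemma Admissible.integral_sensor_sq (hS : S.Admissible) (k : ℕ) (u : Fin m → ℝ) :
    ∫ s, sensor k u s ^ 2 ∂S.inputLaw = quad S.V u := by
  have := (S.measurePreserving_sensor k).integral_comp_of_measurable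
    ((measurable_functional u).pow_const 2)
  rwa [integral_functional_sq _ hS.V_posDef, functional_zero, zero_pow two_ne_zero,
    add_zero] at this

variable {S} in
lemma Admissible.integral_perturb_sq (hS : S.Admissible) (u : Fin n → ℝ) :
    ∫ s, perturb u s ^ 2 ∂S.inputLaw = quad S.Theta u := by
  have := S.measurePreserving_perturb.integral_comp_of_measurable
    ((measurable_functional u).pow_const 2)
  rwa [integral_functional_sq _ hS.Theta_posDef, functional_zero, zero_pow two_ne_zero,
    add_zero] at this

lemma _root_.MeasureTheory.integral_mul_snd_eq_zero {α β : Type*} [MeasurableSpace α]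
    [MeasurableSpace β] {μ : Measure α} {ν : Measure β} [IsProbabilityMeasure μ]
    [IsProbabilityMeasure ν] (f : α → ℝ) {g : β → ℝ} (hg : ∫ p : α × β, g p.2 ∂(μ.prod ν) = 0) :
    ∫ p : α × β, f p.1 * g p.2 ∂(μ.prod ν) = 0 := by
  -- Pairing g with the constant 1 identifies its integral over the product with its marginal
  -- integral, with no integrability hypothesis.
  have h1 := integral_prod_mul (μ := μ) (ν := ν) (fun _ => (1 : ℝ)) g
  simp only [one_mul, integral_const, probReal_univ, smul_eq_mul] at h1
  rw [integral_prod_mul, ← h1, hg, mul_zero]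

lemma integral_comp_snd {α β : Type*} [MeasurableSpace α] [MeasurableSpace β] {μ : Measure α}
    {ν : Measure β} [IsProbabilityMeasure μ] [IsProbabilityMeasure ν] (g : β → ℝ) :
    ∫ p : α × β, g p.2 ∂(μ.prod ν) = ∫ y, g y ∂ν := by
  have h1 := integral_prod_mul (μ := μ) (ν := ν) (fun _ => (1 : ℝ)) g
  simpa using h1

lemma integral_comp_fst {α β : Type*} [MeasurableSpace α] [MeasurableSpace β] {μ : Measure α}
    {ν : Measure β} [IsProbabilityMeasure μ] [IsProbabilityMeasure ν] (g : α → ℝ) :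
    ∫ p : α × β, g p.1 ∂(μ.prod ν) = ∫ y, g y ∂μ := by
  have h1 := integral_prod_mul (μ := μ) (ν := ν) g (fun _ => (1 : ℝ))
  simpa using h1

lemma integral_init_mul_noise (u : Fin n → ℝ) (k : ℕ) (v : Fin n → ℝ) :
    ∫ s, init u s * noise k v s ∂S.inputLaw = 0 :=
  integral_mul_snd_eq_zero (μ := multivariateGaussian S.xbar0 S.X0) (functional u)
    (g := fun p : (ℕ → EuclideanSpace ℝ (Fin n)) ×
      (ℕ → EuclideanSpace ℝ (Fin m)) × EuclideanSpace ℝ (Fin n) => functional v (p.1 k))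
    (S.integral_noise k v)

lemma integral_init_mul_sensor (u : Fin n → ℝ) (k : ℕ) (v : Fin m → ℝ) :
    ∫ s, init u s * sensor k v s ∂S.inputLaw = 0 :=
  integral_mul_snd_eq_zero (μ := multivariateGaussian S.xbar0 S.X0) (functional u)
    (g := fun p : (ℕ → EuclideanSpace ℝ (Fin n)) ×
      (ℕ → EuclideanSpace ℝ (Fin m)) × EuclideanSpace ℝ (Fin n) => functional v (p.2.1 k))
    (S.integral_sensor k v)

lemma integral_init_mul_perturb (u v : Fin n → ℝ) :
    ∫ s, init (m := m) u s * perturb v s ∂S.inputLaw = 0 :=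
  integral_mul_snd_eq_zero (μ := multivariateGaussian S.xbar0 S.X0) (functional u)
    (g := fun p : (ℕ → EuclideanSpace ℝ (Fin n)) ×
      (ℕ → EuclideanSpace ℝ (Fin m)) × EuclideanSpace ℝ (Fin n) => functional v p.2.2)
    (S.integral_perturb v)

lemma integral_noise_mul_sensor (j : ℕ) (u : Fin n → ℝ) (k : ℕ) (v : Fin m → ℝ) :
    ∫ s, noise j u s * sensor k v s ∂S.inputLaw = 0 := by
  have h1 := S.integral_sensor k v
  simp only [inputLaw, sensor] at h1
  rw [integral_comp_snd (fun p : (ℕ → EuclideanSpace ℝ (Fin n)) ×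
    (ℕ → EuclideanSpace ℝ (Fin m)) × EuclideanSpace ℝ (Fin n) => functional v (p.2.1 k))] at h1
  simp only [inputLaw, noise, sensor]
  rw [integral_comp_snd (fun p : (ℕ → EuclideanSpace ℝ (Fin n)) ×
    (ℕ → EuclideanSpace ℝ (Fin m)) × EuclideanSpace ℝ (Fin n) =>
      functional u (p.1 j) * functional v (p.2.1 k))]
  exact integral_mul_snd_eq_zero (fun w : ℕ → EuclideanSpace ℝ (Fin n) => functional u (w j))
    (g := fun p : (ℕ → EuclideanSpace ℝ (Fin m)) × EuclideanSpace ℝ (Fin n) =>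
      functional v (p.1 k)) h1

lemma integral_noise_mul_perturb (j : ℕ) (u v : Fin n → ℝ) :
    ∫ s, noise (m := m) j u s * perturb v s ∂S.inputLaw = 0 := by
  have h1 := S.integral_perturb v
  simp only [inputLaw, perturb] at h1
  rw [integral_comp_snd (fun p : (ℕ → EuclideanSpace ℝ (Fin n)) ×
    (ℕ → EuclideanSpace ℝ (Fin m)) × EuclideanSpace ℝ (Fin n) => functional v p.2.2)] at h1
  simp only [inputLaw, noise, perturb]
  rw [integral_comp_snd (fun p : (ℕ → EuclideanSpace ℝ (Fin n)) ×
    (ℕ → EuclideanSpace ℝ (Fin m)) × EuclideanSpace ℝ (Fin n) =>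
      functional u (p.1 j) * functional v p.2.2)]
  exact integral_mul_snd_eq_zero (fun w : ℕ → EuclideanSpace ℝ (Fin n) => functional u (w j))
    (g := fun p : (ℕ → EuclideanSpace ℝ (Fin m)) × EuclideanSpace ℝ (Fin n) =>
      functional v p.2) h1

lemma integral_sensor_mul_perturb (j : ℕ) (u : Fin m → ℝ) (v : Fin n → ℝ) :
    ∫ s, sensor j u s * perturb v s ∂S.inputLaw = 0 := by
  have h1 := S.integral_perturb v
  simp only [inputLaw, perturb] at h1
  rw [integral_comp_snd (fun p : (ℕ → EuclideanSpace ℝ (Fin n)) ×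
    (ℕ → EuclideanSpace ℝ (Fin m)) × EuclideanSpace ℝ (Fin n) => functional v p.2.2),
    integral_comp_snd (fun p : (ℕ → EuclideanSpace ℝ (Fin m)) × EuclideanSpace ℝ (Fin n) =>
      functional v p.2)] at h1
  simp only [inputLaw, sensor, perturb]
  rw [integral_comp_snd (fun p : (ℕ → EuclideanSpace ℝ (Fin n)) ×
    (ℕ → EuclideanSpace ℝ (Fin m)) × EuclideanSpace ℝ (Fin n) =>
      functional u (p.2.1 j) * functional v p.2.2),
    integral_comp_snd (fun p : (ℕ → EuclideanSpace ℝ (Fin m)) × EuclideanSpace ℝ (Fin n) =>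
      functional u (p.1 j) * functional v p.2)]
  exact integral_mul_snd_eq_zero
    (fun w : ℕ → EuclideanSpace ℝ (Fin m) => functional u (w j)) (g := functional v) h1

lemma integral_functional_mul_functional {k : ℕ} (M : Matrix (Fin k) (Fin k) ℝ) {i j : ℕ}
    (hij : i ≠ j) (u v : Fin k → ℝ) :
    ∫ w : ℕ → EuclideanSpace ℝ (Fin k), functional u (w i) * functional v (w j)
      ∂(Measure.infinitePi fun _ : ℕ => multivariateGaussian 0 M) = 0 := by
  have h1 := iIndepFun_infinitePi
    (P := fun _ : ℕ => multivariateGaussian (0 : EuclideanSpace ℝ (Fin k)) M)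
    (X := fun _ => id) (fun _ => measurable_id)
  have h2 := (h1.indepFun hij).comp (measurable_functional u) (measurable_functional v)
  have h3 := h2.integral_fun_mul_eq_mul_integral
    (((measurable_functional u).comp (measurable_pi_apply i)).aestronglyMeasurable)
    (((measurable_functional v).comp (measurable_pi_apply j)).aestronglyMeasurable)
  have h4 := (measurePreserving_eval_infinitePi
    (fun _ : ℕ => multivariateGaussian (0 : EuclideanSpace ℝ (Fin k)) M)
    j).integral_comp_of_measurable (measurable_functional v)
  rw [integral_functional] at h4
  refine h3.trans ?_
  have h5 : ∫ w : ℕ → EuclideanSpace ℝ (Fin k), functional v (w j)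
      ∂(Measure.infinitePi fun _ : ℕ => multivariateGaussian 0 M) = 0 := by
    simpa [functional] using h4
  exact mul_eq_zero_of_right _ h5

lemma integral_noise_mul_noise {j k : ℕ} (hjk : j ≠ k) (u v : Fin n → ℝ) :
    ∫ s, noise (m := m) j u s * noise k v s ∂S.inputLaw = 0 := by
  simp only [inputLaw, noise]
  rw [integral_comp_snd (fun p : (ℕ → EuclideanSpace ℝ (Fin n)) ×
    (ℕ → EuclideanSpace ℝ (Fin m)) × EuclideanSpace ℝ (Fin n) =>
      functional u (p.1 j) * functional v (p.1 k)),
    integral_comp_fst (fun p : (ℕ → EuclideanSpace ℝ (Fin n)) =>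
      functional u (p j) * functional v (p k))]
  exact integral_functional_mul_functional S.W hjk u v

lemma integral_sensor_mul_sensor {j k : ℕ} (hjk : j ≠ k) (u v : Fin m → ℝ) :
    ∫ s, sensor (n := n) j u s * sensor k v s ∂S.inputLaw = 0 := by
  simp only [inputLaw, sensor]
  rw [integral_comp_snd (fun p : (ℕ → EuclideanSpace ℝ (Fin n)) ×
    (ℕ → EuclideanSpace ℝ (Fin m)) × EuclideanSpace ℝ (Fin n) =>
      functional u (p.2.1 j) * functional v (p.2.1 k)),
    integral_comp_snd (fun p : (ℕ → EuclideanSpace ℝ (Fin m)) × EuclideanSpace ℝ (Fin n) =>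
      functional u (p.1 j) * functional v (p.1 k)),
    integral_comp_fst (fun p : (ℕ → EuclideanSpace ℝ (Fin m)) =>
      functional u (p j) * functional v (p k))]
  exact integral_functional_mul_functional S.V hjk u v

end Inputs

end KFSystem

section Functional

variable {k l : ℕ}

lemma functional_add (u : Fin k → ℝ) (x y : EuclideanSpace ℝ (Fin k)) :
    functional u (x + y) = functional u x + functional u y := by
  simp [functional, dotProduct_add]

lemma functional_sub (u : Fin k → ℝ) (x y : EuclideanSpace ℝ (Fin k)) :
    functional u (x - y) = functional u x - functional u y := by
  simp [functional, dotProduct_sub]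

lemma functional_add_left (u v : Fin k → ℝ) (x : EuclideanSpace ℝ (Fin k)) :
    functional (u + v) x = functional u x + functional v x := by
  simp [functional, add_dotProduct]

lemma functional_sub_left (u v : Fin k → ℝ) (x : EuclideanSpace ℝ (Fin k)) :
    functional (u - v) x = functional u x - functional v x := by
  simp [functional, sub_dotProduct]

lemma functional_neg_left (u : Fin k → ℝ) (x : EuclideanSpace ℝ (Fin k)) :
    functional (-u) x = -functional u x := by
  simp [functional]

lemma functional_toEuclideanLin (M : Matrix (Fin k) (Fin l) ℝ) (u : Fin k → ℝ)
    (x : EuclideanSpace ℝ (Fin l)) :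
    functional u (toEuclideanLin M x) = functional (Mᵀ *ᵥ u) x := by
  simp only [functional, toLpLin_apply]
  rw [dotProduct_mulVec, mulVec_transpose]

lemma sum_functional_single_sq (x : EuclideanSpace ℝ (Fin k)) :
    ‖x‖ ^ 2 = ∑ i, functional (Pi.single i 1) x ^ 2 := by
  rw [EuclideanSpace.real_norm_sq_eq]
  simp [functional]

end Functional

lemma _root_.MeasureTheory.integral_add_sq {α : Type*} [MeasurableSpace α] {μ : Measure α}
    {f g : α → ℝ} (hf : MemLp f 2 μ) (hg : MemLp g 2 μ) (h : ∫ x, f x * g x ∂μ = 0) :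
    ∫ x, (f x + g x) ^ 2 ∂μ = ∫ x, f x ^ 2 ∂μ + ∫ x, g x ^ 2 ∂μ := by
  have h1 : ∀ x, (f x + g x) ^ 2 = f x ^ 2 + g x ^ 2 + 2 * (f x * g x) := fun x => by ring
  have h2 : Integrable (fun x => f x * g x) μ := hf.integrable_mul hg
  have h3 : Integrable (fun x => f x ^ 2 + g x ^ 2) μ := hf.integrable_sq.add hg.integrable_sq
  simp only [h1]
  rw [integral_add h3 (h2.const_mul 2), integral_add hf.integrable_sq hg.integrable_sq,
    integral_const_mul, h, mul_zero, add_zero]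

/-! ### Trajectories and the cost as a sum of squares. -/

namespace KFSystem

variable {n m : ℕ} (S : KFSystem n m)

/-- A square-integrable variable that is uncorrelated with the noise from time `t` on and with the
perturbation. -/
structure Past (t : ℕ) (Y : Sample n m → ℝ) : Prop where
  memLp : MemLp Y 2 S.inputLaw
  noise : ∀ k, t ≤ k → ∀ u, ∫ s, Y s * noise k u s ∂S.inputLaw = 0
  sensor : ∀ k, t ≤ k → ∀ u, ∫ s, Y s * sensor k u s ∂S.inputLaw = 0
  perturb : ∀ u, ∫ s, Y s * perturb u s ∂S.inputLaw = 0

namespace Past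

variable {S} {t : ℕ} {Y Z : Sample n m → ℝ}

lemma mono (hY : S.Past t Y) {t' : ℕ} (h : t ≤ t') : S.Past t' Y :=
  ⟨hY.memLp, fun k hk => hY.noise k (h.trans hk), fun k hk => hY.sensor k (h.trans hk),
    hY.perturb⟩

lemma integral_add_mul {R : Sample n m → ℝ} (hY : MemLp Y 2 S.inputLaw)
    (hZ : MemLp Z 2 S.inputLaw) (hR : MemLp R 2 S.inputLaw)
    (h1 : ∫ s, Y s * R s ∂S.inputLaw = 0) (h2 : ∫ s, Z s * R s ∂S.inputLaw = 0) :
    ∫ s, (Y s + Z s) * R s ∂S.inputLaw = 0 := by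
  have e1 : Integrable (fun s => Y s * R s) S.inputLaw := hY.integrable_mul hR
  have e2 : Integrable (fun s => Z s * R s) S.inputLaw := hZ.integrable_mul hR
  simp only [add_mul]
  rw [integral_add e1 e2, h1, h2, add_zero]

lemma add (hY : S.Past t Y) (hZ : S.Past t Z) : S.Past t (fun s => Y s + Z s) where
  memLp := hY.memLp.add hZ.memLp
  noise k hk u := integral_add_mul hY.memLp hZ.memLp (S.memLp_noise k u) (hY.noise k hk u)
    (hZ.noise k hk u)
  sensor k hk u := integral_add_mul hY.memLp hZ.memLp (S.memLp_sensor k u) (hY.sensor k hk u)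
    (hZ.sensor k hk u)
  perturb u := integral_add_mul hY.memLp hZ.memLp (S.memLp_perturb u) (hY.perturb u)
    (hZ.perturb u)

end Past

lemma past_const (t : ℕ) (c : ℝ) : S.Past t (fun _ => c) where
  memLp := memLp_const c
  noise _ _ _ := by rw [integral_const_mul, integral_noise, mul_zero]
  sensor k _ u := by rw [integral_const_mul, integral_sensor, mul_zero]
  perturb u := by rw [integral_const_mul, integral_perturb, mul_zero]

lemma past_init (t : ℕ) (u : Fin n → ℝ) : S.Past t (init u) where
  memLp := S.memLp_init u
  noise k _ := S.integral_init_mul_noise u k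
  sensor k _ := S.integral_init_mul_sensor u k
  perturb := S.integral_init_mul_perturb u

lemma past_noise (t : ℕ) (u : Fin n → ℝ) : S.Past (t + 1) (noise t u) where
  memLp := S.memLp_noise t u
  noise k hk := S.integral_noise_mul_noise (Nat.ne_of_lt hk) u
  sensor k _ := S.integral_noise_mul_sensor t u k
  perturb := S.integral_noise_mul_perturb t u

lemma past_sensor (t : ℕ) (u : Fin m → ℝ) : S.Past (t + 1) (sensor t u) where
  memLp := S.memLp_sensor t u
  noise k _ v := by
    simp only [mul_comm (KFSystem.sensor t u _)]
    exact S.integral_noise_mul_sensor k v t u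
  sensor k hk := S.integral_sensor_mul_sensor (Nat.ne_of_lt hk) u
  perturb := S.integral_sensor_mul_perturb t u

lemma integral_init (u : Fin n → ℝ) :
    ∫ s, init u s ∂S.inputLaw = u ⬝ᵥ S.xbar0.ofLp := by
  have := S.measurePreserving_init.integral_comp_of_measurable (measurable_functional u)
  rwa [integral_functional] at this

/-- The state trajectory without perturbation. -/
def freeState (s : Sample n m) : ℕ → EuclideanSpace ℝ (Fin n)
  | 0 => s.1
  | t + 1 => toEuclideanLin S.A (freeState s t) + s.2.1 t

variable (π : ℕ → FilterGain n m)

/-- The estimates without perturbation. -/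
def freeEstimate (s : Sample n m) : ℕ → EuclideanSpace ℝ (Fin n)
  | 0 => S.xbar0
  | t + 1 => toEuclideanLin (π t).1 (freeEstimate s t)
      + toEuclideanLin (π t).2 (toEuclideanLin S.C (S.freeState s t) + s.2.2.1 t)

/-- The linear combinations of the unperturbed state and its estimate. -/
def comb (t : ℕ) (f g : Fin n → ℝ) (s : Sample n m) : ℝ :=
  functional f (S.freeState s t) + functional g (S.freeEstimate π s t)

lemma comb_succ (t : ℕ) (f g : Fin n → ℝ) (s : Sample n m) :
    S.comb π (t + 1) f g s =
      S.comb π t (S.Aᵀ *ᵥ f + S.Cᵀ *ᵥ (π t).2ᵀ *ᵥ g) ((π t).1ᵀ *ᵥ g) s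
        + noise t f s + sensor t ((π t).2ᵀ *ᵥ g) s := by
  simp only [comb, freeState, freeEstimate, functional_add, functional_toEuclideanLin,
    functional_add_left, noise, sensor]
  ring

/-- State and estimate at time t involve only noise from earlier times. The cost is quadratic, so
uncorrelatedness with the later noise and with θ₀ is all that is needed. -/
lemma past_comb (t : ℕ) (f g : Fin n → ℝ) : S.Past t (S.comb π t f g) := by
  induction t generalizing f g with
  | zero => exact (S.past_init 0 f).add (S.past_const 0 (functional g S.xbar0))
  | succ t ih =>
    rw [funext (S.comb_succ π t f g)]
    exact (((ih _ _).mono t.le_succ).add (S.past_noise t f)).add (S.past_sensor t _)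

variable {S} {π}

lemma Past.integral_add_noise_add_sensor_sq {t : ℕ} {Y : Sample n m → ℝ} (hY : S.Past t Y)
    (hS : S.Admissible) (u : Fin n → ℝ) (v : Fin m → ℝ) :
    ∫ s, (Y s + KFSystem.noise t u s + KFSystem.sensor t v s) ^ 2 ∂S.inputLaw =
      ∫ s, Y s ^ 2 ∂S.inputLaw + quad S.W u + quad S.V v := by
  have h1 := integral_add_mul hY.memLp (S.memLp_noise t u) (S.memLp_sensor t v)
    (hY.sensor t le_rfl v) (S.integral_noise_mul_sensor t u t v)
  have h2 : MemLp (fun s => Y s + KFSystem.noise t u s) 2 S.inputLaw :=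
    hY.memLp.add (S.memLp_noise t u)
  rw [integral_add_sq h2 (S.memLp_sensor t v) h1,
    integral_add_sq hY.memLp (S.memLp_noise t u) (hY.noise t le_rfl u),
    hS.integral_noise_sq, hS.integral_sensor_sq]

lemma Admissible.integral_comb_sq (hS : S.Admissible) (t : ℕ) (f g : Fin n → ℝ) :
    ∫ s, S.comb π t f g s ^ 2 ∂S.inputLaw = S.joint π t f g := by
  induction t generalizing f g with
  | zero =>
    have hi := S.memLp_init f
    have h1 : ∀ s, S.comb π 0 f g s ^ 2 =
        init f s ^ 2 + 2 * functional g S.xbar0 * init f s + functional g S.xbar0 ^ 2 := fun s => by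
      simp only [comb, freeState, freeEstimate, init]
      ring
    have h2 : Integrable (fun s => 2 * functional g S.xbar0 * init f s) S.inputLaw :=
      (hi.integrable one_le_two).const_mul _
    have h3 : Integrable (fun s => init f s ^ 2 + 2 * functional g S.xbar0 * init f s)
        S.inputLaw := hi.integrable_sq.add h2
    simp only [h1]
    rw [integral_add h3 (integrable_const _), integral_add hi.integrable_sq h2, integral_const_mul,
      hS.integral_init_sq, integral_init, joint_zero, add_dotProduct, integral_const]
    simp only [functional, probReal_univ, smul_eq_mul]
    ring
  | succ t ih =>
    simp only [comb_succ]
    rw [(S.past_comb π t _ _).integral_add_noise_add_sensor_sq hS, ih, hS.joint_succ]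

lemma state_of_lt (s : Sample n m) {h t : ℕ} (ht : t < h) : S.state h s t = S.freeState s t := by
  induction t with
  | zero => simp [state, freeState, injection, ht.ne]
  | succ t ih => simp [state, freeState, injection, ht.ne, ih (t.lt_succ_self.trans ht)]

lemma state_self (s : Sample n m) (h : ℕ) : S.state h s h = S.freeState s h + s.2.2.2 := by
  cases h with
  | zero => simp [state, freeState, injection]
  | succ h => simp [state, freeState, injection, state_of_lt s h.lt_succ_self]

lemma estimate_of_lt (s : Sample n m) {h t : ℕ} (ht : t < h) (q : FilterGain n m) :
    S.estimate h (Function.update π h q) s t = S.freeEstimate π s t := by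
  induction t with
  | zero => simp [estimate, freeEstimate, injection, ht.ne]
  | succ t ih =>
    have ht' := t.lt_succ_self.trans ht
    simp [estimate, freeEstimate, injection, output, ht.ne, ih ht', ht'.ne, state_of_lt s ht']

lemma estimate_self (s : Sample n m) (h : ℕ) (q : FilterGain n m) :
    S.estimate h (Function.update π h q) s h = S.freeEstimate π s h + s.2.2.2 := by
  cases h with
  | zero => simp [estimate, freeEstimate, injection]
  | succ h =>
    simp [estimate, freeEstimate, injection, output, state_of_lt s h.lt_succ_self,
      estimate_of_lt s h.lt_succ_self]

/-- At time h the perturbation enters state and estimate alike and cancels, so the decision variable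
of subproblem h affects only the last error. -/
lemma error_of_le (s : Sample n m) {h t : ℕ} (ht : t ≤ h) (q : FilterGain n m) :
    S.state h s t - S.estimate h (Function.update π h q) s t =
      S.freeState s t - S.freeEstimate π s t := by
  rcases ht.lt_or_eq with ht | rfl
  · rw [state_of_lt s ht, estimate_of_lt s ht]
  · rw [state_self, estimate_self, add_sub_add_right_eq_sub]

lemma functional_error_succ (s : Sample n m) (h : ℕ) (q : FilterGain n m) (u : Fin n → ℝ) :
    functional u (S.state h s (h + 1) - S.estimate h (Function.update π h q) s (h + 1)) =
      S.comb π h (S.Aᵀ *ᵥ u - S.Cᵀ *ᵥ q.2ᵀ *ᵥ u) (-(q.1ᵀ *ᵥ u)) s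
        + perturb (S.Aᵀ *ᵥ u - S.Cᵀ *ᵥ q.2ᵀ *ᵥ u + -(q.1ᵀ *ᵥ u)) s
        + noise h u s + sensor h (-(q.2ᵀ *ᵥ u)) s := by
  simp only [state, estimate, output, state_self, estimate_self, injection, Function.update_self,
    Nat.succ_ne_self, if_false, functional_sub, functional_add, functional_toEuclideanLin,
    functional_add_left, functional_sub_left, functional_neg_left, functional_zero, comb, perturb,
    noise, sensor]
  ring

lemma memLp_error_succ (h : ℕ) (q : FilterGain n m) (u : Fin n → ℝ) :
    MemLp (fun s => functional u
      (S.state h s (h + 1) - S.estimate h (Function.update π h q) s (h + 1))) 2 S.inputLaw := by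
  simp only [functional_error_succ]
  exact (((S.past_comb π h _ _).memLp.add (S.memLp_perturb _)).add (S.memLp_noise h u)).add
    (S.memLp_sensor h _)

/-- Two completions of squares: regression of the state on the perturbed estimate, then the Riccati
square in the gain for the residual covariance. -/
lemma Admissible.integral_error_succ_sq (hS : S.Admissible) (h : ℕ) (q : FilterGain n m)
    (u : Fin n → ℝ) :
    ∫ s, functional u (S.state h s (h + 1) - S.estimate h (Function.update π h q) s (h + 1)) ^ 2
        ∂S.inputLaw =
      quad (S.ric (S.residual π h)) u
        + (quad (S.innov (S.residual π h)) ((q.2 - S.optB π h)ᵀ *ᵥ u)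
          + quad (S.regMoment π h) (((S.A - q.2 * S.C) * S.regression π h - q.1)ᵀ *ᵥ u)) := by
  have hP := hS.residual_posDef (π := π) h
  simp only [functional_error_succ]
  set f := S.Aᵀ *ᵥ u - S.Cᵀ *ᵥ q.2ᵀ *ᵥ u with hf
  set g := -(q.1ᵀ *ᵥ u) with hg
  have hY := S.past_comb π h f g
  have e1 : ∀ s : Sample n m, (S.comb π h f g s + perturb (f + g) s + noise h u s
      + sensor h (-(q.2ᵀ *ᵥ u)) s) =
      (S.comb π h f g s + noise h u s + sensor h (-(q.2ᵀ *ᵥ u)) s) + perturb (f + g) s :=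
    fun s => by ring
  have hY' := ((hY.mono h.le_succ).add (S.past_noise h u)).add (S.past_sensor h (-(q.2ᵀ *ᵥ u)))
  have e2 : (S.regression π h)ᵀ *ᵥ f + g =
      ((S.A - q.2 * S.C) * S.regression π h - q.1)ᵀ *ᵥ u := by
    rw [hf, hg]
    simp only [transpose_sub, transpose_mul, sub_mulVec, ← mulVec_mulVec, mulVec_sub]
    rw [← sub_eq_add_neg]
  have h1 := hS.joint_add_quad_Theta (π := π) h f g
  have h2 := quad_ric_add (hS.innov_posDef hP) hP.transpose_eq u (q.2ᵀ *ᵥ u)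
  rw [← hf] at h2
  simp only [e1]
  rw [integral_add_sq hY'.memLp (S.memLp_perturb _) (hY'.perturb _),
    hY.integral_add_noise_add_sensor_sq hS, hS.integral_comb_sq, hS.integral_perturb_sq,
    quad_neg_vec, ← e2, transpose_sub, sub_mulVec, optB]
  linarith

lemma integrable_error (π : ℕ → FilterGain n m) (t : ℕ) :
    Integrable (fun s => ‖S.freeState s t - S.freeEstimate π s t‖ ^ 2) S.inputLaw := by
  have h1 : ∀ s, ‖S.freeState s t - S.freeEstimate π s t‖ ^ 2 =
      ∑ i, S.comb π t (Pi.single i 1) (-Pi.single i 1) s ^ 2 := fun s => by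
    simp only [sum_functional_single_sq, comb, functional_sub, functional_neg_left]
    simp only [sub_eq_add_neg]
  simp only [h1]
  exact integrable_finsetSum _ fun i _ => (S.past_comb π t _ _).memLp.integrable_sq

/-- The objective of a subproblem as a sum of squares. -/
lemma Admissible.exists_cost_eq (hS : S.Admissible) (π : ℕ → FilterGain n m) (h : ℕ) :
    ∃ K : ℝ, ∀ q : FilterGain n m, S.cost π h q = K +
      ∑ i, (quad (S.innov (S.residual π h)) ((q.2 - S.optB π h)ᵀ *ᵥ Pi.single i 1)
        + quad (S.regMoment π h)
            (((S.A - q.2 * S.C) * S.regression π h - q.1)ᵀ *ᵥ Pi.single i 1)) := by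
  refine ⟨∫ s, ∑ t ∈ Finset.range (h + 1), ‖S.freeState s t - S.freeEstimate π s t‖ ^ 2
    ∂S.inputLaw + ∑ i, quad (S.ric (S.residual π h)) (Pi.single i 1), fun q => ?_⟩
  have h1 : ∀ s, ∑ t ∈ Finset.range (h + 2),
      ‖S.state h s t - S.estimate h (Function.update π h q) s t‖ ^ 2 =
      ∑ t ∈ Finset.range (h + 1), ‖S.freeState s t - S.freeEstimate π s t‖ ^ 2
        + ∑ i, functional (Pi.single i 1)
          (S.state h s (h + 1) - S.estimate h (Function.update π h q) s (h + 1)) ^ 2 := fun s => by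
    rw [Finset.sum_range_succ, sum_functional_single_sq]
    congr 1
    exact Finset.sum_congr rfl fun t ht => by
      rw [error_of_le s (Nat.lt_succ_iff.1 (Finset.mem_range.1 ht))]
  rw [cost]
  simp only [h1]
  rw [integral_add (integrable_finsetSum _ fun t _ => integrable_error π t)
      (integrable_finsetSum _ fun i _ => (memLp_error_succ h q _).integrable_sq),
    integral_finsetSum _ fun i _ => (memLp_error_succ h q _).integrable_sq]
  simp only [hS.integral_error_succ_sq]
  rw [Finset.sum_add_distrib, add_assoc]

lemma eq_zero_of_transpose_mulVec_single {k l : ℕ} {M : Matrix (Fin k) (Fin l) ℝ}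
    (h : ∀ i, Mᵀ *ᵥ Pi.single i 1 = 0) : M = 0 := by
  ext i j
  simpa using congrFun (h i) j

/-- Both forms are positive definite, so the cost attains its constant term only if both arguments
vanish on every basis vector. The second vanishing argument then fixes the state matrix in terms of
the optimal gain. -/
lemma Admissible.isMinimizer_iff (hS : S.Admissible) (π : ℕ → FilterGain n m) (h : ℕ)
    (q : FilterGain n m) : S.IsMinimizer π h q ↔ q = (S.optA π h, S.optB π h) := by
  obtain ⟨K, hK⟩ := hS.exists_cost_eq π h
  have hI := hS.innov_posDef (hS.residual_posDef (π := π) h)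
  have hM := hS.regMoment_posDef (π := π) h
  have hopt : S.cost π h (S.optA π h, S.optB π h) = K := by
    rw [hK]
    simp only [optA, optB, kalmanA, sub_self, transpose_zero, zero_mulVec, quad_zero_vec, add_zero,
      Finset.sum_const_zero]
  refine ⟨fun hq => ?_, ?_⟩
  · have h1 := hq (S.optA π h, S.optB π h)
    rw [hopt, hK, add_le_iff_nonpos_right] at h1
    have h2 := (Finset.sum_eq_zero_iff_of_nonneg fun i _ =>
      add_nonneg (hI.quad_nonneg _) (hM.quad_nonneg _)).1
      (le_antisymm h1 (Finset.sum_nonneg fun i _ =>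
        add_nonneg (hI.quad_nonneg _) (hM.quad_nonneg _)))
    have h3 := fun i => (add_eq_zero_iff_of_nonneg (hI.quad_nonneg _) (hM.quad_nonneg _)).1
      (h2 i (Finset.mem_univ i))
    have h4 : q.2 - S.optB π h = 0 := eq_zero_of_transpose_mulVec_single fun i => by
      by_contra hne
      exact (hI.quad_pos hne).ne' (h3 i).1
    have h5 : (S.A - q.2 * S.C) * S.regression π h - q.1 = 0 :=
      eq_zero_of_transpose_mulVec_single fun i => by
        by_contra hne
        exact (hM.quad_pos hne).ne' (h3 i).2
    rw [sub_eq_zero] at h4 h5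
    rw [h4] at h5
    exact Prod.ext h5.symm h4
  · rintro rfl q'
    rw [hopt, hK]
    exact le_add_of_nonneg_right (Finset.sum_nonneg fun i _ =>
      add_nonneg (hI.quad_nonneg _) (hM.quad_nonneg _))

end KFSystem

/-! ### Assembly of the polynomial and the final estimate. -/

lemma norm_fromCols_le {ι κ l : Type*} [Fintype ι] [Fintype κ] [Fintype l] [DecidableEq ι]
    [DecidableEq κ] [DecidableEq l] (X : Matrix l ι ℝ) (Y : Matrix l κ ℝ) :
    ‖fromCols X Y‖ ≤ ‖X‖ + ‖Y‖ := by
  rw [← l2_opNorm_transpose]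
  refine l2_opNorm_le_of_mulVec (by positivity) fun u => ?_
  have h1 := mulVec_self_le Xᵀ u
  have h2 := mulVec_self_le Yᵀ u
  rw [l2_opNorm_transpose] at h1 h2
  have h3 : 0 ≤ ‖X‖ * ‖Y‖ * (u ⬝ᵥ u) := by
    have := dotProduct_self_nonneg' u
    positivity
  rw [transpose_fromCols, fromRows_mulVec, sumElim_dotProduct_sumElim]
  nlinarith

namespace KFSystem

variable {n m : ℕ} {S : KFSystem n m} {Sig : Matrix (Fin n) (Fin n) ℝ}

lemma params_nonneg (S : KFSystem n m) (Sig : Matrix (Fin n) (Fin n) ℝ) (i : Fin 12) :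
    0 ≤ S.params Sig i := by
  fin_cases i <;> exact norm_nonneg _

lemma boundedBy_of_params (hS : S.Admissible) (hSig : S.IsFARESolution Sig) {b : ℝ}
    (hb : 100 ≤ b) (h : ∀ i, S.params Sig i ≤ b) : S.BoundedBy Sig b :=
  ⟨hS, hSig, hb, h 0, h 1, h 2, h 3, h 4, h 5, h 6, h 7, h 8, h 9, h 10, h 11⟩

end KFSystem

/-- A polynomial bound of all the parameters. -/
def boundPoly (c : ℝ) (k : ℕ) : MvPolynomial (Fin 12) ℝ :=
  MvPolynomial.C (100 + c) * (1 + ∑ i, MvPolynomial.X i) ^ (k + 1)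

lemma eval_boundPoly (c : ℝ) (k : ℕ) (x : Fin 12 → ℝ) :
    MvPolynomial.eval x (boundPoly c k) = (100 + c) * (1 + ∑ i, x i) ^ (k + 1) := by
  simp [boundPoly]

lemma mul_pow_le_eval_boundPoly {c : ℝ} (hc : 0 ≤ c) (k : ℕ) {x : Fin 12 → ℝ} (hx : ∀ i, 0 ≤ x i)
    (i : Fin 12) : (100 + c) * (1 + x i) ^ k * (1 + x i) ≤ MvPolynomial.eval x (boundPoly c k) := by
  rw [eval_boundPoly, mul_assoc, ← pow_succ]
  have h1 := Finset.single_le_sum (f := x) (fun j _ => hx j) (Finset.mem_univ i)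
  have h2 := hx i
  gcongr

end RHPG

end

theorem theorem2 (n m : ℕ) :
    ∃ p : MvPolynomial (Fin 12) ℝ,
      ∀ S : RHPG.KFSystem n m, S.Admissible →
      ∀ Sig : Matrix (Fin n) (Fin n) ℝ, S.IsFARESolution Sig →
        0 < MvPolynomial.eval (S.params Sig) p ∧
        RHPG.inducedNorm Sig (S.kalmanA Sig)ᵀ < 1 ∧
        (∀ (π : ℕ → RHPG.FilterGain n m) (h : ℕ), ∃! q, S.IsMinimizer π h q) ∧
        ∀ r : ℝ,
          (r = RHPG.inducedNorm Sig (S.kalmanA Sig) ∨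
            r = RHPG.inducedNorm Sig (S.kalmanA Sig)ᵀ) →
          r < 1 →
          ∀ ε : ℝ, 0 < ε →
          ∀ N : ℕ, 1 ≤ N →
            S.horizonBound Sig r (ε / MvPolynomial.eval (S.params Sig) p) ≤ (N : ℝ) →
          ∀ π πs : ℕ → RHPG.FilterGain n m,
            (∀ h < N, S.IsMinimizer π h (πs h) ∧
              ‖(π h).1 - (πs h).1‖ ≤ min ε 1 / MvPolynomial.eval (S.params Sig) p ∧
              ‖(π h).2 - (πs h).2‖ ≤ min ε 1 / MvPolynomial.eval (S.params Sig) p) →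
            ‖Matrix.fromCols (π (N - 1)).1 (π (N - 1)).2
                - Matrix.fromCols (S.kalmanA Sig) (S.kalmanGain Sig)‖ ≤ ε ∧
            (ε < 1 - r →
              spectralRadius ℂ ((π (N - 1)).1.map (algebraMap ℝ ℂ)) < 1) := by
  obtain ⟨c, k, hc, hstein⟩ := RHPG.exists_stein_solution n
  -- With b the value of `boundPoly`, the polynomial p evaluates to b⁸⁵, the accuracy denominator
  -- required in `norm_filter_sub_le`.
  refine ⟨RHPG.boundPoly c k ^ 85, fun S hS Sig hSig => ?_⟩
  rw [map_pow]
  have hx := S.params_nonneg Sig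
  have hle := RHPG.mul_pow_le_eval_boundPoly hc k hx
  generalize MvPolynomial.eval (S.params Sig) (RHPG.boundPoly c k) = b at hle
  have hge : ∀ i, 100 + c ≤ (100 + c) * (1 + S.params Sig i) ^ k := fun i =>
    le_mul_of_one_le_right (by linarith) (one_le_pow₀ (by linarith [hx i]))
  have hpar : ∀ i, 100 * (1 + S.params Sig i) ≤ b := fun i =>
    (mul_le_mul_of_nonneg_right (by linarith [hge i]) (by linarith [hx i])).trans (hle i)
  have H : S.BoundedBy Sig b := RHPG.KFSystem.boundedBy_of_params hS hSig
    (by linarith [hpar 0, hx 0]) fun i => by linarith [hpar i, hx i]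
  have hb0 := H.pos
  obtain ⟨Q, s, hQt, hs0, hs1, hQ, hQA⟩ := hstein S.A
  have hQb : ‖Q‖ ≤ b := by
    have h1 : (1 : ℝ) ≤ 1 + ‖S.A‖ := le_add_of_nonneg_right (norm_nonneg _)
    have h2 : (0 : ℝ) ≤ (1 + ‖S.A‖) ^ k := by positivity
    have h3 : (100 + c) * (1 + ‖S.A‖) ^ k * (1 + ‖S.A‖) ≤ b := hle 0
    refine hQ.trans (le_trans ?_ h3)
    calc c * (1 + ‖S.A‖) ^ k ≤ (100 + c) * (1 + ‖S.A‖) ^ k :=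
          mul_le_mul_of_nonneg_right (by linarith) h2
      _ ≤ (100 + c) * (1 + ‖S.A‖) ^ k * (1 + ‖S.A‖) :=
          le_mul_of_one_le_right (by positivity) h1
  refine ⟨by positivity, H.inducedNorm_kalmanA_transpose_lt, fun π h => ?_, ?_⟩
  · exact ⟨_, (hS.isMinimizer_iff π h _).2 rfl, fun q hq => (hS.isMinimizer_iff π h q).1 hq⟩
  · intro r hr hr1 ε hε N hN hhor π πs hπ
    have hopt : ∀ t < N, ‖(π t).1 - S.optA π t‖ ≤ min ε 1 / b ^ 85 ∧
        ‖(π t).2 - S.optB π t‖ ≤ min ε 1 / b ^ 85 := fun t ht => by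
      obtain ⟨h1, h2⟩ := hπ t ht
      rw [(hS.isMinimizer_iff π t _).1 h1] at h2
      exact h2
    obtain ⟨hA, hB⟩ := H.norm_filter_sub_le hs0 hs1 hQb hQt hQA hr hr1 hε hN hhor hopt
    refine ⟨?_, fun hεr => H.spectralRadius_lt_one hr hεr hA⟩
    have h1 : Matrix.fromCols (π (N - 1)).1 (π (N - 1)).2
        - Matrix.fromCols (S.kalmanA Sig) (S.kalmanGain Sig) =
        Matrix.fromCols ((π (N - 1)).1 - S.kalmanA Sig) ((π (N - 1)).2 - S.kalmanGain Sig) := by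
      ext i (j | j) <;> simp
    -- The block norm is at most the sum of the two block norms, each of which may use half of ε.
    have h2 : ε / b ^ 2 ≤ ε / 2 :=
      div_le_div_of_nonneg_left hε.le two_pos (by nlinarith [H.large])
    rw [h1]
    linarith [RHPG.norm_fromCols_le ((π (N - 1)).1 - S.kalmanA Sig)
      ((π (N - 1)).2 - S.kalmanGain Sig)]
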